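/- **Setting.** Let $d\ge 2$, $\mathbb T^d=(\mathbb R/\mathbb Z)^d$, $T>0$, $\gamma>1$, and let $\mu,\lambda$ be real constants with $\mu\ge 0$ and $2\mu+d\lambda>0$. Consider the isentropic compressible Navier–Stokes system on $(0,T)\times\mathbb T^d$ $$\partial_t\varrho+\operatorname{div}(\varrho v)=0,\qquad \partial_t(\varrho v)+\operatorname{div}(\varrho v\otimes v)+\nabla\varrho^\gamma-\mu\Delta v-(\mu+\lambda)\nabla\operatorname{div}v=0,$$ with initial data $\varrho(0)=\varrho_0\ge 0$, $(\varrho v)(0)=\varrho_0v_0$, where $v_0=0$ on $\{\varrho_0=0\}$. Put $E(\varrho,v)=\int_{\mathbb T^d}\big(\tfrac12\varrho|v|^2+\tfrac{\varrho^\gamma}{\gamma-1}\big)dx$ and assume $E(\varrho_0,v_0)<\infty$. A pair $(\varrho,v)$ with $\varrho\ge0$ is a *weak solution* if (i) the equations, with their initial data, hold in the sense of distributions (tested with $C_c^\infty([0,T)\times\mathbb T^d)$), and $\varrho^\gamma,\ \varrho|v|^2\in L^\infty(0,T;L^1(\mathbb T^d))$, $\nabla v\in L^2(0,T;L^2(\mathbb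 T^d))$; (ii) $\varrho$ is a renormalized solution of the mass equation: $\partial_tb(\varrho)+\operatorname{div}(b(\varrho)v)+(b'(\varrho)\varrho-b(\varrho))\operatorname{div}v=0$ in $\mathcal D'((0,T)\times\mathbb T^d)$ for every $b\in C^1$ with $b'(z)=0$ for all large $z$; (iii) for a.e. $t\in(0,T)$, $$E(\varrho,v)(t)+\int_0^t\!\!\int_{\mathbb T^d}\big(\mu|\nabla v|^2+(\mu+\lambda)|\operatorname{div}v|^2\big)\,dx\,ds\le E(\varrho_0,v_0).$$ **Theorem 1.5.** Let $p,q,k,l$ be real numbers with $p>3$, $q>\max\{3,\frac{d(p-3)}2\}$, $$k>\max\Big\{\tfrac{p}{2(p-3)},\ \tfrac{p}{p-2},\ \tfrac{(\gamma-1)p}{2},\ \tfrac{(\gamma-1)(d+q)p}{2q-d(p-3)}\Big\},\qquad l>\max\Big\{\tfrac{q}{2(q-3)},\ \tfrac{q}{q-2},\ \tfrac{(\gamma-1)q}{2}\Big\}.$$ Let $(\varrho,v)$ be a weak solution, vacuum being allowed, such that $$0\le\varrho\in L^k(0,T;L^l(\mathbb T^d)),\qquad \nabla\sqrt\varrho\in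 L^{\frac{2pk}{2k(p-3)-p}}\big(0,T;L^{\frac{2lq}{2l(q-3)-q}}(\mathbb T^d)\big),$$ $$v\in L^p(0,T;L^q(\mathbb T^d)),\qquad \nabla v\in L^{\frac{pk}{k(p-2)-p}}\big(0,T;L^{\frac{ql}{l(q-2)-q}}(\mathbb T^d)\big),\qquad v_0\in L^{\max\{\frac{2\gamma}{\gamma-1},\frac q2\}}(\mathbb T^d).$$ Then, after redefinition of $(\varrho,v)$ at a null set of times $t$, one has $\varrho\in C([0,T];L^\gamma_{\rm weak}(\mathbb T^d))$ and $\varrho v\in C([0,T];L^{2\gamma/(\gamma+1)}_{\rm weak}(\mathbb T^d))$, with values $\varrho_0$ and $\varrho_0v_0$ at $t=0$, and for **every** $t\in[0,T]$ all the integrals below are finite and $$\int_{\mathbb T^d}\Big(\tfrac12\varrho|v|^2+\tfrac{\varrho^\gamma}{\gamma-1}\Big)(t)\,dx+\int_0^t\!\!\int_{\mathbb T^d}\big(\mu|\nabla v|^2+(\mu+\lambda)|\operatorname{div}v|^2\big)\,dx\,ds=\int_{\mathbb T^d}\Big(\tfrac12\varrho_0|v_0|^2+\tfrac{\varrho_0^\gamma}{\gamma-1}\Big)dx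 .$$ -/

import Mathlib

open MeasureTheory Set
open scoped ENNReal

noncomputable section

namespace CNS

/-- The flat torus `𝕋ᵈ = (ℝ/ℤ)ᵈ`, with its Haar probability measure `volume`. -/
abbrev Torus (d : ℕ) : Type := UnitAddTorus (Fin d)

/-- Vectors of `ℝᵈ` with the Euclidean norm. -/
abbrev Vec (d : ℕ) : Type := EuclideanSpace ℝ (Fin d)

/-- `d × d` matrices with the Frobenius norm; for a velocity gradient the entry at `(i, j)`
is `∂ⱼ vᵢ`. -/
abbrev Mat (d : ℕ) : Type := EuclideanSpace ℝ (Fin d × Fin d)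

/-- The product measure `dt ⊗ dx` on `(0,T) × 𝕋ᵈ`. -/
def spaceTime (d : ℕ) (T : ℝ) : Measure (ℝ × Torus d) :=
  (volume.restrict (Ioo 0 T)).prod volume

/-- `f ∈ Lᵖ(0,T; L^q(𝕋ᵈ))`. Time-space fields are functions of `t : ℝ` and `x : 𝕋ᵈ`, of which
only the values for `t ∈ (0,T)`, up to null sets, are used. -/
def MemLpLq {d : ℕ} {F : Type*} [NormedAddCommGroup F] (T : ℝ) (p q : ℝ≥0∞)
    (f : ℝ → Torus d → F) : Prop :=
  AEStronglyMeasurable (fun z : ℝ × Torus d => f z.1 z.2) (spaceTime d T) ∧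
    eLpNorm (fun t => eLpNorm (f t) q volume) p (volume.restrict (Ioo 0 T)) < ∞

/-- The partial derivative `∂ⱼ f` at `x` of a function on the torus. -/
def pderiv {d : ℕ} (j : Fin d) (f : Torus d → ℝ) (x : Torus d) : ℝ :=
  deriv (fun s : ℝ => f (x + Pi.single j (s : UnitAddCircle))) 0

/-- `ψ` is smooth on `ℝ × 𝕋ᵈ`: its lift to `ℝ × ℝᵈ` is smooth. -/
def IsSmooth {d : ℕ} (ψ : ℝ → Torus d → ℝ) : Prop :=
  ContDiff ℝ (⊤ : ℕ∞) (fun z : ℝ × (Fin d → ℝ) => ψ z.1 (fun i => (z.2 i : UnitAddCircle)))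

/-- Test functions in `C_c^∞((0,T) × 𝕋ᵈ)`. -/
def IsTest {d : ℕ} (T : ℝ) (ψ : ℝ → Torus d → ℝ) : Prop :=
  IsSmooth ψ ∧ ∃ a b : ℝ, 0 < a ∧ b < T ∧ ∀ t, t ∉ Icc a b → ∀ x, ψ t x = 0

/-- Test functions in `C_c^∞([0,T) × 𝕋ᵈ)`, which need not vanish at `t = 0`. -/
def IsTestInit {d : ℕ} (T : ℝ) (ψ : ℝ → Torus d → ℝ) : Prop :=
  IsSmooth ψ ∧ ∃ b : ℝ, b < T ∧ ∀ t, b < t → ∀ x, ψ t x = 0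

/-- `g = ∂ⱼ f` in the sense of distributions on `(0,T) × 𝕋ᵈ`, for integrable `f` and `g`. -/
def HasWeakPartial {d : ℕ} (T : ℝ) (j : Fin d) (f g : ℝ → Torus d → ℝ) : Prop :=
  Integrable (fun z : ℝ × Torus d => f z.1 z.2) (spaceTime d T) ∧
  Integrable (fun z : ℝ × Torus d => g z.1 z.2) (spaceTime d T) ∧
  ∀ ψ : ℝ → Torus d → ℝ, IsTest T ψ →
    ∫ z, f z.1 z.2 * pderiv j (ψ z.1) z.2 ∂(spaceTime d T)
      = - ∫ z, g z.1 z.2 * ψ z.1 z.2 ∂(spaceTime d T)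

/-- `G = ∇f` weakly, for a scalar field `f`. -/
def HasWeakGrad {d : ℕ} (T : ℝ) (f : ℝ → Torus d → ℝ) (G : ℝ → Torus d → Vec d) : Prop :=
  ∀ j, HasWeakPartial T j f (fun t x => G t x j)

/-- `D = ∇v` weakly, for a vector field `v`. -/
def HasWeakGradVec {d : ℕ} (T : ℝ) (v : ℝ → Torus d → Vec d) (D : ℝ → Torus d → Mat d) : Prop :=
  ∀ i j, HasWeakPartial T j (fun t x => v t x i) (fun t x => D t x (i, j))

/-- The trace of a matrix; applied to `∇v` it is `div v`. -/
def tr {d : ℕ} (A : Mat d) : ℝ := ∑ i, A (i, i)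

/-- The energy density `½ ϱ|v|² + ϱ^γ/(γ-1)`. -/
def energyDensity {d : ℕ} (γ : ℝ) (ϱ : Torus d → ℝ) (v : Torus d → Vec d) (x : Torus d) : ℝ :=
  1 / 2 * ϱ x * ‖v x‖ ^ 2 + ϱ x ^ γ / (γ - 1)

/-- The energy `∫ (½ ϱ|v|² + ϱ^γ/(γ-1)) dx`. -/
def energy {d : ℕ} (γ : ℝ) (ϱ : Torus d → ℝ) (v : Torus d → Vec d) : ℝ :=
  ∫ x, energyDensity γ ϱ v x

/-- The dissipation `∫₀ᵗ ∫ (μ|∇v|² + (μ+lam)|div v|²) dx ds`, where `D = ∇v`. -/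
def dissipation {d : ℕ} (μ lam : ℝ) (D : ℝ → Torus d → Mat d) (t : ℝ) : ℝ :=
  ∫ z, (μ * ‖D z.1 z.2‖ ^ 2 + (μ + lam) * tr (D z.1 z.2) ^ 2) ∂(spaceTime d t)

/-- `∂ₜϱ + div(ϱv) = 0` in the sense of distributions, with initial density `ϱ₀`. -/
def MassEq {d : ℕ} (T : ℝ) (ϱ : ℝ → Torus d → ℝ) (v : ℝ → Torus d → Vec d)
    (ϱ₀ : Torus d → ℝ) : Prop :=
  ∀ ψ : ℝ → Torus d → ℝ, IsTestInit T ψ →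
    ∫ z, (ϱ z.1 z.2 * deriv (fun s => ψ s z.2) z.1
        + ∑ j, ϱ z.1 z.2 * v z.1 z.2 j * pderiv j (ψ z.1) z.2) ∂(spaceTime d T)
      + ∫ x, ϱ₀ x * ψ 0 x = 0

/-- `∂ₜ(ϱv) + div(ϱv⊗v) + ∇ϱ^γ - μ Δv - (μ+lam) ∇div v = 0` in the sense of distributions,
component by component, with initial momentum `ϱ₀v₀`; here `D = ∇v`. -/
def MomentumEq {d : ℕ} (μ lam γ T : ℝ) (ϱ : ℝ → Torus d → ℝ) (v : ℝ → Torus d → Vec d)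
    (D : ℝ → Torus d → Mat d) (ϱ₀ : Torus d → ℝ) (v₀ : Torus d → Vec d) : Prop :=
  ∀ (i : Fin d) (ψ : ℝ → Torus d → ℝ), IsTestInit T ψ →
    ∫ z, (ϱ z.1 z.2 * v z.1 z.2 i * deriv (fun s => ψ s z.2) z.1
        + ∑ j, ϱ z.1 z.2 * v z.1 z.2 i * v z.1 z.2 j * pderiv j (ψ z.1) z.2
        + ϱ z.1 z.2 ^ γ * pderiv i (ψ z.1) z.2
        - μ * ∑ j, D z.1 z.2 (i, j) * pderiv j (ψ z.1) z.2
        - (μ + lam) * tr (D z.1 z.2) * pderiv i (ψ z.1) z.2) ∂(spaceTime d T)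
      + ∫ x, ϱ₀ x * v₀ x i * ψ 0 x = 0

/-- `ϱ` is a renormalized solution of the mass equation:
`∂ₜ b(ϱ) + div(b(ϱ)v) + (b'(ϱ)ϱ - b(ϱ)) div v = 0` in the sense of distributions on
`(0,T) × 𝕋ᵈ`, for every `b ∈ C¹` with `b'(z) = 0` for all large `z`. -/
def Renormalized {d : ℕ} (T : ℝ) (ϱ : ℝ → Torus d → ℝ) (v : ℝ → Torus d → Vec d)
    (D : ℝ → Torus d → Mat d) : Prop :=
  ∀ b : ℝ → ℝ, ContDiff ℝ 1 b → (∃ M : ℝ, ∀ z, M ≤ z → deriv b z = 0) →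
    ∀ ψ : ℝ → Torus d → ℝ, IsTest T ψ →
      ∫ z, (b (ϱ z.1 z.2) * deriv (fun s => ψ s z.2) z.1
          + ∑ j, b (ϱ z.1 z.2) * v z.1 z.2 j * pderiv j (ψ z.1) z.2
          - (deriv b (ϱ z.1 z.2) * ϱ z.1 z.2 - b (ϱ z.1 z.2)) * tr (D z.1 z.2) * ψ z.1 z.2)
        ∂(spaceTime d T) = 0

/-- `(ϱ, v)` is a finite energy weak solution on `(0,T) × 𝕋ᵈ`, vacuum being allowed, of the
isentropic compressible Navier–Stokes system with pressure `ϱ^γ`, constant viscosities `μ`, `lam`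
and initial data `(ϱ₀, v₀)`; `D` is the weak gradient `∇v`. -/
structure IsWeakSolution {d : ℕ} (μ lam γ T : ℝ) (ϱ : ℝ → Torus d → ℝ)
    (v : ℝ → Torus d → Vec d) (D : ℝ → Torus d → Mat d)
    (ϱ₀ : Torus d → ℝ) (v₀ : Torus d → Vec d) : Prop where
  density_meas :
    AEStronglyMeasurable (fun z : ℝ × Torus d => ϱ z.1 z.2) (spaceTime d T)
  density_nonneg : ∀ᵐ z ∂(spaceTime d T), 0 ≤ ϱ z.1 z.2
  init_density_meas : AEStronglyMeasurable ϱ₀ volume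
  init_density_nonneg : ∀ᵐ x, 0 ≤ ϱ₀ x
  init_velocity_meas : AEStronglyMeasurable v₀ volume
  init_vacuum : ∀ᵐ x, ϱ₀ x = 0 → v₀ x = 0
  init_energy_finite : Integrable (energyDensity γ ϱ₀ v₀)
  gradient : HasWeakGradVec T v D
  pressure_bound : MemLpLq T ∞ 1 (fun t x => ϱ t x ^ γ)
  kinetic_bound : MemLpLq T ∞ 1 (fun t x => ϱ t x * ‖v t x‖ ^ 2)
  gradient_bound : MemLpLq T 2 2 D
  mass : MassEq T ϱ v ϱ₀
  momentum : MomentumEq μ lam γ T ϱ v D ϱ₀ v₀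
  renormalized : Renormalized T ϱ v D
  energy_inequality : ∀ᵐ t ∂(volume.restrict (Ioo 0 T)),
    energy γ (ϱ t) (v t) + dissipation μ lam D t ≤ energy γ ϱ₀ v₀

/-- `(r, u)` is the representative of `(ϱ, v)` for which the density and the momentum have a
meaning at every time `t ∈ [0,T]`: it agrees with `(ϱ, v)` at almost every time,
`r ∈ C([0,T]; L^γ-weak)`, `r u ∈ C([0,T]; L^{2γ/(γ+1)}-weak)`, and at `t = 0` the density and the
momentum are the initial ones. (At each time this determines `r`, and `u` outside vacuum, up to
null sets.) -/
structure IsWeaklyContinuousRep {d : ℕ} (γ T : ℝ) (ϱ : ℝ → Torus d → ℝ)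
    (v : ℝ → Torus d → Vec d) (ϱ₀ : Torus d → ℝ) (v₀ : Torus d → Vec d)
    (r : ℝ → Torus d → ℝ) (u : ℝ → Torus d → Vec d) : Prop where
  density_eq : ∀ᵐ t ∂(volume.restrict (Ioo 0 T)), r t =ᵐ[volume] ϱ t
  velocity_eq : ∀ᵐ t ∂(volume.restrict (Ioo 0 T)), u t =ᵐ[volume] v t
  nonneg : ∀ t ∈ Icc 0 T, ∀ᵐ x, 0 ≤ r t x
  density_mem : ∀ t ∈ Icc 0 T, MemLp (r t) (ENNReal.ofReal γ) volume
  momentum_mem : ∀ t ∈ Icc 0 T,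
    MemLp (fun x => r t x • u t x) (ENNReal.ofReal (2 * γ / (γ + 1))) volume
  density_cont : ∀ w : Torus d → ℝ, MemLp w (ENNReal.ofReal (γ / (γ - 1))) volume →
    ContinuousOn (fun t => ∫ x, r t x * w x) (Icc 0 T)
  momentum_cont : ∀ w : Torus d → Vec d, MemLp w (ENNReal.ofReal (2 * γ / (γ - 1))) volume →
    ContinuousOn (fun t => ∫ x, r t x * inner ℝ (u t x) (w x)) (Icc 0 T)
  init_density : r 0 =ᵐ[volume] ϱ₀
  init_momentum : (fun x => r 0 x • u 0 x) =ᵐ[volume] fun x => ϱ₀ x • v₀ x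

end CNS

end

/-!
The energy equality is proved without regularizing the equations in space-time. Every test function
is a product `χ(t) w(x)`, where `w` is a trigonometric polynomial; countably many `w` suffice
(`ae_forall_trigPoly`), so each weak formulation becomes a statement about almost every time slice
(`HasWeakPartial.slice`), in which the slices are mollified by trigonometric kernels (`moll`) and
Hölder's inequality does the rest. To make the exponents in that inequality additive, Lebesgue
spaces are indexed by the reciprocals of their exponents (`pe`, `Mix`, `RegularSolution`).

*Density.* The product rule gives `div (ϱ v) = 2 √ϱ ∇√ϱ · v + ϱ div v`, which is integrable
(`divMomentum`, `ae_integral_momentum_grad`). Hence `ϱ` agrees at almost every time with a primitive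
`rep` of an `L¹`-valued function of time (`ae_density_eq`). The renormalized equation, with
truncations of `z ^ γ` and tested with functions of time alone, gives the balance of `∫ ϱ ^ γ` at
every time (`integral_pressure_rep`).

*Momentum.* The momentum equation determines `∫ ϱ v · w` at every time, as `momentumPairing`. A weak
limit in `L²` of `√ϱ v`, along an ultrafilter of times avoiding null sets, shows that at each time
this functional is given by `rep · u` for some velocity `u` (`exists_momentum_root`,
`IsVelocityAt`). The weak limit does not increase the norm, so the kinetic energy `e` is lower
semicontinuous (`kinetic_of_isVelocityAt`).

*Kinetic energy.* Convexity gives `e(t) ≥ ∫ (ϱ u)(t) · w - ½ ∫ ϱ(t) |w|²` for every `w`, with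
equality at `t = s` when `w = v(s)`. The right side changes in time according to the equations of
momentum and mass, so that `e(t) ≥ e(s) + ∫_s^t Ψ(τ, s) dτ` for almost every `s` and for every `t`,
before or after `s` (`ae_kinetic_ge`). Here `Ψ(τ, s)` pairs stresses at time `τ` with the velocity
and its gradient at time `s`. By continuity of translations in mixed Lebesgue spaces, replacing
`Ψ(τ, s)` by `Ψ(s, s)` costs `o(h)` on average over `s` when `|t - s| ≤ h` (`tendsto_timeOsc`). A
lower semicontinuous function with such subgradients in both directions of time is a primitive of
`Ψ(s, s)` (`eq_primitive_of_subgradient`), which is `kinetic_balance`: the convective terms of `Ψ(s,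
s)` cancel and what remains is `∫ ϱ ^ γ div v` minus the dissipation. Adding the balance of the
pressure gives `energy_balance`. Weak continuity of `rep` and `rep · u` holds on trigonometric
polynomials by construction and extends by density, thanks to the energy bound
(`continuousOn_pairing`).
-/


noncomputable section

namespace CNS

open Filter Topology

variable {d : ℕ}

instance unitAddCircle_isProbabilityMeasure :
    IsProbabilityMeasure (volume : Measure UnitAddCircle) :=
  ⟨UnitAddCircle.measure_univ⟩

instance torus_isProbabilityMeasure : IsProbabilityMeasure (volume : Measure (Torus d)) :=
  inferInstanceAs (IsProbabilityMeasure (Measure.pi fun _ : Fin d => (volume : Measure UnitAddCircle)))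

/-! ### Trigonometric polynomials on the torus -/

/-- The function `cos (2π xᵢ)` on the torus. -/
def cosT (i : Fin d) (x : Torus d) : ℝ := (AddCircle.toCircle (x i) : ℂ).re

/-- The function `sin (2π xᵢ)` on the torus. -/
def sinT (i : Fin d) (x : Torus d) : ℝ := (AddCircle.toCircle (x i) : ℂ).im

/-- The algebra of real trigonometric polynomials on the torus. -/
def trigPoly (d : ℕ) : Subalgebra ℝ (Torus d → ℝ) :=
  Algebra.adjoin ℝ (range cosT ∪ range sinT)

lemma cosT_mem (i : Fin d) : cosT i ∈ trigPoly d :=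
  Algebra.subset_adjoin (Or.inl ⟨i, rfl⟩)

lemma sinT_mem (i : Fin d) : sinT i ∈ trigPoly d :=
  Algebra.subset_adjoin (Or.inr ⟨i, rfl⟩)

lemma const_mem_trigPoly (c : ℝ) : (fun _ => c) ∈ trigPoly d :=
  (trigPoly d).algebraMap_mem c

lemma trigPoly_induction {P : (Torus d → ℝ) → Prop} (hc : ∀ i, P (cosT i)) (hs : ∀ i, P (sinT i))
    (hk : ∀ c : ℝ, P fun _ => c)
    (hadd : ∀ f g, f ∈ trigPoly d → g ∈ trigPoly d → P f → P g → P (fun x => f x + g x))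
    (hmul : ∀ f g, f ∈ trigPoly d → g ∈ trigPoly d → P f → P g → P (fun x => f x * g x))
    {f : Torus d → ℝ} (hf : f ∈ trigPoly d) : P f := by
  induction hf using Algebra.adjoin_induction with
  | mem x hx =>
    rcases hx with ⟨i, rfl⟩ | ⟨i, rfl⟩
    · exact hc i
    · exact hs i
  | algebraMap r => exact hk r
  | add x y hx hy h1 h2 => exact hadd x y hx hy h1 h2
  | mul x y hx hy h1 h2 => exact hmul x y hx hy h1 h2

lemma cosT_coe (i : Fin d) (x : Torus d) (s : ℝ) (h : x i = (s : UnitAddCircle)) :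
    cosT i x = Real.cos (2 * Real.pi * s) := by
  rw [cosT, h, AddCircle.toCircle_apply_mk, Circle.coe_exp, Complex.exp_ofReal_mul_I_re, div_one]

lemma sinT_coe (i : Fin d) (x : Torus d) (s : ℝ) (h : x i = (s : UnitAddCircle)) :
    sinT i x = Real.sin (2 * Real.pi * s) := by
  rw [sinT, h, AddCircle.toCircle_apply_mk, Circle.coe_exp, Complex.exp_ofReal_mul_I_im, div_one]

lemma continuous_cosT (i : Fin d) : Continuous (cosT i) := by
  unfold cosT
  have := AddCircle.continuous_toCircle (T := (1 : ℝ))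
  fun_prop

lemma continuous_sinT (i : Fin d) : Continuous (sinT i) := by
  unfold sinT
  have := AddCircle.continuous_toCircle (T := (1 : ℝ))
  fun_prop

lemma continuous_of_mem_trigPoly {f : Torus d → ℝ} (hf : f ∈ trigPoly d) : Continuous f :=
  trigPoly_induction (P := Continuous) continuous_cosT continuous_sinT
    (fun _ => continuous_const) (fun _ _ _ _ hf hg => hf.add hg)
    (fun _ _ _ _ hf hg => hf.mul hg) hf

lemma exists_bound_of_mem_trigPoly {f : Torus d → ℝ} (hf : f ∈ trigPoly d) :
    ∃ C : ℝ, 0 ≤ C ∧ ∀ x, |f x| ≤ C := by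
  obtain ⟨C, hC⟩ := isCompact_univ.exists_bound_of_continuousOn
    (continuous_of_mem_trigPoly hf).continuousOn
  exact ⟨C, (norm_nonneg _).trans (hC 0 trivial), fun x => hC x trivial⟩

lemma memLp_of_mem_trigPoly {f : Torus d → ℝ} (hf : f ∈ trigPoly d) (p : ℝ≥0∞) :
    MemLp f p volume := by
  obtain ⟨C, -, hC⟩ := exists_bound_of_mem_trigPoly hf
  exact MemLp.of_bound (continuous_of_mem_trigPoly hf).aestronglyMeasurable C
    (ae_of_all _ hC)

lemma contDiff_of_mem_trigPoly {f : Torus d → ℝ} (hf : f ∈ trigPoly d) :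
    ContDiff ℝ (⊤ : ℕ∞) (fun z : Fin d → ℝ => f (fun i => (z i : UnitAddCircle))) := by
  refine trigPoly_induction (P := fun f => ContDiff ℝ (⊤ : ℕ∞)
    (fun z : Fin d → ℝ => f (fun i => (z i : UnitAddCircle)))) ?_ ?_ (fun _ => contDiff_const)
    (fun _ _ _ _ hf hg => hf.add hg) (fun _ _ _ _ hf hg => hf.mul hg) hf
  · intro i
    simp_rw [fun z : Fin d → ℝ => cosT_coe i (fun i => (z i : UnitAddCircle)) (z i) rfl]
    fun_prop
  · intro i
    simp_rw [fun z : Fin d → ℝ => sinT_coe i (fun i => (z i : UnitAddCircle)) (z i) rfl]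
    fun_prop

lemma hasDerivAt_cosT (i j : Fin d) (x : Torus d) :
    HasDerivAt (fun s : ℝ => cosT i (x + Pi.single j (s : UnitAddCircle)))
      (if i = j then -(2 * Real.pi) * sinT i x else 0) 0 := by
  obtain ⟨y, hy⟩ := QuotientAddGroup.mk_surjective (x i)
  split_ifs with h
  · subst h
    have h1 : ∀ s : ℝ, (x + Pi.single i (s : UnitAddCircle) : Torus d) i
        = ((y + s : ℝ) : UnitAddCircle) := by
      intro s; simp [← hy]
    simp_rw [fun s => cosT_coe i _ _ (h1 s)]
    rw [sinT_coe i x y hy.symm]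
    have := ((((hasDerivAt_id (0 : ℝ)).const_add y).const_mul (2 * Real.pi)).cos)
    simpa [mul_comm] using! this
  · have h1 : ∀ s : ℝ, cosT i (x + Pi.single j (s : UnitAddCircle)) = cosT i x := by
      intro s; simp [cosT, Pi.single_eq_of_ne h]
    simp_rw [h1]
    exact hasDerivAt_const _ _

lemma hasDerivAt_sinT (i j : Fin d) (x : Torus d) :
    HasDerivAt (fun s : ℝ => sinT i (x + Pi.single j (s : UnitAddCircle)))
      (if i = j then (2 * Real.pi) * cosT i x else 0) 0 := by
  obtain ⟨y, hy⟩ := QuotientAddGroup.mk_surjective (x i)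
  split_ifs with h
  · subst h
    have h1 : ∀ s : ℝ, (x + Pi.single i (s : UnitAddCircle) : Torus d) i
        = ((y + s : ℝ) : UnitAddCircle) := by
      intro s; simp [← hy]
    simp_rw [fun s => sinT_coe i _ _ (h1 s)]
    rw [cosT_coe i x y hy.symm]
    have := ((((hasDerivAt_id (0 : ℝ)).const_add y).const_mul (2 * Real.pi)).sin)
    simpa [mul_comm] using! this
  · have h1 : ∀ s : ℝ, sinT i (x + Pi.single j (s : UnitAddCircle)) = sinT i x := by
      intro s; simp [sinT, Pi.single_eq_of_ne h]
    simp_rw [h1]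
    exact hasDerivAt_const _ _

lemma exists_hasDerivAt_of_mem_trigPoly {f : Torus d → ℝ} (hf : f ∈ trigPoly d) (j : Fin d) :
    ∃ g ∈ trigPoly d, ∀ x, HasDerivAt (fun s : ℝ => f (x + Pi.single j (s : UnitAddCircle)))
      (g x) 0 := by
  refine trigPoly_induction (P := fun f => ∃ g ∈ trigPoly d, ∀ x,
    HasDerivAt (fun s : ℝ => f (x + Pi.single j (s : UnitAddCircle))) (g x) 0) ?_ ?_ ?_ ?_ ?_ hf
  · intro i
    refine ⟨fun x => if i = j then -(2 * Real.pi) * sinT i x else 0, ?_,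
      fun x => hasDerivAt_cosT i j x⟩
    split_ifs
    · exact (trigPoly d).smul_mem (sinT_mem i) (-(2 * Real.pi))
    · exact const_mem_trigPoly 0
  · intro i
    refine ⟨fun x => if i = j then (2 * Real.pi) * cosT i x else 0, ?_,
      fun x => hasDerivAt_sinT i j x⟩
    split_ifs
    · exact (trigPoly d).smul_mem (cosT_mem i) (2 * Real.pi)
    · exact const_mem_trigPoly 0
  · exact fun c => ⟨fun _ => 0, const_mem_trigPoly 0, fun x => hasDerivAt_const _ _⟩
  · rintro f g - - ⟨f', hf', h1⟩ ⟨g', hg', h2⟩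
    exact ⟨f' + g', add_mem hf' hg', fun x => (h1 x).add (h2 x)⟩
  · rintro f g hf hg ⟨f', hf', h1⟩ ⟨g', hg', h2⟩
    refine ⟨f' * g + f * g', add_mem (mul_mem hf' hg) (mul_mem hf hg'), fun x => ?_⟩
    have := (h1 x).mul (h2 x)
    simpa using! this

lemma hasDerivAt_pderiv {f : Torus d → ℝ} (hf : f ∈ trigPoly d) (j : Fin d) (x : Torus d) :
    HasDerivAt (fun s : ℝ => f (x + Pi.single j (s : UnitAddCircle))) (pderiv j f x) 0 := by
  obtain ⟨g, -, hg⟩ := exists_hasDerivAt_of_mem_trigPoly hf j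
  exact (hg x).differentiableAt.hasDerivAt

lemma pderiv_mem_trigPoly {f : Torus d → ℝ} (hf : f ∈ trigPoly d) (j : Fin d) :
    pderiv j f ∈ trigPoly d := by
  obtain ⟨g, hg, h⟩ := exists_hasDerivAt_of_mem_trigPoly hf j
  have : pderiv j f = g := funext fun x => (h x).deriv
  rwa [this]

lemma pderiv_add {f g : Torus d → ℝ} (hf : f ∈ trigPoly d) (hg : g ∈ trigPoly d) (j : Fin d)
    (x : Torus d) : pderiv j (fun y => f y + g y) x = pderiv j f x + pderiv j g x :=
  ((hasDerivAt_pderiv hf j x).add (hasDerivAt_pderiv hg j x)).deriv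

lemma pderiv_mul {f g : Torus d → ℝ} (hf : f ∈ trigPoly d) (hg : g ∈ trigPoly d) (j : Fin d)
    (x : Torus d) :
    pderiv j (fun y => f y * g y) x = pderiv j f x * g x + f x * pderiv j g x := by
  have := ((hasDerivAt_pderiv hf j x).mul (hasDerivAt_pderiv hg j x)).deriv
  simpa using! this

lemma pderiv_const (c : ℝ) (j : Fin d) (x : Torus d) : pderiv j (fun _ => c) x = 0 := by
  simp [pderiv]

lemma pderiv_const_mul (f : Torus d → ℝ) (c : ℝ) (j : Fin d) (x : Torus d) :
    pderiv j (fun y => c * f y) x = c * pderiv j f x := by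
  simp [pderiv]

lemma isSmooth_mul {χ : ℝ → ℝ} (hχ : ContDiff ℝ (⊤ : ℕ∞) χ) {w : Torus d → ℝ}
    (hw : w ∈ trigPoly d) : IsSmooth (fun t x => χ t * w x) :=
  (hχ.comp contDiff_fst).mul ((contDiff_of_mem_trigPoly hw).comp contDiff_snd)

/-- The trigonometric polynomials are spanned by a countable family, so that a property which is
linear in `w` and holds for each trigonometric polynomial `w` outside a null set depending on `w`
holds for all of them outside one null set. -/
lemma ae_forall_trigPoly {α : Type*} [MeasurableSpace α] {ν : Measure α}
    {P : α → (Torus d → ℝ) → Prop} (h : ∀ w ∈ trigPoly d, ∀ᵐ a ∂ν, P a w)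
    (hadd : ∀ᵐ a ∂ν, ∀ w₁ ∈ trigPoly d, ∀ w₂ ∈ trigPoly d,
      P a w₁ → P a w₂ → P a (fun x => w₁ x + w₂ x))
    (hsmul : ∀ᵐ a ∂ν, ∀ (c : ℝ), ∀ w ∈ trigPoly d, P a w → P a (fun x => c * w x)) :
    ∀ᵐ a ∂ν, ∀ w ∈ trigPoly d, P a w := by
  set S : Set (Torus d → ℝ) := range cosT ∪ range sinT with hS
  have hSc : S.Countable := (countable_range _).union (countable_range _)
  have : Countable S := hSc.to_subtype
  have hcl : (Submonoid.closure S : Set (Torus d → ℝ)).Countable := by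
    refine (countable_range (fun l : List S => (l.map Subtype.val).prod)).mono ?_
    intro x hx
    obtain ⟨l, hl, rfl⟩ := Submonoid.exists_list_of_mem_closure hx
    refine ⟨l.attach.map (fun y => ⟨y.1, hl y.1 y.2⟩), ?_⟩
    simp only [List.map_map]
    exact congrArg List.prod (List.attach_map_subtype_val l)
  have hmem : ∀ w ∈ Submonoid.closure S, w ∈ trigPoly d := fun w hw => by
    have : w ∈ Submodule.span ℝ (Submonoid.closure S : Set (Torus d → ℝ)) :=
      Submodule.subset_span hw
    rw [← Algebra.adjoin_eq_span] at this
    exact this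
  have h0 : ∀ᵐ a ∂ν, ∀ w ∈ (Submonoid.closure S : Set (Torus d → ℝ)), P a w :=
    (ae_ball_iff hcl).2 fun w hw => h w (hmem w hw)
  filter_upwards [h0, hadd, hsmul] with a ha hadd hsmul w hw
  have hw' : w ∈ Submodule.span ℝ (Submonoid.closure S : Set (Torus d → ℝ)) := by
    rw [← Algebra.adjoin_eq_span]; exact hw
  have key : w ∈ trigPoly d ∧ P a w := by
    induction hw' using Submodule.span_induction with
    | mem x hx => exact ⟨hmem x hx, ha x hx⟩
    | zero =>
      refine ⟨zero_mem _, ?_⟩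
      have h1 := ha 1 (one_mem (Submonoid.closure S))
      have := hsmul 0 1 (one_mem _) h1
      simpa using! this
    | add x y hx hy h1 h2 =>
      have h1 := h1 (by rw [← Algebra.adjoin_eq_span] at hx; exact hx)
      have h2 := h2 (by rw [← Algebra.adjoin_eq_span] at hy; exact hy)
      exact ⟨add_mem h1.1 h2.1, hadd x h1.1 y h2.1 h1.2 h2.2⟩
    | smul c x hx h1 =>
      have h1 := h1 (by rw [← Algebra.adjoin_eq_span] at hx; exact hx)
      exact ⟨(trigPoly d).smul_mem h1.1 c, hsmul c x h1.1 h1.2⟩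
  exact key.2

/-! ### Mollification by trigonometric kernels -/

/-- A nonnegative trigonometric polynomial with a unique maximum, at the origin. -/
def peak (x : Torus d) : ℝ := ∏ i, (1 + cosT i x)

/-- The `N`-th kernel: the normalized power `peak ^ N`, an approximation of the identity. -/
def kernel (N : ℕ) (x : Torus d) : ℝ := (∫ y : Torus d, peak y ^ N)⁻¹ * peak x ^ N

/-- The convolution of `f` with the `N`-th kernel. -/
def moll (N : ℕ) (f : Torus d → ℝ) (x : Torus d) : ℝ := ∫ y, kernel N (x - y) * f y

lemma normSq_toCircle (i : Fin d) (x : Torus d) : cosT i x ^ 2 + sinT i x ^ 2 = 1 := by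
  have := Complex.sq_norm (AddCircle.toCircle (x i) : ℂ)
  rw [Circle.norm_coe, Complex.normSq_apply] at this
  simp only [cosT, sinT]; nlinarith

lemma cosT_le_one (i : Fin d) (x : Torus d) : cosT i x ≤ 1 := by
  nlinarith [normSq_toCircle i x, sq_nonneg (sinT i x)]

lemma neg_one_le_cosT (i : Fin d) (x : Torus d) : -1 ≤ cosT i x := by
  nlinarith [normSq_toCircle i x, sq_nonneg (sinT i x)]

lemma cosT_sub (i : Fin d) (x y : Torus d) :
    cosT i (x - y) = cosT i x * cosT i y + sinT i x * sinT i y := by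
  simp [cosT, sinT, sub_eq_add_neg, AddCircle.toCircle_add, AddCircle.toCircle_neg]

lemma cosT_zero (i : Fin d) : cosT i (0 : Torus d) = 1 := by
  simp [cosT]

lemma sinT_zero (i : Fin d) : sinT i (0 : Torus d) = 0 := by
  simp [sinT]

lemma cosT_neg (i : Fin d) (x : Torus d) : cosT i (-x) = cosT i x := by
  simpa [cosT_zero, sinT_zero] using cosT_sub i 0 x

lemma peak_neg (x : Torus d) : peak (-x) = peak x := by
  simp [peak, cosT_neg]

lemma kernel_neg (N : ℕ) (x : Torus d) : kernel N (-x) = kernel N x := by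
  simp [kernel, peak_neg]

lemma peak_nonneg (x : Torus d) : 0 ≤ peak x :=
  Finset.prod_nonneg fun i _ => by linarith [neg_one_le_cosT i x]

lemma peak_zero : peak (0 : Torus d) = 2 ^ d := by
  simp [peak, cosT_zero]; norm_num

lemma eq_zero_of_cosT {i : Fin d} {x : Torus d} (h : cosT i x = 1) : x i = 0 := by
  have h2 : sinT i x = 0 := by
    have := normSq_toCircle i x
    rw [h] at this; nlinarith
  apply AddCircle.injective_toCircle (one_ne_zero : (1 : ℝ) ≠ 0)
  rw [AddCircle.toCircle_zero]
  ext
  apply Complex.ext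
  · simpa [cosT] using h
  · simpa [sinT] using h2

lemma peak_lt {x : Torus d} (hx : x ≠ 0) : peak x < peak (0 : Torus d) := by
  obtain ⟨i, hi⟩ := Function.ne_iff.1 hx
  have h1 : cosT i x < 1 := lt_of_le_of_ne (cosT_le_one i x) fun h => hi (eq_zero_of_cosT h)
  have h2 : ∏ j ∈ Finset.univ.erase i, (1 + cosT j x) ≤ ∏ j ∈ Finset.univ.erase i, (2 : ℝ) :=
    Finset.prod_le_prod (fun j _ => by linarith [neg_one_le_cosT j x])
      (fun j _ => by linarith [cosT_le_one j x])
  have h3 : 0 < ∏ j ∈ Finset.univ.erase i, (2 : ℝ) := Finset.prod_pos fun _ _ => by norm_num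
  have h4 : peak (0 : Torus d) = 2 * ∏ j ∈ Finset.univ.erase i, (2 : ℝ) := by
    rw [Finset.mul_prod_erase Finset.univ (fun _ => (2 : ℝ)) (Finset.mem_univ i), peak_zero]
    simp
  rw [h4, peak, ← Finset.mul_prod_erase Finset.univ (fun j => 1 + cosT j x) (Finset.mem_univ i)]
  have h5 := neg_one_le_cosT i x
  nlinarith

lemma continuous_peak : Continuous (peak : Torus d → ℝ) := by
  unfold peak
  exact continuous_finsetProd _ fun i _ => continuous_const.add (continuous_cosT i)

lemma integrable_peak_pow (N : ℕ) : Integrable (fun x : Torus d => peak x ^ N) :=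
  (continuous_peak.pow N).integrable_of_hasCompactSupport (HasCompactSupport.of_compactSpace _)

lemma integral_peak_pow_pos (N : ℕ) : 0 < ∫ x : Torus d, peak x ^ N := by
  rw [integral_pos_iff_support_of_nonneg (fun x => pow_nonneg (peak_nonneg x) N)
    (integrable_peak_pow N)]
  refine IsOpen.measure_pos _ ((continuous_peak.pow N).isOpen_support) ⟨0, ?_⟩
  simp only [Function.mem_support, peak_zero]
  positivity

lemma kernel_nonneg (N : ℕ) (x : Torus d) : 0 ≤ kernel N x :=
  mul_nonneg (inv_nonneg.2 (integral_peak_pow_pos N).le) (pow_nonneg (peak_nonneg x) N)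

lemma continuous_kernel (N : ℕ) : Continuous (kernel N : Torus d → ℝ) :=
  continuous_const.mul (continuous_peak.pow N)

lemma integrable_kernel (N : ℕ) : Integrable (kernel N : Torus d → ℝ) :=
  (integrable_peak_pow N).const_mul _

lemma integral_kernel (N : ℕ) : ∫ x : Torus d, kernel N x = 1 := by
  simp only [kernel]
  rw [integral_const_mul, inv_mul_cancel₀ (integral_peak_pow_pos N).ne']

lemma lintegral_kernel (N : ℕ) : ∫⁻ x : Torus d, ENNReal.ofReal (kernel N x) = 1 := by
  rw [← ofReal_integral_eq_lintegral_ofReal (integrable_kernel N)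
    (ae_of_all _ (kernel_nonneg N)), integral_kernel, ENNReal.ofReal_one]

/-- A kernel `k (x, y)` that is a finite sum of products `a(x) b(y)` of trigonometric
polynomials. -/
def IsSeparable (k : Torus d → Torus d → ℝ) : Prop :=
  ∃ (ι : Type) (_ : Fintype ι) (a b : ι → Torus d → ℝ),
    (∀ i, a i ∈ trigPoly d) ∧ (∀ i, b i ∈ trigPoly d) ∧ ∀ x y, k x y = ∑ i, a i x * b i y

lemma IsSeparable.mul {k k' : Torus d → Torus d → ℝ} (h : IsSeparable k) (h' : IsSeparable k') :
    IsSeparable (fun x y => k x y * k' x y) := by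
  obtain ⟨ι, _, a, b, ha, hb, e⟩ := h
  obtain ⟨ι', _, a', b', ha', hb', e'⟩ := h'
  refine ⟨ι × ι', inferInstance, fun i => a i.1 * a' i.2, fun i => b i.1 * b' i.2,
    fun i => mul_mem (ha _) (ha' _), fun i => mul_mem (hb _) (hb' _), fun x y => ?_⟩
  beta_reduce
  rw [e, e', Finset.sum_mul_sum, Fintype.sum_prod_type]
  refine Finset.sum_congr rfl fun i _ => Finset.sum_congr rfl fun j _ => ?_
  simp only [Pi.mul_apply]; ring

lemma isSeparable_const (c : ℝ) : IsSeparable (d := d) (fun _ _ => c) :=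
  ⟨Unit, inferInstance, fun _ _ => c, fun _ _ => 1, fun _ => const_mem_trigPoly c,
    fun _ => const_mem_trigPoly 1, fun x y => by simp⟩

lemma isSeparable_peak_sub : IsSeparable (d := d) (fun x y => peak (x - y)) := by
  have h1 : ∀ i : Fin d, IsSeparable (fun x y : Torus d => 1 + cosT i (x - y)) := by
    intro i
    refine ⟨Fin 3, inferInstance, ![fun _ => 1, cosT i, sinT i], ![fun _ => 1, cosT i, sinT i],
      ?_, ?_, ?_⟩
    · intro k; fin_cases k
      exacts [const_mem_trigPoly 1, cosT_mem i, sinT_mem i]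
    · intro k; fin_cases k
      exacts [const_mem_trigPoly 1, cosT_mem i, sinT_mem i]
    · intro x y
      simp [Fin.sum_univ_three, cosT_sub]; ring
  have h2 : ∀ s : Finset (Fin d),
      IsSeparable (fun x y : Torus d => ∏ i ∈ s, (1 + cosT i (x - y))) := by
    classical
    intro s
    induction s using Finset.induction_on with
    | empty => simpa using isSeparable_const (d := d) 1
    | insert i s hi ih =>
      simp_rw [Finset.prod_insert hi]
      exact (h1 i).mul ih
  exact h2 Finset.univ

lemma isSeparable_kernel_sub (N : ℕ) : IsSeparable (d := d) (fun x y => kernel N (x - y)) := by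
  have h : ∀ n : ℕ, IsSeparable (d := d) (fun x y => peak (x - y) ^ n) := by
    intro n
    induction n with
    | zero => simpa using isSeparable_const (d := d) 1
    | succ n ih => simp_rw [pow_succ]; exact ih.mul isSeparable_peak_sub
  exact (isSeparable_const _).mul (h N)

lemma integrable_mul_of_mem_trigPoly {f w : Torus d → ℝ} (hf : Integrable f)
    (hw : w ∈ trigPoly d) : Integrable (fun x => f x * w x) := by
  obtain ⟨C, -, hC⟩ := exists_bound_of_mem_trigPoly hw
  exact hf.mul_bdd (c := C) (continuous_of_mem_trigPoly hw).aestronglyMeasurable (ae_of_all _ hC)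

lemma moll_mem_trigPoly (N : ℕ) {f : Torus d → ℝ} (hf : Integrable f) :
    moll N f ∈ trigPoly d := by
  obtain ⟨ι, _, a, b, ha, hb, e⟩ := isSeparable_kernel_sub (d := d) N
  have : moll N f = ∑ i, (∫ y, b i y * f y) • a i := by
    ext x
    simp only [moll, e, Finset.sum_mul, Finset.sum_apply, Pi.smul_apply, smul_eq_mul]
    rw [integral_finsetSum]
    · refine Finset.sum_congr rfl fun i _ => ?_
      rw [← integral_mul_const]
      congr 1; ext y; ring
    · intro i _
      have := (integrable_mul_of_mem_trigPoly hf (hb i)).const_mul (a i x)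
      refine this.congr (ae_of_all _ fun y => ?_)
      simp only; ring
  rw [this]
  exact sum_mem fun i _ => (trigPoly d).smul_mem (ha i) _

lemma kernel_sub_mem_trigPoly (N : ℕ) (x : Torus d) :
    (fun y => kernel N (x - y)) ∈ trigPoly d := by
  obtain ⟨ι, _, a, b, ha, hb, e⟩ := isSeparable_kernel_sub (d := d) N
  have : (fun y => kernel N (x - y)) = ∑ i, a i x • b i := by
    ext y; simp [e]
  rw [this]
  exact sum_mem fun i _ => (trigPoly d).smul_mem (hb i) _

lemma moll_eq (N : ℕ) (f : Torus d → ℝ) (x : Torus d) :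
    moll N f x = ∫ z, kernel N z * f (x + z) := by
  rw [moll, ← integral_add_left_eq_self _ x]
  simp [kernel_neg]

/-- `g` is the weak partial derivative `∂ⱼ f` on the torus, tested with trigonometric
polynomials. -/
def HasTorusPartial (j : Fin d) (f g : Torus d → ℝ) : Prop :=
  ∀ w ∈ trigPoly d, ∫ x, f x * pderiv j w x = -∫ x, g x * w x

lemma pderiv_moll (N : ℕ) {f g : Torus d → ℝ} (hf : Integrable f)
    {j : Fin d} (h : HasTorusPartial j f g) (x : Torus d) :
    pderiv j (moll N f) x = moll N g x := by
  obtain ⟨ι, _, a, b, ha, hb, e⟩ := isSeparable_kernel_sub (d := d) N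
  have h1 : ∀ x, moll N f x = ∑ i, a i x * ∫ y, b i y * f y := by
    intro x
    simp only [moll, e, Finset.sum_mul]
    rw [integral_finsetSum]
    · refine Finset.sum_congr rfl fun i _ => ?_
      rw [← integral_const_mul]
      congr 1; ext y; ring
    · intro i _
      have := (integrable_mul_of_mem_trigPoly hf (hb i)).const_mul (a i x)
      refine this.congr (ae_of_all _ fun y => ?_)
      simp only; ring
  have h2 : HasDerivAt (fun s : ℝ => moll N f (x + Pi.single j (s : UnitAddCircle)))
      (∑ i, pderiv j (a i) x * ∫ y, b i y * f y) 0 := by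
    simp_rw [h1]
    exact HasDerivAt.fun_sum fun i _ => (hasDerivAt_pderiv (ha i) j x).mul_const _
  -- the derivatives of `k(x - y)` in `x` and in `y` are opposite
  have h4 : ∀ y, pderiv j (fun y => kernel N (x - y)) y = -∑ i, pderiv j (a i) x * b i y := by
    intro y
    have h5 : HasDerivAt (fun s : ℝ => kernel N ((x + Pi.single j (s : UnitAddCircle)) - y))
        (∑ i, pderiv j (a i) x * b i y) 0 := by
      simp_rw [e]
      exact HasDerivAt.fun_sum fun i _ => (hasDerivAt_pderiv (ha i) j x).mul_const _
    have h6 : HasDerivAt (fun s : ℝ => kernel N (x - (y + Pi.single j (s : UnitAddCircle))))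
        (-∑ i, pderiv j (a i) x * b i y) 0 := by
      have := HasDerivAt.scomp (0 : ℝ) (h := fun s : ℝ => -s) (by simpa using h5)
        (hasDerivAt_neg (0 : ℝ))
      simp only [neg_smul, one_smul] at this
      refine this.congr_of_eventuallyEq (Eventually.of_forall fun s => ?_)
      simp only [Function.comp]
      congr 1
      have : (Pi.single j ((-s : ℝ) : UnitAddCircle) : Torus d)
          = - Pi.single j (s : UnitAddCircle) := by
        rw [← Pi.single_neg]; simp
      rw [this]; abel
    exact h6.deriv
  have h7 := h _ (kernel_sub_mem_trigPoly N x)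
  simp_rw [h4] at h7
  have h8 : ∫ y, f y * -∑ i, pderiv j (a i) x * b i y
      = - ∑ i, pderiv j (a i) x * ∫ y, b i y * f y := by
    simp_rw [mul_neg, integral_neg, Finset.mul_sum]
    rw [integral_finsetSum]
    · congr 1
      refine Finset.sum_congr rfl fun i _ => ?_
      rw [← integral_const_mul]
      congr 1; ext y; ring
    · intro i _
      have := (integrable_mul_of_mem_trigPoly hf (hb i)).const_mul (pderiv j (a i) x)
      refine this.congr (ae_of_all _ fun y => ?_)
      simp only; ring
  rw [h8, neg_inj] at h7
  rw [show pderiv j (moll N f) x = _ from h2.deriv, h7, moll]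
  congr 1; ext y; ring

/-! ### Convergence in Lebesgue spaces on the torus -/

/-- The Lebesgue exponent `1 / a`; indexing by the reciprocal makes Hölder's inequality additive. -/
def pe (a : ℝ) : ℝ≥0∞ := (ENNReal.ofReal a)⁻¹

lemma pe_eq {a : ℝ} (ha : 0 < a) : pe a = ENNReal.ofReal a⁻¹ :=
  (ENNReal.ofReal_inv_of_pos ha).symm

lemma one_le_pe {a : ℝ} (h : a ≤ 1) : 1 ≤ pe a := by
  rw [pe, ENNReal.one_le_inv]
  exact ENNReal.ofReal_le_one.2 h

lemma pe_one : pe 1 = 1 := by simp [pe]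

lemma pe_ne_top {a : ℝ} (ha : 0 < a) : pe a ≠ ∞ := by
  rw [pe_eq ha]; exact ENNReal.ofReal_ne_top

lemma pe_ne_zero {a : ℝ} : pe a ≠ 0 := by
  simp [pe]

lemma toReal_pe {a : ℝ} (ha : 0 < a) : (pe a).toReal = a⁻¹ := by
  rw [pe_eq ha, ENNReal.toReal_ofReal (inv_pos.2 ha).le]

lemma pe_anti {a b : ℝ} (h : a ≤ b) : pe b ≤ pe a :=
  ENNReal.inv_le_inv.2 (ENNReal.ofReal_le_ofReal h)

lemma holderTriple_pe {a b : ℝ} (ha : 0 ≤ a) (hb : 0 ≤ b) :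
    ENNReal.HolderTriple (pe a) (pe b) (pe (a + b)) :=
  ⟨by simp [pe, ENNReal.ofReal_add ha hb]⟩

lemma memLp_mul {f g : Torus d → ℝ} {a b : ℝ} (ha : 0 ≤ a) (hb : 0 ≤ b)
    (hf : MemLp f (pe a) volume) (hg : MemLp g (pe b) volume) :
    MemLp (fun x => f x * g x) (pe (a + b)) volume :=
  have := holderTriple_pe ha hb
  hg.mul hf

lemma eLpNorm_mul_le {f g : Torus d → ℝ} {a b : ℝ} (ha : 0 ≤ a) (hb : 0 ≤ b)
    (hf : AEStronglyMeasurable f volume) (hg : AEStronglyMeasurable g volume) :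
    eLpNorm (fun x => f x * g x) (pe (a + b)) volume
      ≤ eLpNorm f (pe a) volume * eLpNorm g (pe b) volume := by
  have := holderTriple_pe ha hb
  have h := eLpNorm_smul_le_mul_eLpNorm (p := pe a) (q := pe b) (r := pe (a + b)) hg hf
  exact h

/-- The sequence `F N` converges to `f` in the Lebesgue space of exponent `1 / a`. -/
structure LConv (a : ℝ) (F : ℕ → Torus d → ℝ) (f : Torus d → ℝ) : Prop where
  mem : ∀ N, MemLp (F N) (pe a) volume
  lim_mem : MemLp f (pe a) volume
  tendsto : Tendsto (fun N => eLpNorm (fun x => F N x - f x) (pe a) volume) atTop (𝓝 0)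

lemma LConv.const {a : ℝ} {f : Torus d → ℝ} (hf : MemLp f (pe a) volume) :
    LConv a (fun _ => f) f :=
  ⟨fun _ => hf, hf, by simp⟩

lemma LConv.mono {a b : ℝ} (h : a ≤ b) {F : ℕ → Torus d → ℝ} {f : Torus d → ℝ}
    (hF : LConv a F f) : LConv b F f := by
  refine ⟨fun N => (hF.mem N).mono_exponent (pe_anti h), hF.lim_mem.mono_exponent (pe_anti h), ?_⟩
  refine tendsto_of_tendsto_of_tendsto_of_le_of_le tendsto_const_nhds hF.tendsto
    (fun _ => zero_le) fun N => ?_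
  exact eLpNorm_le_eLpNorm_of_exponent_le (pe_anti h)
    ((hF.mem N).sub hF.lim_mem).aestronglyMeasurable

lemma LConv.mul {a b : ℝ} (ha : 0 ≤ a) (hb : 0 ≤ b) (hab : a + b ≤ 1)
    {F G : ℕ → Torus d → ℝ} {f g : Torus d → ℝ} (hF : LConv a F f) (hG : LConv b G g) :
    LConv (a + b) (fun N x => F N x * G N x) (fun x => f x * g x) := by
  refine ⟨fun N => memLp_mul ha hb (hF.mem N) (hG.mem N),
    memLp_mul ha hb hF.lim_mem hG.lim_mem, ?_⟩
  have hlim : Tendsto (fun N => eLpNorm (fun x => F N x - f x) (pe a) volume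
      * eLpNorm (fun x => G N x - g x) (pe b) volume
      + eLpNorm (fun x => F N x - f x) (pe a) volume * eLpNorm g (pe b) volume
      + eLpNorm f (pe a) volume * eLpNorm (fun x => G N x - g x) (pe b) volume) atTop (𝓝 0) := by
    have h1 := ENNReal.Tendsto.mul hF.tendsto (Or.inr ENNReal.zero_ne_top) hG.tendsto
      (Or.inr ENNReal.zero_ne_top)
    have h2 := ENNReal.Tendsto.mul_const (b := eLpNorm g (pe b) volume) hF.tendsto
      (Or.inr hG.lim_mem.2.ne)
    have h3 := ENNReal.Tendsto.const_mul (a := eLpNorm f (pe a) volume) hG.tendsto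
      (Or.inr hF.lim_mem.2.ne)
    simpa using (h1.add h2).add h3
  refine tendsto_of_tendsto_of_tendsto_of_le_of_le tendsto_const_nhds hlim
    (fun _ => zero_le) fun N => ?_
  have mF := ((hF.mem N).sub hF.lim_mem).aestronglyMeasurable
  have mG := ((hG.mem N).sub hG.lim_mem).aestronglyMeasurable
  have e : (fun x => F N x * G N x - f x * g x)
      = ((fun x => (F N x - f x) * (G N x - g x)) + fun x => (F N x - f x) * g x)
        + fun x => f x * (G N x - g x) := by
    ext x; simp only [Pi.add_apply]; ring
  rw [e]
  refine (eLpNorm_add_le ((mF.mul mG).add (mF.mul hG.lim_mem.1)) (hF.lim_mem.1.mul mG)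
    (one_le_pe hab)).trans ?_
  refine add_le_add ((eLpNorm_add_le (mF.mul mG) (mF.mul hG.lim_mem.1) (one_le_pe hab)).trans ?_)
    (eLpNorm_mul_le ha hb hF.lim_mem.1 mG)
  exact add_le_add (eLpNorm_mul_le ha hb mF mG) (eLpNorm_mul_le ha hb mF hG.lim_mem.1)

lemma memLp_pe_integrable {a : ℝ} (ha : a ≤ 1) {f : Torus d → ℝ} (hf : MemLp f (pe a) volume) :
    Integrable f :=
  hf.integrable (one_le_pe ha)

lemma LConv.tendsto_integral {a : ℝ} (ha : a ≤ 1) {F : ℕ → Torus d → ℝ} {f : Torus d → ℝ}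
    (hF : LConv a F f) : Tendsto (fun N => ∫ x, F N x) atTop (𝓝 (∫ x, f x)) := by
  have h1 := hF.mono ha
  refine tendsto_integral_of_L1' f h1.lim_mem.1
    (Eventually.of_forall fun N => memLp_pe_integrable le_rfl (h1.mem N)) ?_
  have := h1.tendsto
  rw [pe_one] at this
  exact this

lemma moll_congr {f g : Torus d → ℝ} (h : f =ᵐ[volume] g) (N : ℕ) : moll N f = moll N g := by
  ext x
  exact integral_congr_ae (h.mono fun y hy => by simp only [hy])

lemma moll_sub {f g : Torus d → ℝ} (hf : Integrable f) (hg : Integrable g) (N : ℕ) (x : Torus d) :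
    moll N (fun y => f y - g y) x = moll N f x - moll N g x := by
  simp only [moll, mul_sub]
  refine integral_sub ?_ ?_
  · exact (integrable_mul_of_mem_trigPoly hf (kernel_sub_mem_trigPoly N x)).congr
      (ae_of_all _ fun y => mul_comm _ _)
  · exact (integrable_mul_of_mem_trigPoly hg (kernel_sub_mem_trigPoly N x)).congr
      (ae_of_all _ fun y => mul_comm _ _)

/-- Young's inequality: mollification does not increase the norm. -/
lemma eLpNorm_moll_le {a : ℝ} (ha : 0 < a) (ha1 : a ≤ 1) {f : Torus d → ℝ}
    (hf : AEStronglyMeasurable f volume) (N : ℕ) :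
    eLpNorm (moll N f) (pe a) volume ≤ eLpNorm f (pe a) volume := by
  obtain ⟨g, hg, hfg⟩ := hf
  rw [moll_congr hfg, eLpNorm_congr_ae hfg]
  clear hfg
  have hgm : Measurable g := hg.measurable
  rw [eLpNorm_eq_lintegral_rpow_enorm_toReal pe_ne_zero (pe_ne_top ha),
    eLpNorm_eq_lintegral_rpow_enorm_toReal pe_ne_zero (pe_ne_top ha), toReal_pe ha]
  refine ENNReal.rpow_le_rpow ?_ (by positivity)
  have hkm : Measurable fun z : Torus d => ENNReal.ofReal (kernel N z) :=
    (continuous_kernel N).measurable.ennreal_ofReal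
  calc ∫⁻ x, ‖moll N g x‖ₑ ^ a⁻¹
      ≤ ∫⁻ x, ∫⁻ z, ENNReal.ofReal (kernel N z) * ‖g (x + z)‖ₑ ^ a⁻¹ := by
        refine lintegral_mono fun x => ?_
        have h1 : ‖moll N g x‖ₑ ≤ ∫⁻ z, ENNReal.ofReal (kernel N z) * ‖g (x + z)‖ₑ := by
          rw [moll_eq]
          refine (enorm_integral_le_lintegral_enorm _).trans (lintegral_mono fun z => ?_)
          rw [enorm_mul, Real.enorm_eq_ofReal (kernel_nonneg N z)]
        have h2 := ENNReal.lintegral_mul_norm_pow_le (μ := (volume : Measure (Torus d)))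
          (f := fun z => ENNReal.ofReal (kernel N z) * ‖g (x + z)‖ₑ ^ a⁻¹)
          (g := fun z => ENNReal.ofReal (kernel N z)) (p := a) (q := 1 - a)
          (by fun_prop) hkm.aemeasurable ha.le (by linarith) (by ring)
        rw [lintegral_kernel, ENNReal.one_rpow, mul_one] at h2
        have h3 : ∀ z, (ENNReal.ofReal (kernel N z) * ‖g (x + z)‖ₑ ^ a⁻¹) ^ a
            * ENNReal.ofReal (kernel N z) ^ (1 - a)
            = ENNReal.ofReal (kernel N z) * ‖g (x + z)‖ₑ := by
          intro z
          rw [ENNReal.mul_rpow_of_nonneg _ _ ha.le, ← ENNReal.rpow_mul, inv_mul_cancel₀ ha.ne',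
            ENNReal.rpow_one, mul_right_comm, ← ENNReal.rpow_add_of_nonneg _ _ ha.le (by linarith)]
          simp
        simp_rw [h3] at h2
        have h4 := ENNReal.rpow_le_rpow (h1.trans h2) (inv_pos.2 ha).le
        rwa [← ENNReal.rpow_mul, mul_inv_cancel₀ ha.ne', ENNReal.rpow_one] at h4
    _ = ∫⁻ z, ∫⁻ x, ENNReal.ofReal (kernel N z) * ‖g (x + z)‖ₑ ^ a⁻¹ :=
        lintegral_lintegral_swap (Measurable.aemeasurable
          ((hkm.comp measurable_snd).mul ((hgm.comp measurable_add).enorm.pow_const _)))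
    _ = ∫⁻ z : Torus d, ENNReal.ofReal (kernel N z) * ∫⁻ x, ‖g x‖ₑ ^ a⁻¹ := by
        refine lintegral_congr fun z => ?_
        have hz : Measurable fun x => ‖g (x + z)‖ₑ ^ a⁻¹ :=
          ((hgm.comp (measurable_add_const z)).enorm).pow_const _
        rw [lintegral_const_mul _ hz, lintegral_add_right_eq_self (fun x => ‖g x‖ₑ ^ a⁻¹) z]
    _ = ∫⁻ x, ‖g x‖ₑ ^ a⁻¹ := by
        rw [lintegral_mul_const _ hkm, lintegral_kernel, one_mul]

/-- The mollifications of a continuous function converge pointwise, by the peak function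
theorem. -/
lemma tendsto_moll_of_continuous {g : Torus d → ℝ} (hg : Continuous g) (x : Torus d) :
    Tendsto (fun N => moll N g x) atTop (𝓝 (g x)) := by
  have h := tendsto_setIntegral_pow_smul_of_unique_maximum_of_isCompact_of_continuousOn
    (μ := (volume : Measure (Torus d))) (s := univ) (x₀ := (0 : Torus d)) (c := peak)
    (g := fun z => g (x + z)) isCompact_univ continuous_peak.continuousOn
    (fun y _ hy => peak_lt hy) (fun y _ => peak_nonneg y) (by rw [peak_zero]; positivity)
    (by simp) (by fun_prop)
  simp only [add_zero, Measure.restrict_univ, smul_eq_mul] at h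
  refine h.congr fun N => ?_
  rw [moll_eq, ← integral_const_mul]
  congr 1; ext z; simp only [kernel]; ring

lemma abs_moll_le {g : Torus d → ℝ} {C : ℝ} (hC : ∀ x, |g x| ≤ C) (N : ℕ) (x : Torus d) :
    |moll N g x| ≤ C := by
  rw [moll_eq]
  have h1 : ∀ z, |kernel N z * g (x + z)| ≤ C * kernel N z := fun z => by
    rw [abs_mul, abs_of_nonneg (kernel_nonneg N z), mul_comm]
    exact mul_le_mul_of_nonneg_right (hC _) (kernel_nonneg N z)
  rw [← Real.norm_eq_abs]
  calc ‖∫ z, kernel N z * g (x + z)‖ ≤ ∫ z : Torus d, C * kernel N z :=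
        norm_integral_le_of_norm_le ((integrable_kernel N).const_mul C) (ae_of_all _ h1)
    _ = C := by rw [integral_const_mul, integral_kernel N, mul_one]

lemma tendsto_eLpNorm_moll_of_continuous {a : ℝ} (ha : 0 < a) {g : Torus d → ℝ}
    (hg : Continuous g) :
    Tendsto (fun N => eLpNorm (fun x => moll N g x - g x) (pe a) volume) atTop (𝓝 0) := by
  obtain ⟨C, hC⟩ := isCompact_univ.exists_bound_of_continuousOn hg.continuousOn
  have hC : ∀ x, |g x| ≤ C := fun x => hC x trivial
  have hgi : Integrable g := hg.integrable_of_hasCompactSupport (HasCompactSupport.of_compactSpace _)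
  have hm : ∀ N, Continuous (moll N g) := fun N =>
    continuous_of_mem_trigPoly (moll_mem_trigPoly N hgi)
  have h1 : Tendsto (fun N => ∫⁻ x, ‖moll N g x - g x‖ₑ ^ a⁻¹) atTop
      (𝓝 (∫⁻ _ : Torus d, 0)) := by
    refine tendsto_lintegral_of_dominated_convergence (fun _ => ENNReal.ofReal (2 * C) ^ a⁻¹)
      (fun N => ?_) (fun N => ae_of_all _ fun x => ?_) ?_ (ae_of_all _ fun x => ?_)
    · have := (hm N).measurable
      have := hg.measurable
      fun_prop
    · refine ENNReal.rpow_le_rpow ?_ (by positivity)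
      rw [← ofReal_norm]
      refine ENNReal.ofReal_le_ofReal ((norm_sub_le _ _).trans ?_)
      have := abs_moll_le hC N x
      have := hC x
      simp only [Real.norm_eq_abs]; linarith
    · simp only [lintegral_const, measure_univ, mul_one]
      exact ENNReal.rpow_ne_top_of_nonneg (by positivity) ENNReal.ofReal_ne_top
    · have h2 : Tendsto (fun N => moll N g x - g x) atTop (𝓝 0) := by
        simpa using (tendsto_moll_of_continuous hg x).sub_const (g x)
      have h3 : Tendsto (fun N => ‖moll N g x - g x‖ₑ) atTop (𝓝 0) := by
        simpa using h2.enorm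
      have := (ENNReal.continuous_rpow_const (y := a⁻¹)).tendsto 0 |>.comp h3
      rwa [ENNReal.zero_rpow_of_pos (by positivity)] at this
  simp only [lintegral_zero] at h1
  simp_rw [eLpNorm_eq_lintegral_rpow_enorm_toReal pe_ne_zero (pe_ne_top ha), toReal_pe ha]
  have h4 := (ENNReal.continuous_rpow_const (y := 1 / a⁻¹)).tendsto 0 |>.comp h1
  rwa [ENNReal.zero_rpow_of_pos (by positivity)] at h4

lemma lConv_moll {a : ℝ} (ha : 0 < a) (ha1 : a ≤ 1) {f : Torus d → ℝ}
    (hf : MemLp f (pe a) volume) : LConv a (fun N => moll N f) f := by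
  have hfi := memLp_pe_integrable ha1 hf
  have hmem : ∀ N, MemLp (moll N f) (pe a) volume := fun N =>
    memLp_of_mem_trigPoly (moll_mem_trigPoly N hfi) _
  refine ⟨hmem, hf, ?_⟩
  rw [ENNReal.tendsto_nhds_zero]
  intro ε hε
  have hε3 : ε / 3 ≠ 0 := (ENNReal.div_pos hε.ne' (by norm_num)).ne'
  obtain ⟨g, hg, hgm⟩ := hf.exists_boundedContinuous_eLpNorm_sub_le (pe_ne_top ha) hε3
  have hgi := memLp_pe_integrable ha1 hgm
  filter_upwards [(ENNReal.tendsto_nhds_zero.1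
    (tendsto_eLpNorm_moll_of_continuous ha g.continuous)) (ε / 3) (pos_iff_ne_zero.2 hε3)] with N hN
  have e : (fun x => moll N f x - f x)
      = (moll N (fun y => f y - g y) + fun x => moll N g x - g x) - (f - (g : Torus d → ℝ)) := by
    ext x
    simp only [Pi.add_apply, Pi.sub_apply, moll_sub hfi hgi]; ring
  have m1 : AEStronglyMeasurable (moll N (fun y => f y - g y)) volume :=
    (memLp_of_mem_trigPoly (moll_mem_trigPoly N (hfi.sub hgi)) 1).1
  have m2 : AEStronglyMeasurable (fun x => moll N g x - g x) volume :=
    (memLp_of_mem_trigPoly (moll_mem_trigPoly N hgi) 1).1.sub hgm.1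
  rw [e]
  calc eLpNorm _ (pe a) volume
      ≤ (eLpNorm (moll N (fun y => f y - g y)) (pe a) volume
        + eLpNorm (fun x => moll N g x - g x) (pe a) volume)
        + eLpNorm (f - (g : Torus d → ℝ)) (pe a) volume :=
        (eLpNorm_sub_le (m1.add m2) (hf.1.sub hgm.1) (one_le_pe ha1)).trans
          (add_le_add (eLpNorm_add_le m1 m2 (one_le_pe ha1)) le_rfl)
    _ ≤ (ε / 3 + ε / 3) + ε / 3 :=
        add_le_add (add_le_add ((eLpNorm_moll_le ha ha1 (hf.1.sub hgm.1) N).trans hg) hN) hg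
    _ = ε := ENNReal.add_thirds ε

/-- The fundamental lemma of the calculus of variations, for trigonometric polynomials. -/
lemma ae_eq_zero_of_integral_trigPoly {f : Torus d → ℝ} (hf : Integrable f)
    (h : ∀ w ∈ trigPoly d, ∫ x, f x * w x = 0) : f =ᵐ[volume] 0 := by
  have h0 : ∀ N, moll N f = 0 := fun N => by
    ext x
    have := h _ (kernel_sub_mem_trigPoly N x)
    simp only [moll, Pi.zero_apply]
    rw [← this]; congr 1; ext y; ring
  have h1 := (lConv_moll one_pos le_rfl (by rwa [pe_one, memLp_one_iff_integrable] :
    MemLp f (pe 1) volume)).tendsto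
  simp only [h0, Pi.zero_apply, zero_sub, pe_one] at h1
  have h2 := tendsto_nhds_unique h1 tendsto_const_nhds
  rw [show (fun x => -f x) = -f from rfl, eLpNorm_neg] at h2
  exact (eLpNorm_eq_zero_iff hf.1 one_ne_zero).1 h2.symm

/-! ### Mixed Lebesgue norms -/

/-- The Lebesgue norm of exponent `1 / a` of a function with values in `[0, ∞]`. -/
def nrm {α : Type*} [MeasurableSpace α] (a : ℝ) (ν : Measure α) (φ : α → ℝ≥0∞) : ℝ≥0∞ :=
  (∫⁻ t, φ t ^ a⁻¹ ∂ν) ^ a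

lemma nrm_mul_le {α : Type*} [MeasurableSpace α] {ν : Measure α} {a b : ℝ} (ha : 0 < a)
    (hb : 0 < b) {φ ψ : α → ℝ≥0∞} (hφ : AEMeasurable φ ν) (hψ : AEMeasurable ψ ν) :
    nrm (a + b) ν (fun t => φ t * ψ t) ≤ nrm a ν φ * nrm b ν ψ := by
  have hab : 0 < a + b := by positivity
  have h := ENNReal.lintegral_mul_norm_pow_le (hφ.pow_const a⁻¹) (hψ.pow_const b⁻¹)
    (p := a / (a + b)) (q := b / (a + b)) (by positivity) (by positivity) (by field_simp)
  have e : ∀ t, (φ t ^ a⁻¹) ^ (a / (a + b)) * (ψ t ^ b⁻¹) ^ (b / (a + b))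
      = (φ t * ψ t) ^ (a + b)⁻¹ := by
    intro t
    rw [ENNReal.mul_rpow_of_nonneg _ _ (by positivity), ← ENNReal.rpow_mul, ← ENNReal.rpow_mul]
    congr 2 <;> field_simp
  simp_rw [e] at h
  have h2 := ENNReal.rpow_le_rpow h hab.le
  rw [ENNReal.mul_rpow_of_nonneg _ _ hab.le, ← ENNReal.rpow_mul, ← ENNReal.rpow_mul,
    div_mul_cancel₀ _ hab.ne', div_mul_cancel₀ _ hab.ne'] at h2
  exact h2

lemma nrm_mono {α : Type*} [MeasurableSpace α] {ν : Measure α} {a : ℝ} (ha : 0 ≤ a)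
    {φ ψ : α → ℝ≥0∞} (h : φ ≤ᵐ[ν] ψ) : nrm a ν φ ≤ nrm a ν ψ :=
  ENNReal.rpow_le_rpow (lintegral_mono_ae (h.mono fun _ ht =>
    ENNReal.rpow_le_rpow ht (inv_nonneg.2 ha))) ha

lemma nrm_one {α : Type*} [MeasurableSpace α] {ν : Measure α} {φ : α → ℝ≥0∞} :
    nrm 1 ν φ = ∫⁻ t, φ t ∂ν := by
  simp [nrm]

lemma nrm_const_lt_top {α : Type*} [MeasurableSpace α] {ν : Measure α} [IsFiniteMeasure ν]
    {a : ℝ} (ha : 0 < a) {c : ℝ≥0∞} (hc : c ≠ ∞) : nrm a ν (fun _ => c) < ∞ := by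
  rw [nrm, lintegral_const]
  exact ENNReal.rpow_lt_top_of_nonneg ha.le (ENNReal.mul_ne_top
    (ENNReal.rpow_ne_top_of_nonneg (inv_pos.2 ha).le hc) (measure_ne_top _ _))

lemma nrm_lt_top_mono {α : Type*} [MeasurableSpace α] {ν : Measure α} [IsFiniteMeasure ν]
    {a b : ℝ} (ha : 0 < a) (hab : a ≤ b) {φ : α → ℝ≥0∞} (hφ : AEMeasurable φ ν)
    (h : nrm a ν φ < ∞) : nrm b ν φ < ∞ := by
  rcases hab.eq_or_lt with rfl | hab
  · exact h
  have := nrm_mul_le ha (sub_pos.2 hab) hφ (aemeasurable_const (b := (1 : ℝ≥0∞)))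
  simp only [mul_one, add_sub_cancel] at this
  exact this.trans_lt (ENNReal.mul_lt_top h (nrm_const_lt_top (sub_pos.2 hab) ENNReal.one_ne_top))

lemma eLpNorm_eq_lintegral {E : Type*} [NormedAddCommGroup E] {α : Type*} [MeasurableSpace α]
    {ν : Measure α} {b : ℝ} (hb : 0 < b) (f : α → E) :
    eLpNorm f (pe b) ν = (∫⁻ x, ‖f x‖ₑ ^ b⁻¹ ∂ν) ^ b := by
  rw [eLpNorm_eq_lintegral_rpow_enorm_toReal pe_ne_zero (pe_ne_top hb), toReal_pe hb]
  simp

lemma aemeasurable_eLpNorm_slice {ν : Measure ℝ} {b : ℝ} (hb : 0 < b) {f : ℝ → Torus d → ℝ}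
    (hf : AEStronglyMeasurable (fun z : ℝ × Torus d => f z.1 z.2) (ν.prod volume)) :
    AEMeasurable (fun t => eLpNorm (f t) (pe b) volume) ν := by
  simp_rw [eLpNorm_eq_lintegral hb]
  exact ((hf.enorm.pow_const b⁻¹).lintegral_prod_right').pow_const b

/-- Hölder's inequality in mixed norms, for conjugate exponents. -/
lemma lintegral_mul_le_nrm {ν : Measure ℝ} [SFinite ν] {a b : ℝ} (ha : 0 < a) (ha1 : a < 1)
    (hb : 0 < b) (hb1 : b < 1) {f g : ℝ → Torus d → ℝ}
    (hf : AEStronglyMeasurable (fun z : ℝ × Torus d => f z.1 z.2) (ν.prod volume))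
    (hg : AEStronglyMeasurable (fun z : ℝ × Torus d => g z.1 z.2) (ν.prod volume)) :
    ∫⁻ s, (∫⁻ x, ‖f s x‖ₑ * ‖g s x‖ₑ) ∂ν
      ≤ nrm a ν (fun s => eLpNorm (f s) (pe b) volume)
        * nrm (1 - a) ν (fun s => eLpNorm (g s) (pe (1 - b)) volume) := by
  have h1 : ∫⁻ s, (∫⁻ x, ‖f s x‖ₑ * ‖g s x‖ₑ) ∂ν
      ≤ ∫⁻ s, eLpNorm (f s) (pe b) volume * eLpNorm (g s) (pe (1 - b)) volume ∂ν := by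
    refine lintegral_mono_ae ?_
    filter_upwards [hf.prodMk_left, hg.prodMk_left] with s hfs hgs
    have := eLpNorm_mul_le hb.le (sub_pos.2 hb1).le hfs hgs
    rw [add_sub_cancel, pe_one, eLpNorm_one_eq_lintegral_enorm] at this
    simpa [enorm_mul] using this
  refine h1.trans ?_
  have := nrm_mul_le ha (sub_pos.2 ha1) (aemeasurable_eLpNorm_slice hb hf)
    (aemeasurable_eLpNorm_slice (sub_pos.2 hb1) hg)
  rwa [add_sub_cancel, nrm_one] at this

/-- `f ∈ L^{1/a}(0,T; L^{1/b}(𝕋ᵈ))`, for positive reals `a` and `b`. -/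
structure Mix (T a b : ℝ) (f : ℝ → Torus d → ℝ) : Prop where
  meas : AEStronglyMeasurable (fun z : ℝ × Torus d => f z.1 z.2) (spaceTime d T)
  lt_top : nrm a (volume.restrict (Ioo 0 T)) (fun t => eLpNorm (f t) (pe b) volume) < ∞

variable {T : ℝ}

lemma Mix.of_memLpLq {F : Type*} [NormedAddCommGroup F] {P Q : ℝ} (hP : 0 < P) (hQ : 0 < Q)
    {f : ℝ → Torus d → F} (hf : MemLpLq T (ENNReal.ofReal P) (ENNReal.ofReal Q) f)
    {g : ℝ → Torus d → ℝ}
    (hg : AEStronglyMeasurable (fun z : ℝ × Torus d => g z.1 z.2) (spaceTime d T))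
    (hgf : ∀ t x, ‖g t x‖ ≤ ‖f t x‖) : Mix T P⁻¹ Q⁻¹ g := by
  refine ⟨hg, ?_⟩
  have h := hf.2
  rw [eLpNorm_eq_lintegral_rpow_enorm_toReal (by simpa using hP) ENNReal.ofReal_ne_top,
    ENNReal.toReal_ofReal hP.le] at h
  simp only [enorm_eq_self, one_div] at h
  refine lt_of_le_of_lt ?_ h
  rw [nrm, inv_inv]
  refine ENNReal.rpow_le_rpow (lintegral_mono fun t => ENNReal.rpow_le_rpow ?_ hP.le)
    (inv_pos.2 hP).le
  rw [pe_eq (inv_pos.2 hQ), inv_inv]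
  exact eLpNorm_mono (hgf t)

lemma Mix.of_le {a b : ℝ} (ha : 0 ≤ a) {f g : ℝ → Torus d → ℝ} (hf : Mix T a b f)
    (hg : AEStronglyMeasurable (fun z : ℝ × Torus d => g z.1 z.2) (spaceTime d T))
    (hgf : ∀ t x, |g t x| ≤ |f t x|) : Mix T a b g :=
  ⟨hg, (nrm_mono ha (ae_of_all _ fun t => eLpNorm_mono (hgf t))).trans_lt hf.lt_top⟩

lemma Mix.aemeasurable {a b : ℝ} (hb : 0 < b) {f : ℝ → Torus d → ℝ} (hf : Mix T a b f) :
    AEMeasurable (fun t => eLpNorm (f t) (pe b) volume) (volume.restrict (Ioo 0 T)) :=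
  aemeasurable_eLpNorm_slice hb hf.meas

lemma Mix.mul {a b a' b' : ℝ} (ha : 0 < a) (hb : 0 < b) (ha' : 0 < a') (hb' : 0 < b')
    {f g : ℝ → Torus d → ℝ} (hf : Mix T a b f) (hg : Mix T a' b' g) :
    Mix T (a + a') (b + b') (fun t x => f t x * g t x) := by
  refine ⟨hf.meas.mul hg.meas, ?_⟩
  refine lt_of_le_of_lt ?_ (ENNReal.mul_lt_top hf.lt_top hg.lt_top)
  refine le_trans (nrm_mono (by positivity) ?_)
    (nrm_mul_le ha ha' (hf.aemeasurable hb) (hg.aemeasurable hb'))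
  filter_upwards [hf.meas.prodMk_left, hg.meas.prodMk_left] with t h1 h2
  exact eLpNorm_mul_le hb.le hb'.le h1 h2

lemma Mix.mono {a b a' b' : ℝ} (ha : 0 < a) (hb : 0 < b) (haa : a ≤ a') (hbb : b ≤ b')
    {f : ℝ → Torus d → ℝ} (hf : Mix T a b f) : Mix T a' b' f := by
  refine ⟨hf.meas, ?_⟩
  refine lt_of_le_of_lt (nrm_mono (ha.le.trans haa) ?_)
    (nrm_lt_top_mono ha haa (hf.aemeasurable hb) hf.lt_top)
  filter_upwards [hf.meas.prodMk_left] with t h1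
  exact eLpNorm_le_eLpNorm_of_exponent_le (pe_anti hbb) h1

lemma Mix.abs_rpow {a b c : ℝ} (ha : 0 < a) (hb : 0 < b) (hc : 0 < c) {f : ℝ → Torus d → ℝ}
    (hf : Mix T a b f) : Mix T (c * a) (c * b) (fun t x => |f t x| ^ c) := by
  have hm : AEStronglyMeasurable (fun z : ℝ × Torus d => |f z.1 z.2| ^ c) (spaceTime d T) :=
    (Real.continuous_rpow_const hc.le).comp_aestronglyMeasurable
      (continuous_abs.comp_aestronglyMeasurable hf.meas)
  refine ⟨hm, ?_⟩
  have e : ∀ t, eLpNorm (fun x => |f t x| ^ c) (pe (c * b)) volume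
      = eLpNorm (f t) (pe b) volume ^ c := by
    intro t
    have := eLpNorm_norm_rpow (p := pe (c * b)) (μ := (volume : Measure (Torus d))) (f t) hc
    rw [show pe (c * b) * ENNReal.ofReal c = pe b by
      rw [pe_eq (by positivity), pe_eq hb, ← ENNReal.ofReal_mul (by positivity)]
      congr 1; field_simp] at this
    exact this
  simp_rw [e, nrm, ← ENNReal.rpow_mul]
  have h := hf.lt_top
  rw [nrm] at h
  rw [show c * (c * a)⁻¹ = a⁻¹ by field_simp, mul_comm c a, ENNReal.rpow_mul]
  exact ENNReal.rpow_lt_top_of_nonneg hc.le h.ne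

lemma Mix.sqrt {a b : ℝ} (ha : 0 < a) (hb : 0 < b) {f : ℝ → Torus d → ℝ}
    (hf : Mix T a b f) : Mix T (a / 2) (b / 2) (fun t x => √(f t x)) := by
  have h := hf.abs_rpow ha hb (c := 1 / 2) (by norm_num)
  rw [show 1 / 2 * a = a / 2 by ring, show 1 / 2 * b = b / 2 by ring] at h
  refine h.of_le (by positivity) (Real.continuous_sqrt.comp_aestronglyMeasurable hf.meas)
    fun t x => ?_
  rw [← Real.sqrt_eq_rpow, abs_of_nonneg (Real.sqrt_nonneg _), abs_of_nonneg (Real.sqrt_nonneg _)]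
  exact Real.sqrt_le_sqrt (le_abs_self _)

lemma Mix.lintegral_lt_top {a b : ℝ} (ha : 0 < a) (ha1 : a ≤ 1) (hb : 0 < b)
    {f : ℝ → Torus d → ℝ} (hf : Mix T a b f) :
    ∫⁻ t in Ioo 0 T, eLpNorm (f t) (pe b) volume < ∞ := by
  have := nrm_lt_top_mono ha ha1 (hf.aemeasurable hb) hf.lt_top
  rwa [nrm_one] at this

lemma Mix.memLp_slice {a b : ℝ} (ha : 0 < a) (hb : 0 < b)
    {f : ℝ → Torus d → ℝ} (hf : Mix T a b f) :
    ∀ᵐ t ∂(volume.restrict (Ioo 0 T)), MemLp (f t) (pe b) volume := by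
  have h := hf.lt_top
  rw [nrm, ENNReal.rpow_lt_top_iff_of_pos ha] at h
  filter_upwards [hf.meas.prodMk_left,
    ae_lt_top' ((hf.aemeasurable hb).pow_const a⁻¹) h.ne] with t h1 h2
  exact ⟨h1, (ENNReal.rpow_lt_top_iff_of_pos (inv_pos.2 ha)).1 h2⟩

instance : SFinite (spaceTime d T) := by unfold spaceTime; infer_instance

instance : IsFiniteMeasure (spaceTime d T) := by unfold spaceTime; infer_instance

lemma Mix.integrable {a b : ℝ} (ha : 0 < a) (ha1 : a ≤ 1) (hb : 0 < b) (hb1 : b ≤ 1)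
    {f : ℝ → Torus d → ℝ} (hf : Mix T a b f) :
    Integrable (fun z : ℝ × Torus d => f z.1 z.2) (spaceTime d T) := by
  refine ⟨hf.meas, ?_⟩
  have h := (hf.mono ha hb le_rfl hb1).lintegral_lt_top ha ha1 one_pos
  simp_rw [pe_one, eLpNorm_one_eq_lintegral_enorm] at h
  rw [HasFiniteIntegral, spaceTime, lintegral_prod _ hf.meas.enorm]
  exact h

/-! ### Continuity of the time translations in mixed norms -/

lemma measurePreserving_shift (σ : ℝ) :
    MeasurePreserving (fun z : ℝ × Torus d => (z.1 + σ, z.2))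
      ((volume : Measure ℝ).prod (volume : Measure (Torus d)))
      ((volume : Measure ℝ).prod (volume : Measure (Torus d))) :=
  (measurePreserving_add_right volume σ).prod (MeasurePreserving.id volume)

lemma tendsto_translation_L1 {F : ℝ × Torus d → ℝ}
    (hF : Integrable F ((volume : Measure ℝ).prod (volume : Measure (Torus d)))) :
    Tendsto (fun σ : ℝ => ∫⁻ z, ‖F (z.1 + σ, z.2) - F z‖ₑ
      ∂((volume : Measure ℝ).prod (volume : Measure (Torus d)))) (𝓝 0) (𝓝 0) := by
  have : ((volume : Measure ℝ).prod (volume : Measure (Torus d))).Regular :=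
    Measure.Regular.of_sigmaCompactSpace_of_isLocallyFiniteMeasure _
  let g : ℝ → C(ℝ × Torus d, ℝ × Torus d) := fun σ => ⟨fun z => (z.1 + σ, z.2), by fun_prop⟩
  have hg : Continuous g := ContinuousMap.continuous_of_continuous_uncurry _ (by
    simp only [g, Function.uncurry_def, ContinuousMap.coe_mk]; fun_prop)
  have h := (continuous_const (y := hF.toL1 F)).compMeasurePreservingLp hg
    (fun σ => measurePreserving_shift σ) ENNReal.one_ne_top
  have h0 := (h.tendsto 0)
  rw [tendsto_iff_edist_tendsto_0] at h0
  refine h0.congr fun σ => ?_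
  rw [Lp.edist_def, eLpNorm_one_eq_lintegral_enorm]
  refine lintegral_congr_ae ?_
  have e := hF.coeFn_toL1
  filter_upwards [Lp.coeFn_compMeasurePreserving (hF.toL1 F) (measurePreserving_shift (d := d) σ),
    Lp.coeFn_compMeasurePreserving (hF.toL1 F) (measurePreserving_shift (d := d) 0), e,
    (measurePreserving_shift (d := d) σ).quasiMeasurePreserving.ae e] with z h1 h2 h3 h4
  simp only [Pi.sub_apply]
  erw [h1, h2]
  simp only [Function.comp_apply, add_zero, h4, Prod.mk.eta, h3]

lemma tendsto_nrm_tail {ν : Measure ℝ} [SFinite ν] {a b : ℝ} (ha : 0 < a) (hb : 0 < b)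
    {G : ℝ → Torus d → ℝ}
    (hG : StronglyMeasurable (fun z : ℝ × Torus d => G z.1 z.2))
    (hfin : nrm a ν (fun t => eLpNorm (G t) (pe b) volume) < ∞) :
    Tendsto (fun M : ℕ => nrm a ν (fun t =>
      eLpNorm (fun x => if (M : ℝ) < |G t x| then G t x else 0) (pe b) volume)) atTop (𝓝 0) := by
  have hset : ∀ M : ℕ, MeasurableSet {z : ℝ × Torus d | (M : ℝ) < |G z.1 z.2|} := fun M =>
    measurableSet_lt measurable_const hG.measurable.abs
  have hm : ∀ M : ℕ, Measurable
      (fun z : ℝ × Torus d => if (M : ℝ) < |G z.1 z.2| then G z.1 z.2 else 0) := fun M =>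
    Measurable.ite (hset M) hG.measurable measurable_const
  have hle : ∀ (M : ℕ) t x, ‖if (M : ℝ) < |G t x| then G t x else 0‖ₑ ≤ ‖G t x‖ₑ := by
    intro M t x; split_ifs <;> simp
  have hfin2 : ∫⁻ t, eLpNorm (G t) (pe b) volume ^ a⁻¹ ∂ν < ∞ := by
    rwa [nrm, ENNReal.rpow_lt_top_iff_of_pos ha] at hfin
  have hmeas : AEMeasurable (fun t => eLpNorm (G t) (pe b) volume) ν :=
    aemeasurable_eLpNorm_slice hb hG.aestronglyMeasurable
  have hfae := ae_lt_top' (hmeas.pow_const a⁻¹) hfin2.ne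
  have hinner : ∀ᵐ t ∂ν, Tendsto (fun M : ℕ =>
      eLpNorm (fun x => if (M : ℝ) < |G t x| then G t x else 0) (pe b) volume) atTop (𝓝 0) := by
    filter_upwards [hfae] with t ht
    rw [ENNReal.rpow_lt_top_iff_of_pos (inv_pos.2 ha), eLpNorm_eq_lintegral hb,
      ENNReal.rpow_lt_top_iff_of_pos hb] at ht
    simp_rw [eLpNorm_eq_lintegral hb]
    have h1 : Tendsto (fun M : ℕ => ∫⁻ x, ‖if (M : ℝ) < |G t x| then G t x else 0‖ₑ ^ b⁻¹) atTop
        (𝓝 (∫⁻ _ : Torus d, 0)) := by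
      refine tendsto_lintegral_of_dominated_convergence (fun x => ‖G t x‖ₑ ^ b⁻¹)
        (fun M => ?_) (fun M => ae_of_all _ fun x =>
          ENNReal.rpow_le_rpow (hle M t x) (inv_pos.2 hb).le) ht.ne (ae_of_all _ fun x => ?_)
      · exact (((hm M).comp measurable_prodMk_left).enorm).pow_const _
      · refine tendsto_const_nhds.congr' ?_
        obtain ⟨M₀, hM₀⟩ := exists_nat_ge |G t x|
        filter_upwards [eventually_ge_atTop M₀] with M hM
        have : ¬ (M : ℝ) < |G t x| := not_lt.2 (hM₀.trans (by exact_mod_cast hM))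
        simp [this, hb]
    simp only [lintegral_zero] at h1
    have h4 := (ENNReal.continuous_rpow_const (y := b)).tendsto 0 |>.comp h1
    rwa [ENNReal.zero_rpow_of_pos hb] at h4
  have h1 : Tendsto (fun M : ℕ => ∫⁻ t,
      eLpNorm (fun x => if (M : ℝ) < |G t x| then G t x else 0) (pe b) volume ^ a⁻¹ ∂ν) atTop
      (𝓝 (∫⁻ _, 0 ∂ν)) := by
    refine tendsto_lintegral_of_dominated_convergence'
      (fun t => eLpNorm (G t) (pe b) volume ^ a⁻¹) (fun M => ?_) (fun M => ae_of_all _ fun t =>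
        ENNReal.rpow_le_rpow (eLpNorm_mono_enorm (hle M t)) (inv_pos.2 ha).le) hfin2.ne ?_
    · exact (aemeasurable_eLpNorm_slice
        (f := fun t x => if (M : ℝ) < |G t x| then G t x else 0) hb
        (hm M).aestronglyMeasurable).pow_const _
    · filter_upwards [hinner] with t ht
      have h4 := (ENNReal.continuous_rpow_const (y := a⁻¹)).tendsto 0 |>.comp ht
      rwa [ENNReal.zero_rpow_of_pos (inv_pos.2 ha)] at h4
  simp only [lintegral_zero] at h1
  have h4 := (ENNReal.continuous_rpow_const (y := a)).tendsto 0 |>.comp h1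
  rwa [ENNReal.zero_rpow_of_pos ha] at h4

/-- Time translations are continuous in mixed norms, in duality with a fixed function: the tail of
`G` is controlled by Hölder's inequality, its bounded part by continuity in `L¹`. -/
lemma tendsto_translation_pairing {a b : ℝ} (ha : 0 < a) (ha1 : a < 1) (hb : 0 < b) (hb1 : b < 1)
    {F G : ℝ → Torus d → ℝ}
    (hF : StronglyMeasurable (fun z : ℝ × Torus d => F z.1 z.2))
    (hG : StronglyMeasurable (fun z : ℝ × Torus d => G z.1 z.2))
    (hF1 : Integrable (fun z : ℝ × Torus d => F z.1 z.2)
      ((volume : Measure ℝ).prod (volume : Measure (Torus d))))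
    (hFn : nrm a volume (fun t => eLpNorm (F t) (pe b) volume) < ∞)
    (hGn : nrm (1 - a) volume (fun t => eLpNorm (G t) (pe (1 - b)) volume) < ∞) :
    Tendsto (fun σ : ℝ => ∫⁻ s, ∫⁻ x, ‖F (s + σ) x - F s x‖ₑ * ‖G s x‖ₑ) (𝓝 0) (𝓝 0) := by
  set NF := nrm a volume (fun t => eLpNorm (F t) (pe b) volume) with hNF
  rw [ENNReal.tendsto_nhds_zero]
  intro ε hε
  have hε2 : 0 < ε / 2 := ENNReal.div_pos hε.ne' (by norm_num)
  have htail := tendsto_nrm_tail (sub_pos.2 ha1) (sub_pos.2 hb1) hG hGn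
  have ht2 := ENNReal.Tendsto.const_mul (a := NF + NF) htail
    (Or.inr (ENNReal.add_lt_top.2 ⟨hFn, hFn⟩).ne)
  rw [mul_zero] at ht2
  obtain ⟨M, hM⟩ := ((ENNReal.tendsto_nhds_zero.1 ht2) (ε / 2) hε2).exists
  have hL1 := ENNReal.Tendsto.const_mul (a := (M : ℝ≥0∞)) (tendsto_translation_L1 hF1)
    (Or.inr (ENNReal.natCast_ne_top M))
  rw [mul_zero] at hL1
  filter_upwards [(ENNReal.tendsto_nhds_zero.1 hL1) (ε / 2) hε2] with σ hσ
  set H : ℝ → Torus d → ℝ := fun t x => if (M : ℝ) < |G t x| then G t x else 0 with hH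
  have hHm : Measurable (fun z : ℝ × Torus d => H z.1 z.2) :=
    Measurable.ite (measurableSet_lt measurable_const hG.measurable.abs) hG.measurable
      measurable_const
  have hFσ : Measurable (fun z : ℝ × Torus d => F (z.1 + σ) z.2) :=
    hF.measurable.comp (measurePreserving_shift σ).measurable
  have hFm := hF.measurable
  have hFs : nrm a volume (fun t => eLpNorm (F (t + σ)) (pe b) volume) = NF := by
    rw [hNF, nrm, nrm, lintegral_add_right_eq_self
      (fun t => eLpNorm (F t) (pe b) volume ^ a⁻¹) σ]
  have hpt : ∀ s x, ‖F (s + σ) x - F s x‖ₑ * ‖G s x‖ₑ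
      ≤ (‖F (s + σ) x‖ₑ * ‖H s x‖ₑ + ‖F s x‖ₑ * ‖H s x‖ₑ)
        + M * ‖F (s + σ) x - F s x‖ₑ := by
    intro s x
    by_cases h : (M : ℝ) < |G s x|
    · refine le_add_right ?_
      simp only [hH, h, if_true, ← add_mul]
      gcongr
      exact enorm_sub_le
    · refine le_add_left ?_
      rw [mul_comm]
      gcongr
      rw [← ofReal_norm, Real.norm_eq_abs, ← ENNReal.ofReal_natCast]
      exact ENNReal.ofReal_le_ofReal (not_lt.1 h)
  have m1 : Measurable fun z : ℝ × Torus d => ‖F (z.1 + σ) z.2‖ₑ * ‖H z.1 z.2‖ₑ :=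
    hFσ.enorm.mul hHm.enorm
  have m2 : Measurable fun z : ℝ × Torus d => ‖F z.1 z.2‖ₑ * ‖H z.1 z.2‖ₑ :=
    hFm.enorm.mul hHm.enorm
  have m3 : Measurable fun z : ℝ × Torus d => ‖F (z.1 + σ) z.2 - F z.1 z.2‖ₑ :=
    (hFσ.sub hFm).enorm
  calc ∫⁻ s, ∫⁻ x, ‖F (s + σ) x - F s x‖ₑ * ‖G s x‖ₑ
      ≤ ∫⁻ s, ∫⁻ x, ((‖F (s + σ) x‖ₑ * ‖H s x‖ₑ + ‖F s x‖ₑ * ‖H s x‖ₑ)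
        + M * ‖F (s + σ) x - F s x‖ₑ) :=
        lintegral_mono fun s => lintegral_mono fun x => hpt s x
    _ = (∫⁻ s, ∫⁻ x, ‖F (s + σ) x‖ₑ * ‖H s x‖ₑ) + (∫⁻ s, ∫⁻ x, ‖F s x‖ₑ * ‖H s x‖ₑ)
        + M * ∫⁻ s, ∫⁻ x, ‖F (s + σ) x - F s x‖ₑ := by
        have e : ∀ s, ∫⁻ x, ((‖F (s + σ) x‖ₑ * ‖H s x‖ₑ + ‖F s x‖ₑ * ‖H s x‖ₑ)
            + M * ‖F (s + σ) x - F s x‖ₑ)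
            = (∫⁻ x, ‖F (s + σ) x‖ₑ * ‖H s x‖ₑ) + (∫⁻ x, ‖F s x‖ₑ * ‖H s x‖ₑ)
              + M * ∫⁻ x, ‖F (s + σ) x - F s x‖ₑ := by
          intro s
          have m1' : Measurable fun x => ‖F (s + σ) x‖ₑ * ‖H s x‖ₑ := m1.comp measurable_prodMk_left
          have m2' : Measurable fun x => ‖F s x‖ₑ * ‖H s x‖ₑ := m2.comp measurable_prodMk_left
          have m3' : Measurable fun x => ‖F (s + σ) x - F s x‖ₑ := m3.comp measurable_prodMk_left
          rw [lintegral_add_left (m1'.fun_add m2'), lintegral_add_left m1', lintegral_const_mul _ m3']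
        simp_rw [e]
        rw [lintegral_add_left (m1.lintegral_prod_right'.fun_add m2.lintegral_prod_right'),
          lintegral_add_left m1.lintegral_prod_right',
          lintegral_const_mul _ m3.lintegral_prod_right']
    _ ≤ ε / 2 + ε / 2 := by
        refine add_le_add ?_ ?_
        · refine le_trans ?_ hM
          rw [add_mul]
          refine add_le_add ?_ ?_
          · rw [← hFs]
            exact lintegral_mul_le_nrm (f := fun s x => F (s + σ) x) (g := H) ha ha1 hb hb1
              hFσ.aestronglyMeasurable hHm.aestronglyMeasurable
          · exact lintegral_mul_le_nrm (f := F) (g := H) ha ha1 hb hb1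
              hFm.aestronglyMeasurable hHm.aestronglyMeasurable
        · refine le_trans (le_of_eq ?_) hσ
          rw [lintegral_prod _ m3.aemeasurable]
    _ = ε := ENNReal.add_halves ε

/-! ### Oscillation in time -/

/-- The oscillation of `F` over times within `h` of `s`, tested with `G` at time `s`. -/
def timeOsc (T : ℝ) (F G : ℝ → Torus d → ℝ) (h s : ℝ) : ℝ≥0∞ :=
  ∫⁻ τ in Ioo 0 T ∩ Icc (s - h) (s + h), ∫⁻ x, ‖F τ x - F s x‖ₑ * ‖G s x‖ₑ

lemma timeOsc_congr {F G F' G' : ℝ → Torus d → ℝ}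
    (hF : ∀ᵐ t ∂(volume.restrict (Ioo 0 T)), F t =ᵐ[volume] F' t)
    (hG : ∀ᵐ t ∂(volume.restrict (Ioo 0 T)), G t =ᵐ[volume] G' t) :
    ∀ᵐ s ∂(volume.restrict (Ioo 0 T)), ∀ h, timeOsc T F G h s = timeOsc T F' G' h s := by
  filter_upwards [hF, hG] with s hFs hGs h
  refine lintegral_congr_ae ?_
  filter_upwards [ae_restrict_of_ae_restrict_of_subset inter_subset_left hF] with τ hFτ
  refine lintegral_congr_ae ?_
  filter_upwards [hFs, hGs, hFτ] with x h1 h2 h3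
  rw [h1, h2, h3]

/-- A strongly measurable representative, vanishing outside `(0,T)`. -/
lemma exists_stronglyMeasurable_rep {F : ℝ → Torus d → ℝ}
    (hF : AEStronglyMeasurable (fun z : ℝ × Torus d => F z.1 z.2) (spaceTime d T)) :
    ∃ F' : ℝ → Torus d → ℝ, StronglyMeasurable (fun z : ℝ × Torus d => F' z.1 z.2) ∧
      (∀ t ∉ Ioo 0 T, F' t = 0) ∧
      ∀ᵐ t ∂(volume.restrict (Ioo 0 T)), F t =ᵐ[volume] F' t := by
  classical
  obtain ⟨f, hf, hfF⟩ := hF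
  refine ⟨fun t x => if t ∈ Ioo 0 T then f (t, x) else 0, ?_, ?_, ?_⟩
  · exact StronglyMeasurable.ite (measurableSet_Ioo.preimage measurable_fst) hf
      stronglyMeasurable_const
  · intro t ht; ext x; simp only [if_neg ht, Pi.zero_apply]
  · filter_upwards [Measure.ae_ae_of_ae_prod hfF, ae_restrict_mem measurableSet_Ioo] with t h1 h2
    filter_upwards [h1] with x h3
    simp only [if_pos h2, h3]

lemma nrm_rep {a b : ℝ} (ha : 0 < a) {F F' : ℝ → Torus d → ℝ}
    (h0 : ∀ t ∉ Ioo 0 T, F' t = 0)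
    (h : ∀ᵐ t ∂(volume.restrict (Ioo 0 T)), F t =ᵐ[volume] F' t) :
    nrm a volume (fun t => eLpNorm (F' t) (pe b) volume)
      = nrm a (volume.restrict (Ioo 0 T)) (fun t => eLpNorm (F t) (pe b) volume) := by
  rw [nrm, nrm]
  congr 1
  rw [lintegral_congr_ae (h.mono fun t ht => by rw [eLpNorm_congr_ae ht]),
    setLIntegral_eq_of_support_subset]
  intro t ht
  by_contra hc
  simp [h0 t hc, ha] at ht

/-- The time oscillation of `F` over an interval of length `h` is `o(h)` on average, when `F` and
`G` lie in conjugate mixed Lebesgue spaces. -/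
lemma tendsto_timeOsc {a b : ℝ} (ha : 0 < a) (ha1 : a < 1) (hb : 0 < b) (hb1 : b < 1)
    {F G : ℝ → Torus d → ℝ} (hF : Mix T a b F) (hG : Mix T (1 - a) (1 - b) G) :
    Tendsto (fun h : ℝ => (ENNReal.ofReal h)⁻¹ * ∫⁻ s in Ioo 0 T, timeOsc T F G h s)
      (𝓝[>] 0) (𝓝 0) := by
  obtain ⟨F', hF'm, hF'0, hFF'⟩ := exists_stronglyMeasurable_rep hF.meas
  obtain ⟨G', hG'm, hG'0, hGG'⟩ := exists_stronglyMeasurable_rep hG.meas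
  have hFn : nrm a volume (fun t => eLpNorm (F' t) (pe b) volume) < ∞ := by
    rw [nrm_rep ha hF'0 hFF']; exact hF.lt_top
  have hGn : nrm (1 - a) volume (fun t => eLpNorm (G' t) (pe (1 - b)) volume) < ∞ := by
    rw [nrm_rep (sub_pos.2 ha1) hG'0 hGG']; exact hG.lt_top
  have hF1 : Integrable (fun z : ℝ × Torus d => F' z.1 z.2)
      ((volume : Measure ℝ).prod (volume : Measure (Torus d))) := by
    refine ⟨hF'm.aestronglyMeasurable, ?_⟩
    have h1 := (hF.mono ha hb ha1.le hb1.le).lt_top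
    rw [← nrm_rep one_pos hF'0 hFF', nrm_one] at h1
    simp_rw [pe_one, eLpNorm_one_eq_lintegral_enorm] at h1
    rwa [HasFiniteIntegral, lintegral_prod _ hF'm.measurable.enorm.aemeasurable]
  have hω := tendsto_translation_pairing ha ha1 hb hb1 hF'm hG'm hF1 hFn hGn
  set ω : ℝ → ℝ≥0∞ := fun σ => ∫⁻ s, ∫⁻ x, ‖F' (s + σ) x - F' s x‖ₑ * ‖G' s x‖ₑ with hωd
  have hbd : ∀ h : ℝ, ∫⁻ s in Ioo 0 T, timeOsc T F G h s ≤ ∫⁻ σ in Icc (-h) h, ω σ := by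
    intro h
    calc ∫⁻ s in Ioo 0 T, timeOsc T F G h s
        = ∫⁻ s in Ioo 0 T, timeOsc T F' G' h s :=
          lintegral_congr_ae ((timeOsc_congr hFF' hGG').mono fun s hs => hs h)
      _ ≤ ∫⁻ s, ∫⁻ τ in Icc (s - h) (s + h), ∫⁻ x, ‖F' τ x - F' s x‖ₑ * ‖G' s x‖ₑ := by
          refine (setLIntegral_le_lintegral _ _).trans (lintegral_mono fun s => ?_)
          exact lintegral_mono_set inter_subset_right
      _ = ∫⁻ s, ∫⁻ σ in Icc (-h) h, ∫⁻ x, ‖F' (s + σ) x - F' s x‖ₑ * ‖G' s x‖ₑ := by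
          refine lintegral_congr fun s => ?_
          rw [← lintegral_indicator measurableSet_Icc, ← lintegral_indicator measurableSet_Icc,
            ← lintegral_add_left_eq_self _ s]
          refine lintegral_congr fun σ => ?_
          have : s + σ ∈ Icc (s - h) (s + h) ↔ σ ∈ Icc (-h) h := by
            simp only [mem_Icc]; constructor <;> rintro ⟨h1, h2⟩ <;> constructor <;> linarith
          by_cases hσ : σ ∈ Icc (-h) h
          · rw [indicator_of_mem hσ, indicator_of_mem (this.2 hσ)]
          · rw [indicator_of_notMem hσ, indicator_of_notMem (fun h => hσ (this.1 h))]
      _ = ∫⁻ σ in Icc (-h) h, ω σ := by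
          refine lintegral_lintegral_swap ?_
          have hFm := hF'm.measurable
          have hGm := hG'm.measurable
          have m : Measurable fun z : (ℝ × ℝ) × Torus d =>
              ‖F' (z.1.1 + z.1.2) z.2 - F' z.1.1 z.2‖ₑ * ‖G' z.1.1 z.2‖ₑ := by
            have e1 : Measurable fun z : (ℝ × ℝ) × Torus d => F' (z.1.1 + z.1.2) z.2 :=
              hFm.comp (g := fun z : ℝ × Torus d => F' z.1 z.2)
                (f := fun z : (ℝ × ℝ) × Torus d => (z.1.1 + z.1.2, z.2)) (by fun_prop)
            have e2 : Measurable fun z : (ℝ × ℝ) × Torus d => F' z.1.1 z.2 :=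
              hFm.comp (g := fun z : ℝ × Torus d => F' z.1 z.2)
                (f := fun z : (ℝ × ℝ) × Torus d => (z.1.1, z.2)) (by fun_prop)
            have e3 : Measurable fun z : (ℝ × ℝ) × Torus d => G' z.1.1 z.2 :=
              hGm.comp (g := fun z : ℝ × Torus d => G' z.1 z.2)
                (f := fun z : (ℝ × ℝ) × Torus d => (z.1.1, z.2)) (by fun_prop)
            exact (e1.sub e2).enorm.mul e3.enorm
          exact m.lintegral_prod_right'.aemeasurable
  rw [ENNReal.tendsto_nhds_zero]
  intro ε hε
  have hε2 : 0 < ε / 2 := ENNReal.div_pos hε.ne' (by norm_num)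
  obtain ⟨δ, hδ, hδω⟩ := Metric.eventually_nhds_iff.1 ((ENNReal.tendsto_nhds_zero.1 hω) (ε / 2) hε2)
  filter_upwards [Ioo_mem_nhdsGT hδ] with h hh
  have hh0 : 0 < h := hh.1
  have h1 : ∫⁻ σ in Icc (-h) h, ω σ ≤ ENNReal.ofReal h * ε := by
    calc ∫⁻ σ in Icc (-h) h, ω σ ≤ ∫⁻ σ in Icc (-h) h, ε / 2 := by
          refine setLIntegral_mono measurable_const fun σ hσ => hδω ?_
          rw [Real.dist_0_eq_abs]
          exact (abs_le.2 hσ).trans_lt hh.2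
      _ = ENNReal.ofReal h * ε := by
          rw [setLIntegral_const, Real.volume_Icc, show h - -h = h + h by ring,
            ENNReal.ofReal_add hh0.le hh0.le, ← mul_two, mul_comm (ε / 2), mul_assoc,
            ENNReal.mul_div_cancel (by norm_num) (by norm_num)]
  have hne : ENNReal.ofReal h ≠ 0 := by simpa using hh0
  calc (ENNReal.ofReal h)⁻¹ * ∫⁻ s in Ioo 0 T, timeOsc T F G h s
      ≤ (ENNReal.ofReal h)⁻¹ * (ENNReal.ofReal h * ε) := by
        gcongr; exact (hbd h).trans h1
    _ = ε := by rw [← mul_assoc, ENNReal.inv_mul_cancel hne ENNReal.ofReal_ne_top, one_mul]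

/-! ### A criterion for absolute continuity in time -/

lemma ofReal_integral_le_lintegral {α : Type*} [MeasurableSpace α] {ν : Measure α} {f : α → ℝ}
    (hf : Integrable f ν) : ENNReal.ofReal (∫ x, f x ∂ν) ≤ ∫⁻ x, ENNReal.ofReal (f x) ∂ν := by
  rw [integral_eq_lintegral_pos_part_sub_lintegral_neg_part hf]
  refine (ENNReal.ofReal_le_ofReal (sub_le_self _ ENNReal.toReal_nonneg)).trans ?_
  exact ENNReal.ofReal_toReal_le

lemma intervalIntegrable_of_Ioo {f : ℝ → ℝ} (hf : IntegrableOn f (Ioo 0 T)) {a b : ℝ}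
    (ha : a ∈ Icc 0 T) (hb : b ∈ Icc 0 T) : IntervalIntegrable f volume a b := by
  rw [intervalIntegrable_iff']
  have h1 : IntegrableOn f (Icc 0 T) := by rwa [integrableOn_Icc_iff_integrableOn_Ioo]
  exact h1.mono_set (uIcc_subset_Icc ha hb)

lemma continuousOn_primitive_Ioo {f : ℝ → ℝ} (hT : 0 ≤ T) (hf : IntegrableOn f (Ioo 0 T)) :
    ContinuousOn (fun t => ∫ s in (0 : ℝ)..t, f s) (Icc 0 T) := by
  have h := intervalIntegral.continuousOn_primitive_interval (μ := volume) (f := f) (a := 0) (b := T)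
    (by rwa [uIcc_of_le hT, integrableOn_Icc_iff_integrableOn_Ioo])
  rwa [uIcc_of_le hT] at h

lemma tendsto_right_average {e : ℝ → ℝ} {a : ℝ} {I : ℝ → ℝ} (h : HasDerivAt I (e a) a) :
    Tendsto (fun h : ℝ => h⁻¹ * (I (a + h) - I a)) (𝓝[>] 0) (𝓝 (e a)) := by
  have := h.tendsto_slope_zero_right
  simpa using! this

lemma tendsto_left_average {e : ℝ → ℝ} {a : ℝ} {I : ℝ → ℝ} (h : HasDerivAt I (e a) a) :
    Tendsto (fun h : ℝ => h⁻¹ * (I a - I (a - h))) (𝓝[>] 0) (𝓝 (e a)) := by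
  have h1 := h.tendsto_slope_zero_left
  have h2 : Tendsto (fun h : ℝ => -h) (𝓝[>] 0) (𝓝[<] 0) := by
    have := tendsto_neg_nhdsGT (a := (0 : ℝ))
    simpa using this
  refine (h1.comp h2).congr fun h => ?_
  simp only [Function.comp, smul_eq_mul, inv_neg, sub_eq_add_neg]
  ring

/-- The increment of `e` between two Lebesgue points is bounded below by the integral of `B`, if
`e` lies above its affine approximations of slope `B` up to an error that is `o(h)` on average. -/
lemma increment_of_subgradient {e B : ℝ → ℝ} (hT : 0 < T)
    (he : IntegrableOn e (Ioo 0 T)) (hB : IntegrableOn B (Ioo 0 T)) {β : ℝ → ℝ → ℝ≥0∞}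
    (hβ : Tendsto (fun h : ℝ => (ENNReal.ofReal h)⁻¹ * ∫⁻ s in Ioo 0 T, β h s) (𝓝[>] 0) (𝓝 0))
    (key : ∀ᵐ s ∂(volume.restrict (Ioo 0 T)), ∀ h, 0 < h → ∀ t ∈ Icc 0 T, |t - s| ≤ h →
      ENNReal.ofReal (e s + (t - s) * B s - e t) ≤ β h s)
    {a b : ℝ} (ha : a ∈ Ioo 0 T) (hb : b ∈ Ioo 0 T) (hab : a ≤ b)
    (hea : HasDerivAt (fun t => ∫ s in (0 : ℝ)..t, e s) (e a) a)
    (heb : HasDerivAt (fun t => ∫ s in (0 : ℝ)..t, e s) (e b) b) :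
    e b - e a = ∫ s in a..b, B s := by
  have h0 : (0 : ℝ) ∈ Icc 0 T := ⟨le_rfl, hT.le⟩
  have hIe : ∀ x ∈ Icc 0 T, ∀ y ∈ Icc 0 T, ∫ s in x..y, e s
      = (∫ s in (0 : ℝ)..y, e s) - ∫ s in (0 : ℝ)..x, e s := fun x hx y hy =>
    (intervalIntegral.integral_interval_sub_left (intervalIntegrable_of_Ioo he h0 hy)
      (intervalIntegrable_of_Ioo he h0 hx)).symm
  -- the bound for the translates by `ε h`, with `ε = 1` or `ε = -1`
  have main : ∀ ε : ℝ, |ε| = 1 → ∀ᶠ h in 𝓝[>] (0 : ℝ),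
      ENNReal.ofReal (h⁻¹ * ((∫ s in a..b, e s) - ∫ s in (a + ε * h)..(b + ε * h), e s)
        + ε * ∫ s in a..b, B s) ≤ (ENNReal.ofReal h)⁻¹ * ∫⁻ s in Ioo 0 T, β h s := by
    intro ε hε
    have hm : 0 < min (min a (T - a)) (min b (T - b)) := by
      simp only [lt_min_iff, sub_pos]; exact ⟨⟨ha.1, ha.2⟩, hb.1, hb.2⟩
    filter_upwards [Ioo_mem_nhdsGT hm] with h hh
    have hh0 : 0 < h := hh.1
    have hh1 := hh.2
    simp only [lt_min_iff] at hh1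
    obtain ⟨hε1, hε2⟩ := abs_le.1 hε.le
    have hεh1 : -h ≤ ε * h := by nlinarith
    have hεh2 : ε * h ≤ h := by nlinarith
    have hah : a + ε * h ∈ Icc 0 T := ⟨by linarith, by linarith⟩
    have hbh : b + ε * h ∈ Icc 0 T := ⟨by linarith, by linarith⟩
    have haI : a ∈ Icc 0 T := ⟨ha.1.le, ha.2.le⟩
    have hbI : b ∈ Icc 0 T := ⟨hb.1.le, hb.2.le⟩
    have i1 : IntegrableOn e (Ioc a b) :=
      (intervalIntegrable_iff_integrableOn_Ioc_of_le hab).1 (intervalIntegrable_of_Ioo he haI hbI)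
    have i2 : IntegrableOn B (Ioc a b) :=
      (intervalIntegrable_iff_integrableOn_Ioc_of_le hab).1 (intervalIntegrable_of_Ioo hB haI hbI)
    have i3 : IntegrableOn (fun s => e (s + ε * h)) (Ioc a b) := by
      rw [← intervalIntegrable_iff_integrableOn_Ioc_of_le hab]
      have := (intervalIntegrable_of_Ioo he hah hbh).comp_add_right (ε * h)
      simpa using this
    have e1 : ∫ s in Ioc a b, (e s + ε * h * B s - e (s + ε * h))
        = (∫ s in a..b, e s) - (∫ s in (a + ε * h)..(b + ε * h), e s)
          + ε * h * ∫ s in a..b, B s := by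
      have i12 : IntegrableOn (fun s => e s + ε * h * B s) (Ioc a b) := i1.add (i2.const_mul _)
      rw [integral_sub i12 i3, integral_add i1 (i2.const_mul _),
        integral_const_mul, ← intervalIntegral.integral_of_le hab,
        ← intervalIntegral.integral_of_le hab, ← intervalIntegral.integral_of_le hab,
        intervalIntegral.integral_comp_add_right]
      ring
    have e2 := ofReal_integral_le_lintegral ((i1.add (i2.const_mul (ε * h))).sub i3)
    have hsub : Ioc a b ⊆ Ioo 0 T := fun s hs => ⟨ha.1.trans hs.1, hs.2.trans_lt hb.2⟩
    have e3 : ∫⁻ s in Ioc a b, ENNReal.ofReal (e s + ε * h * B s - e (s + ε * h))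
        ≤ ∫⁻ s in Ioo 0 T, β h s := by
      refine le_trans (lintegral_mono_ae ?_) (lintegral_mono_set hsub)
      filter_upwards [ae_restrict_of_ae_restrict_of_subset hsub key,
        ae_restrict_mem measurableSet_Ioc] with s hs hsI
      have := hs h hh0 (s + ε * h) ⟨by linarith [hsI.1], by linarith [hsI.2]⟩
        (by rw [add_sub_cancel_left, abs_mul, hε, one_mul, abs_of_pos hh0])
      rwa [add_sub_cancel_left] at this
    have e4 : h⁻¹ * ((∫ s in a..b, e s) - ∫ s in (a + ε * h)..(b + ε * h), e s)
        + ε * ∫ s in a..b, B s = h⁻¹ * ∫ s in Ioc a b, (e s + ε * h * B s - e (s + ε * h)) := by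
      rw [e1]; field_simp
    rw [e4, ENNReal.ofReal_mul (inv_nonneg.2 hh0.le), ENNReal.ofReal_inv_of_pos hh0]
    gcongr
    exact e2.trans e3
  have mem_ev : ∀ᶠ h in 𝓝[>] (0 : ℝ), a + h ∈ Icc 0 T ∧ b + h ∈ Icc 0 T ∧ a - h ∈ Icc 0 T
      ∧ b - h ∈ Icc 0 T := by
    have hm : 0 < min (min a (T - a)) (min b (T - b)) := by
      simp only [lt_min_iff, sub_pos]; exact ⟨⟨ha.1, ha.2⟩, hb.1, hb.2⟩
    filter_upwards [Ioo_mem_nhdsGT hm] with h hh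
    have hh0 : 0 < h := hh.1
    have hh1 := hh.2
    simp only [lt_min_iff] at hh1
    have := ha.1; have := ha.2; have := hb.1; have := hb.2
    refine ⟨⟨?_, ?_⟩, ⟨?_, ?_⟩, ⟨?_, ?_⟩, ⟨?_, ?_⟩⟩ <;> linarith
  have haI : a ∈ Icc 0 T := ⟨ha.1.le, ha.2.le⟩
  have hbI : b ∈ Icc 0 T := ⟨hb.1.le, hb.2.le⟩
  refine le_antisymm ?_ ?_
  · -- backward translates
    have t1 := (tendsto_left_average heb).sub (tendsto_left_average hea)
    have t2 := ENNReal.tendsto_ofReal (t1.add_const (-1 * ∫ s in a..b, B s))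
    have t3 := le_of_tendsto_of_tendsto t2 hβ (by
      filter_upwards [main (-1) (by simp), mem_ev] with h h1 ⟨m1, m2, m3, m4⟩
      refine le_trans (le_of_eq ?_) h1
      rw [show a + -1 * h = a - h by ring, show b + -1 * h = b - h by ring, hIe _ haI _ hbI,
        hIe _ m3 _ m4]
      congr 1; ring)
    have t4 := ENNReal.ofReal_eq_zero.1 (le_antisymm t3 zero_le)
    linarith
  · have t1 := (tendsto_right_average hea).sub (tendsto_right_average heb)
    have t2 := ENNReal.tendsto_ofReal (t1.add_const (1 * ∫ s in a..b, B s))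
    have t3 := le_of_tendsto_of_tendsto t2 hβ (by
      filter_upwards [main 1 (by simp), mem_ev] with h h1 ⟨m1, m2, m3, m4⟩
      refine le_trans (le_of_eq ?_) h1
      rw [one_mul h, hIe _ haI _ hbI, hIe _ m1 _ m2]
      congr 1; ring)
    have t4 := ENNReal.ofReal_eq_zero.1 (le_antisymm t3 zero_le)
    linarith

/-- If `e` lies above its affine approximations of slope `B` at almost every time, up to an error
that is `o(h)` on average, and if `e` is lower semicontinuous along almost all times, then `e` is
the primitive of `B`, at every time. -/
theorem eq_primitive_of_subgradient {e B : ℝ → ℝ} (hT : 0 < T)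
    (he : IntegrableOn e (Ioo 0 T)) (hB : IntegrableOn B (Ioo 0 T)) {β : ℝ → ℝ → ℝ≥0∞}
    (hβ : Tendsto (fun h : ℝ => (ENNReal.ofReal h)⁻¹ * ∫⁻ s in Ioo 0 T, β h s) (𝓝[>] 0) (𝓝 0))
    (key : ∀ᵐ s ∂(volume.restrict (Ioo 0 T)), ∀ h, 0 < h → ∀ t ∈ Icc 0 T, |t - s| ≤ h →
      ENNReal.ofReal (e s + (t - s) * B s - e t) ≤ β h s)
    (lsc : ∀ t ∈ Icc 0 T, ∀ c, (∀ᶠ s in ae (volume.restrict (Ioo 0 T)) ⊓ 𝓝 t, e s ≤ c) → e t ≤ c) :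
    ∀ t ∈ Icc 0 T, e t = e 0 + ∫ s in (0 : ℝ)..t, B s := by
  have h0 : (0 : ℝ) ∈ Icc 0 T := ⟨le_rfl, hT.le⟩
  have hTI : T ∈ Icc 0 T := ⟨hT.le, le_rfl⟩
  have hleb : ∀ᵐ s ∂(volume.restrict (Ioo 0 T)), s ∈ Ioo 0 T ∧
      HasDerivAt (fun t => ∫ s in (0 : ℝ)..t, e s) (e s) s := by
    have h1 := (intervalIntegrable_of_Ioo he h0 hTI).ae_hasDerivAt_integral
    filter_upwards [ae_restrict_of_ae h1, ae_restrict_mem measurableSet_Ioo] with s hs hsI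
    refine ⟨hsI, hs ?_ 0 (by simp)⟩
    rw [uIcc_of_le hT.le]; exact ⟨hsI.1.le, hsI.2.le⟩
  have hne : (ae (volume.restrict (Ioo 0 T))).NeBot := by
    rw [ae_neBot, Ne, Measure.restrict_eq_zero, Real.volume_Ioo]
    simpa using hT
  obtain ⟨a, haI, ha⟩ := hleb.exists
  set c := e a - ∫ s in (0 : ℝ)..a, B s with hc
  set P : ℝ → ℝ := fun t => ∫ s in (0 : ℝ)..t, B s with hP
  have hPc : ContinuousOn P (Icc 0 T) := continuousOn_primitive_Ioo hT.le hB
  have hae : ∀ᵐ s ∂(volume.restrict (Ioo 0 T)), e s = c + P s := by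
    filter_upwards [hleb] with b hb
    have hI : ∀ x ∈ Ioo 0 T, ∀ y ∈ Ioo 0 T, ∫ s in x..y, B s = P y - P x := fun x hx y hy =>
      (intervalIntegral.integral_interval_sub_left
        (intervalIntegrable_of_Ioo hB h0 ⟨hy.1.le, hy.2.le⟩)
        (intervalIntegrable_of_Ioo hB h0 ⟨hx.1.le, hx.2.le⟩)).symm
    rcases le_total a b with hab | hab
    · have := increment_of_subgradient hT he hB hβ key haI hb.1 hab ha hb.2
      rw [hI _ haI _ hb.1] at this
      simp only [hc]; linarith
    · have := increment_of_subgradient hT he hB hβ key hb.1 haI hab hb.2 ha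
      rw [hI _ hb.1 _ haI] at this
      simp only [hc]; linarith
  have hev : ∀ t ∈ Icc 0 T, ∀ ε > 0, ∀ᶠ s in 𝓝 t, s ∈ Ioo 0 T → |P s - P t| < ε := by
    intro t ht ε hε
    have := (Metric.tendsto_nhdsWithin_nhds.1 (hPc t ht)) ε hε
    obtain ⟨δ, hδ, h⟩ := this
    filter_upwards [Metric.ball_mem_nhds t hδ] with s hs hsI
    exact h ⟨hsI.1.le, hsI.2.le⟩ hs
  have hall : ∀ t ∈ Icc 0 T, e t = c + P t := by
    intro t ht
    refine le_antisymm ?_ ?_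
    · refine le_of_forall_pos_le_add fun ε hε => lsc t ht _ ?_
      have h1 : ∀ᶠ s in ae (volume.restrict (Ioo 0 T)) ⊓ 𝓝 t, e s = c + P s ∧ s ∈ Ioo 0 T :=
        mem_inf_of_left (hae.and (ae_restrict_mem measurableSet_Ioo))
      have h2 : ∀ᶠ s in ae (volume.restrict (Ioo 0 T)) ⊓ 𝓝 t, s ∈ Ioo 0 T → |P s - P t| < ε :=
        mem_inf_of_right (hev t ht ε hε)
      filter_upwards [h1, h2] with s h1 h2
      have := (abs_lt.1 (h2 h1.2)).2
      rw [h1.1]; linarith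
    · -- average the affine lower bounds over the times close to `t`
      by_contra hlt
      push Not at hlt
      set η := (c + P t - e t) / 2 with hη
      have hη0 : 0 < η := by rw [hη]; linarith
      set J : ℝ → Set ℝ := fun h => Ioo 0 T ∩ Ioo (t - h) (t + h) with hJ
      obtain ⟨δ, hδ, hδP⟩ := Metric.eventually_nhds_iff.1 (hev t ht η hη0)
      have hJm : ∀ h, MeasurableSet (J h) := fun h => measurableSet_Ioo.inter measurableSet_Ioo
      have t1 : Tendsto (fun h => ∫⁻ s in J h, ‖B s‖ₑ ∂(volume.restrict (Ioo 0 T))) (𝓝[>] 0)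
          (𝓝 0) := by
        refine tendsto_setLIntegral_zero hB.2.ne ?_
        have t3 : Tendsto (fun h : ℝ => ENNReal.ofReal (h + h)) (𝓝[>] 0) (𝓝 0) := by
          have : Tendsto (fun h : ℝ => h + h) (𝓝[>] 0) (𝓝 0) := by
            have : Continuous fun h : ℝ => h + h := by fun_prop
            simpa using (this.tendsto 0).mono_left nhdsWithin_le_nhds
          simpa using ENNReal.tendsto_ofReal this
        refine tendsto_of_tendsto_of_tendsto_of_le_of_le tendsto_const_nhds t3
          (fun _ => zero_le) fun h => ?_
        simp only [Function.comp]
        refine (Measure.restrict_apply_le _ _).trans ((measure_mono inter_subset_right).trans ?_)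
        rw [Real.volume_Ioo]
        exact ENNReal.ofReal_le_ofReal (by linarith)
      have t2 := hβ.add t1
      rw [add_zero] at t2
      have t3 : ∀ᶠ h in 𝓝[>] (0 : ℝ), ENNReal.ofReal η
          ≤ (ENNReal.ofReal h)⁻¹ * (∫⁻ s in Ioo 0 T, β h s)
            + ∫⁻ s in J h, ‖B s‖ₑ ∂(volume.restrict (Ioo 0 T)) := by
        filter_upwards [Ioo_mem_nhdsGT (lt_min hδ hT)] with h hh
        have hh0 : 0 < h := hh.1
        have hh1 := lt_min_iff.1 hh.2
        have hvol : ENNReal.ofReal h ≤ volume (J h) := by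
          rw [hJ]
          simp only [Ioo_inter_Ioo, Real.volume_Ioo]
          refine ENNReal.ofReal_le_ofReal ?_
          have := ht.1; have := ht.2
          rcases max_cases 0 (t - h) with h1 | h1 <;> rcases min_cases T (t + h) with h2 | h2 <;>
            linarith
        have hpt : ∀ᵐ s ∂(volume.restrict (J h)), ENNReal.ofReal η
            ≤ β h s + ENNReal.ofReal h * ‖B s‖ₑ := by
          filter_upwards [ae_restrict_of_ae_restrict_of_subset inter_subset_left key,
            ae_restrict_of_ae_restrict_of_subset inter_subset_left hae,
            ae_restrict_mem (hJm h)] with s hs hes hsJ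
          have hts : |t - s| ≤ h := by
            rw [abs_le]; constructor <;> linarith [hsJ.2.1, hsJ.2.2]
          have h1 := hs h hh0 t ht hts
          have h2 := hδP (y := s) (by
            rw [Real.dist_eq, abs_sub_comm]; exact hts.trans_lt hh1.1) hsJ.1
          have h3 := (abs_lt.1 h2).1
          have h4 : -(h * |B s|) ≤ (t - s) * B s := by
            have := neg_abs_le ((t - s) * B s)
            rw [abs_mul] at this
            nlinarith [abs_nonneg (B s)]
          have h5 : η ≤ (e s + (t - s) * B s - e t) + h * |B s| := by
            rw [hes]; linarith
          calc ENNReal.ofReal η ≤ ENNReal.ofReal ((e s + (t - s) * B s - e t) + h * |B s|) :=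
                ENNReal.ofReal_le_ofReal h5
            _ ≤ ENNReal.ofReal (e s + (t - s) * B s - e t) + ENNReal.ofReal (h * |B s|) :=
                ENNReal.ofReal_add_le
            _ ≤ β h s + ENNReal.ofReal h * ‖B s‖ₑ := by
                refine add_le_add h1 ?_
                rw [ENNReal.ofReal_mul hh0.le, ← Real.norm_eq_abs, ofReal_norm]
        have hBm : AEMeasurable (fun s => ENNReal.ofReal h * ‖B s‖ₑ) (volume.restrict (J h)) :=
          ((hB.mono_set inter_subset_left).1.enorm).const_mul _
        have h6 : ENNReal.ofReal h * ENNReal.ofReal η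
            ≤ (∫⁻ s in Ioo 0 T, β h s) + ENNReal.ofReal h * ∫⁻ s in J h, ‖B s‖ₑ := by
          calc ENNReal.ofReal h * ENNReal.ofReal η ≤ ∫⁻ s in J h, ENNReal.ofReal η := by
                rw [setLIntegral_const, mul_comm]; gcongr
            _ ≤ ∫⁻ s in J h, (β h s + ENNReal.ofReal h * ‖B s‖ₑ) := lintegral_mono_ae hpt
            _ = (∫⁻ s in J h, β h s) + ENNReal.ofReal h * ∫⁻ s in J h, ‖B s‖ₑ := by
                rw [lintegral_add_right' _ hBm, lintegral_const_mul' _ _ ENNReal.ofReal_ne_top]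
            _ ≤ _ := by gcongr; exact inter_subset_left
        have hne' : ENNReal.ofReal h ≠ 0 := by simpa using hh0
        have h7 : ∫⁻ s in J h, ‖B s‖ₑ ∂(volume.restrict (Ioo 0 T)) = ∫⁻ s in J h, ‖B s‖ₑ := by
          rw [Measure.restrict_restrict (hJm h), inter_eq_left.2 inter_subset_left]
        rw [h7]
        calc ENNReal.ofReal η = (ENNReal.ofReal h)⁻¹ * (ENNReal.ofReal h * ENNReal.ofReal η) := by
              rw [← mul_assoc, ENNReal.inv_mul_cancel hne' ENNReal.ofReal_ne_top, one_mul]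
          _ ≤ (ENNReal.ofReal h)⁻¹ * ((∫⁻ s in Ioo 0 T, β h s)
              + ENNReal.ofReal h * ∫⁻ s in J h, ‖B s‖ₑ) := by gcongr
          _ = _ := by
              rw [mul_add, ← mul_assoc (ENNReal.ofReal h)⁻¹ (ENNReal.ofReal h),
                ENNReal.inv_mul_cancel hne' ENNReal.ofReal_ne_top, one_mul]
      have t4 := le_of_tendsto_of_tendsto tendsto_const_nhds t2 t3
      have t5 := ENNReal.ofReal_eq_zero.1 (le_antisymm t4 zero_le)
      linarith
  intro t ht
  have hP0 : P 0 = 0 := by simp [hP]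
  rw [hall t ht, hall 0 h0, hP0, add_zero]

/-! ### Weak derivatives in time -/

lemma integral_Ioo_eq {f : ℝ → ℝ} (hT : 0 ≤ T) : ∫ t in Ioo 0 T, f t = ∫ t in (0 : ℝ)..T, f t := by
  rw [intervalIntegral.integral_of_le hT, integral_Ioc_eq_integral_Ioo]

/-- Integration by parts for a primitive against a smooth function. -/
lemma integral_primitive_mul_deriv (hT : 0 ≤ T) {g : ℝ → ℝ} (hg : IntegrableOn g (Ioo 0 T))
    {χ : ℝ → ℝ} (hχ : ContDiff ℝ (⊤ : ℕ∞) χ) (c : ℝ) :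
    ∫ t in Ioo 0 T, ((c + ∫ s in (0 : ℝ)..t, g s) * deriv χ t + g t * χ t)
      = (c + ∫ s in (0 : ℝ)..T, g s) * χ T - c * χ 0 := by
  have h0 : (0 : ℝ) ∈ Icc 0 T := ⟨le_rfl, hT⟩
  have hTI : T ∈ Icc 0 T := ⟨hT, le_rfl⟩
  have hgi := intervalIntegrable_of_Ioo hg h0 hTI
  have hF : AbsolutelyContinuousOnInterval (fun t => c + ∫ s in (0 : ℝ)..t, g s) 0 T := by
    have h1 := hgi.absolutelyContinuousOnInterval_intervalIntegral (c := 0) (by simp)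
    have h2 : AbsolutelyContinuousOnInterval (fun _ : ℝ => c) 0 T :=
      (contDiff_const (n := 1)).contDiffOn.absolutelyContinuousOnInterval
    exact h2.add h1
  have hX : AbsolutelyContinuousOnInterval χ 0 T :=
    (hχ.of_le (by exact_mod_cast le_top)).contDiffOn.absolutelyContinuousOnInterval
  have h := AbsolutelyContinuousOnInterval.integral_deriv_mul_eq_sub hF hX
  simp only [intervalIntegral.integral_same, add_zero] at h
  rw [integral_Ioo_eq hT, ← h]
  refine intervalIntegral.integral_congr_ae ?_
  filter_upwards [hgi.ae_hasDerivAt_integral] with t ht htI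
  have h3 := ht (uIoc_subset_uIcc htI) 0 (by simp)
  rw [(h3.const_add c).deriv]
  ring

lemma exists_Icc_of_isCompact {K : Set ℝ} (hT : 0 < T) (hK : IsCompact K) (h : K ⊆ Ioo 0 T) :
    ∃ a b, 0 < a ∧ b < T ∧ K ⊆ Icc a b := by
  rcases K.eq_empty_or_nonempty with rfl | hne
  · exact ⟨T / 2, T / 2, by linarith, by linarith, empty_subset _⟩
  · obtain ⟨a, ha⟩ := hK.exists_isLeast hne
    obtain ⟨b, hb⟩ := hK.exists_isGreatest hne
    exact ⟨a, b, (h ha.1).1, (h hb.1).2, fun x hx => ⟨ha.2 hx, hb.2 hx⟩⟩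

lemma contDiff_primitive {η : ℝ → ℝ} (hη : ContDiff ℝ (⊤ : ℕ∞) η) :
    ContDiff ℝ (⊤ : ℕ∞) (fun t => ∫ s in (0 : ℝ)..t, η s) ∧
      deriv (fun t => ∫ s in (0 : ℝ)..t, η s) = η := by
  have hd : ∀ t, HasDerivAt (fun t => ∫ s in (0 : ℝ)..t, η s) (η t) t := fun t =>
    (hη.continuous.integral_hasStrictDerivAt 0 t).hasDerivAt
  have e : deriv (fun t => ∫ s in (0 : ℝ)..t, η s) = η := funext fun t => (hd t).deriv
  refine ⟨?_, e⟩
  rw [contDiff_infty_iff_deriv]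
  exact ⟨fun t => (hd t).differentiableAt, by rw [e]; exact hη⟩

/-- A function on `(0,T)` with integrable weak derivative `g` is, up to a constant, the primitive
of `g`. -/
lemma ae_eq_primitive_of_weak_deriv (hT : 0 < T) {f g : ℝ → ℝ} (hf : IntegrableOn f (Ioo 0 T))
    (hg : IntegrableOn g (Ioo 0 T))
    (h : ∀ χ : ℝ → ℝ, ContDiff ℝ (⊤ : ℕ∞) χ →
      (∃ a b, 0 < a ∧ b < T ∧ ∀ t, t ∉ Icc a b → χ t = 0) →
      ∫ t in Ioo 0 T, (f t * deriv χ t + g t * χ t) = 0) :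
    ∃ c, ∀ᵐ t ∂(volume.restrict (Ioo 0 T)), f t = c + ∫ s in (0 : ℝ)..t, g s := by
  have hPc := continuousOn_primitive_Ioo hT.le hg
  have hPi : IntegrableOn (fun t => ∫ s in (0 : ℝ)..t, g s) (Ioo 0 T) :=
    (hPc.integrableOn_Icc).mono_set Ioo_subset_Icc_self
  set F : ℝ → ℝ := fun t => f t - ∫ s in (0 : ℝ)..t, g s with hF
  have hFi : IntegrableOn F (Ioo 0 T) := hf.sub hPi
  have hbd : ∀ {φ : ℝ → ℝ}, IntegrableOn φ (Ioo 0 T) → ∀ {χ : ℝ → ℝ}, Continuous χ →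
      IntegrableOn (fun t => φ t * χ t) (Ioo 0 T) := by
    intro φ hφ χ hχ
    obtain ⟨C, hC⟩ := (isCompact_Icc (a := 0) (b := T)).exists_bound_of_continuousOn
      hχ.continuousOn
    refine Integrable.mul_bdd (c := C) hφ hχ.aestronglyMeasurable ?_
    filter_upwards [ae_restrict_mem measurableSet_Ioo] with t ht
    exact hC t ⟨ht.1.le, ht.2.le⟩
  -- `F` has vanishing weak derivative
  have h1 : ∀ χ : ℝ → ℝ, ContDiff ℝ (⊤ : ℕ∞) χ →
      (∃ a b, 0 < a ∧ b < T ∧ ∀ t, t ∉ Icc a b → χ t = 0) →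
      ∫ t in Ioo 0 T, F t * deriv χ t = 0 := by
    intro χ hχ hsupp
    have e1 := h χ hχ hsupp
    have e2 := integral_primitive_mul_deriv hT.le hg hχ 0
    obtain ⟨a, b, ha, hb, hs⟩ := hsupp
    have hχd : Continuous (deriv χ) := hχ.continuous_deriv (by exact_mod_cast le_top)
    rw [hs T (fun hm => by linarith [hm.2]), mul_zero, zero_mul, sub_zero] at e2
    simp only [zero_add] at e2
    rw [integral_add (hbd hf hχd) (hbd hg hχ.continuous)] at e1
    rw [integral_add (hbd hPi hχd) (hbd hg hχ.continuous)] at e2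
    have e3 : ∫ t in Ioo 0 T, F t * deriv χ t = (∫ t in Ioo 0 T, f t * deriv χ t)
        - ∫ t in Ioo 0 T, (∫ s in (0 : ℝ)..t, g s) * deriv χ t := by
      rw [← integral_sub (hbd hf hχd) (hbd hPi hχd)]
      refine integral_congr_ae (ae_of_all _ fun t => ?_)
      simp only [hF]; ring
    linarith
  -- a fixed bump function of integral one
  let φ : ContDiffBump (T / 2) := ⟨T / 8, T / 4, by linarith, by linarith⟩
  set θ₀ : ℝ → ℝ := φ.normed volume with hθ₀
  have hθ₀d : ContDiff ℝ (⊤ : ℕ∞) θ₀ := φ.contDiff_normed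
  have hθ₀1 : ∫ t, θ₀ t = 1 := φ.integral_normed
  have hθ₀s : tsupport θ₀ ⊆ Ioo 0 T := by
    rw [hθ₀, φ.tsupport_normed_eq, Real.closedBall_eq_Icc]
    intro t ht
    have h1 := ht.1
    have h2 := ht.2
    constructor
    · have : T / 2 - T / 4 ≤ t := h1
      linarith
    · have : t ≤ T / 2 + T / 4 := h2
      linarith
  have hθ₀c : HasCompactSupport θ₀ := φ.hasCompactSupport_normed
  refine ⟨∫ t in Ioo 0 T, F t * θ₀ t, ?_⟩
  set c := ∫ t in Ioo 0 T, F t * θ₀ t with hc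
  have hloc : LocallyIntegrableOn (fun t => F t - c) (Ioo 0 T) :=
    (hFi.sub (integrableOn_const (by simp))).locallyIntegrableOn
  have h2 := isOpen_Ioo.ae_eq_zero_of_integral_contDiff_smul_eq_zero hloc ?_
  · rw [ae_restrict_iff' measurableSet_Ioo]
    filter_upwards [h2] with t ht htI
    have := ht htI
    simp only [hF] at this; linarith
  · intro θ hθ hθc hθs
    set m := ∫ t, θ t with hm
    set η : ℝ → ℝ := fun t => θ t - m * θ₀ t with hη
    have hηd : ContDiff ℝ (⊤ : ℕ∞) η := hθ.sub (contDiff_const.mul hθ₀d)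
    obtain ⟨hXd, hXe⟩ := contDiff_primitive hηd
    obtain ⟨a, b, ha, hb, hab⟩ := exists_Icc_of_isCompact hT (hθc.isCompact.union hθ₀c.isCompact)
      (union_subset hθs hθ₀s)
    have hη0 : ∀ t, t ∉ Icc a b → η t = 0 := by
      intro t ht
      have h3 : θ t = 0 := image_eq_zero_of_notMem_tsupport fun h => ht (hab (Or.inl h))
      have h4 : θ₀ t = 0 := image_eq_zero_of_notMem_tsupport fun h => ht (hab (Or.inr h))
      simp [hη, h3, h4]
    have hθi : Integrable θ := hθ.continuous.integrable_of_hasCompactSupport hθc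
    have hθ₀i : Integrable θ₀ := hθ₀d.continuous.integrable_of_hasCompactSupport hθ₀c
    have hηi : ∫ t, η t = 0 := by
      rw [hη, integral_sub hθi (hθ₀i.const_mul m), integral_const_mul, hθ₀1]; ring
    have hX0 : ∀ t, t ∉ Icc a b → ∫ s in (0 : ℝ)..t, η s = 0 := by
      intro t ht
      rcases lt_or_ge t a with hta | hta
      · refine (intervalIntegral.integral_congr (g := fun _ => 0) fun s hs => ?_).trans (by simp)
        refine hη0 s fun hsI => ?_
        have h5 : s < a := hs.2.trans_lt (max_lt ha hta)
        exact absurd hsI.1 (not_le.2 h5)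
      · have htb : b < t := by
          by_contra hh; exact ht ⟨hta, not_lt.1 hh⟩
        rw [intervalIntegral.integral_of_le (ha.le.trans hta),
          setIntegral_eq_integral_of_forall_compl_eq_zero, hηi]
        intro s hs
        refine hη0 s fun hsI => hs ⟨ha.trans_le hsI.1, hsI.2.trans htb.le⟩
    have h3 := h1 _ hXd ⟨a, b, ha, hb, hX0⟩
    rw [hXe] at h3
    have e1 : ∫ t in Ioo 0 T, F t * η t = (∫ t in Ioo 0 T, F t * θ t) - m * c := by
      rw [hc, ← integral_const_mul, ← integral_sub (hbd hFi hθ.continuous)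
        ((hbd hFi hθ₀d.continuous).const_mul m)]
      refine integral_congr_ae (ae_of_all _ fun t => ?_)
      simp only [hη]; ring
    have e2 : ∫ t in Ioo 0 T, θ t = m :=
      setIntegral_eq_integral_of_forall_compl_eq_zero fun t ht =>
        image_eq_zero_of_notMem_tsupport fun h => ht (hθs h)
    have e3 : ∫ t, θ t • (F t - c) = ∫ t in Ioo 0 T, θ t • (F t - c) := by
      refine (setIntegral_eq_integral_of_forall_compl_eq_zero fun t ht => ?_).symm
      rw [image_eq_zero_of_notMem_tsupport fun h => ht (hθs h), zero_smul]
    rw [e3]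
    have e4 : ∫ t in Ioo 0 T, θ t • (F t - c)
        = (∫ t in Ioo 0 T, F t * θ t) - c * ∫ t in Ioo 0 T, θ t := by
      rw [← integral_const_mul, ← integral_sub (hbd hFi hθ.continuous)
        (hθi.integrableOn.const_mul c)]
      refine integral_congr_ae (ae_of_all _ fun t => ?_)
      simp only [smul_eq_mul]; ring
    rw [e4, e2]
    linarith

/-- The version with initial value of `ae_eq_primitive_of_weak_deriv`. -/
lemma ae_eq_primitive_of_weak_deriv_init (hT : 0 < T) {f g : ℝ → ℝ} {c : ℝ}
    (hf : IntegrableOn f (Ioo 0 T)) (hg : IntegrableOn g (Ioo 0 T))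
    (h : ∀ χ : ℝ → ℝ, ContDiff ℝ (⊤ : ℕ∞) χ → (∃ b, b < T ∧ ∀ t, b < t → χ t = 0) →
      (∫ t in Ioo 0 T, (f t * deriv χ t + g t * χ t)) + c * χ 0 = 0) :
    ∀ᵐ t ∂(volume.restrict (Ioo 0 T)), f t = c + ∫ s in (0 : ℝ)..t, g s := by
  obtain ⟨c', hc'⟩ := ae_eq_primitive_of_weak_deriv hT hf hg (by
    rintro χ hχ ⟨a, b, ha, hb, hs⟩
    have := h χ hχ ⟨b, hb, fun t ht => hs t fun hm => by linarith [hm.2]⟩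
    rwa [hs 0 (fun hm => by linarith [hm.1]), mul_zero, add_zero] at this)
  let φ : ContDiffBump (0 : ℝ) := ⟨T / 4, T / 2, by linarith, by linarith⟩
  have hφ : ContDiff ℝ (⊤ : ℕ∞) φ := φ.contDiff
  have hφ0 : φ 0 = 1 := φ.one_of_mem_closedBall (by simp [φ.rIn_pos.le])
  have hφs : ∀ t, T / 2 < t → φ t = 0 := fun t ht =>
    φ.zero_of_le_dist (by
      rw [Real.dist_0_eq_abs]
      exact ht.le.trans (le_abs_self t))
  have e1 := h φ hφ ⟨T / 2, by linarith, hφs⟩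
  have e2 := integral_primitive_mul_deriv hT.le hg hφ c'
  rw [hφs T (by linarith), hφ0, mul_zero, mul_one, zero_sub] at e2
  have e3 : ∫ t in Ioo 0 T, (f t * deriv φ t + g t * φ t)
      = ∫ t in Ioo 0 T, ((c' + ∫ s in (0 : ℝ)..t, g s) * deriv φ t + g t * φ t) :=
    integral_congr_ae (hc'.mono fun t ht => by simp only [ht])
  rw [e3, e2, hφ0, mul_one] at e1
  have : c' = c := by linarith
  rwa [this] at hc'

/-! ### Time slices of weak formulations -/

/-- Integrability over `(0,T) × 𝕋ᵈ`. -/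
abbrev IntST (T : ℝ) (f : ℝ → Torus d → ℝ) : Prop :=
  Integrable (fun z : ℝ × Torus d => f z.1 z.2) (spaceTime d T)

lemma IntST.mul_left {f : ℝ → Torus d → ℝ} (hf : IntST T f) {χ : ℝ → ℝ} (hχ : Continuous χ) :
    IntST T (fun t x => f t x * χ t) := by
  obtain ⟨C, hC⟩ := (isCompact_Icc (a := 0) (b := T)).exists_bound_of_continuousOn
    hχ.continuousOn
  refine Integrable.mul_bdd (c := C) hf (hχ.comp continuous_fst).aestronglyMeasurable ?_
  have h1 : ∀ᵐ t ∂(volume.restrict (Ioo 0 T)), ‖χ t‖ ≤ C := by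
    filter_upwards [ae_restrict_mem measurableSet_Ioo] with t ht
    exact hC t ⟨ht.1.le, ht.2.le⟩
  exact Measure.quasiMeasurePreserving_fst.ae h1

lemma IntST.mul_trigPoly {f : ℝ → Torus d → ℝ} (hf : IntST T f) {w : Torus d → ℝ}
    (hw : w ∈ trigPoly d) : IntST T (fun t x => f t x * w x) := by
  obtain ⟨C, -, hC⟩ := exists_bound_of_mem_trigPoly hw
  exact Integrable.mul_bdd (c := C) hf
    ((continuous_of_mem_trigPoly hw).comp continuous_snd).aestronglyMeasurable
    (ae_of_all _ fun z => hC z.2)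

lemma IntST.slice {f : ℝ → Torus d → ℝ} (hf : IntST T f) :
    ∀ᵐ t ∂(volume.restrict (Ioo 0 T)), Integrable (f t) :=
  Integrable.prod_right_ae hf

lemma IntST.integrableOn {f : ℝ → Torus d → ℝ} (hf : IntST T f) :
    IntegrableOn (fun t => ∫ x, f t x) (Ioo 0 T) :=
  Integrable.integral_prod_left hf

lemma IntST.integral_eq {f : ℝ → Torus d → ℝ} (hf : IntST T f) :
    ∫ z, f z.1 z.2 ∂(spaceTime d T) = ∫ t in Ioo 0 T, ∫ x, f t x :=
  integral_prod _ hf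

lemma IntST.restrict {f : ℝ → Torus d → ℝ} (hf : IntST T f) {a b : ℝ} (ha : a ∈ Icc 0 T)
    (hb : b ∈ Icc 0 T) :
    Integrable (fun z : ℝ × Torus d => f z.1 z.2) ((volume.restrict (uIoc a b)).prod volume) := by
  refine Integrable.mono_measure hf (Measure.prod_mono ?_ le_rfl)
  rw [Measure.restrict_congr_set (Ioo_ae_eq_Ioc (a := (0 : ℝ)) (b := T))]
  refine Measure.restrict_mono (fun x hx => ?_) le_rfl
  rw [mem_uIoc] at hx
  rcases hx with hx | hx
  · exact ⟨ha.1.trans_lt hx.1, hx.2.trans hb.2⟩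
  · exact ⟨hb.1.trans_lt hx.1, hx.2.trans ha.2⟩

lemma integral_test_eq {p q : ℝ → Torus d → ℝ} (hp : IntST T p) (hq : IntST T q) {χ : ℝ → ℝ}
    (hχ : ContDiff ℝ (⊤ : ℕ∞) χ) :
    ∫ z, (p z.1 z.2 * deriv χ z.1 + q z.1 z.2 * χ z.1) ∂(spaceTime d T)
      = ∫ t in Ioo 0 T, ((∫ x, p t x) * deriv χ t + (∫ x, q t x) * χ t) := by
  have h1 := hp.mul_left (hχ.continuous_deriv (by exact_mod_cast le_top))
  have h2 := hq.mul_left hχ.continuous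
  have h3 : IntST T (fun t x => p t x * deriv χ t + q t x * χ t) := h1.add h2
  rw [h3.integral_eq]
  refine integral_congr_ae ?_
  filter_upwards [h1.slice, h2.slice] with t h1 h2
  rw [integral_add h1 h2, integral_mul_const, integral_mul_const]

/-- A weak time derivative on `(0,T) × 𝕋ᵈ`, tested with functions of time only. -/
lemma ae_integral_eq_primitive (hT : 0 < T) {p q : ℝ → Torus d → ℝ} (hp : IntST T p)
    (hq : IntST T q)
    (h : ∀ χ : ℝ → ℝ, ContDiff ℝ (⊤ : ℕ∞) χ →
      (∃ a b, 0 < a ∧ b < T ∧ ∀ t, t ∉ Icc a b → χ t = 0) →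
      ∫ z, (p z.1 z.2 * deriv χ z.1 + q z.1 z.2 * χ z.1) ∂(spaceTime d T) = 0) :
    ∃ c, ∀ᵐ t ∂(volume.restrict (Ioo 0 T)), ∫ x, p t x = c + ∫ s in (0 : ℝ)..t, ∫ x, q s x :=
  ae_eq_primitive_of_weak_deriv hT hp.integrableOn hq.integrableOn fun χ hχ hs => by
    rw [← integral_test_eq hp hq hχ, h χ hχ hs]

lemma ae_integral_eq_primitive_init (hT : 0 < T) {p q : ℝ → Torus d → ℝ} {c : ℝ}
    (hp : IntST T p) (hq : IntST T q)
    (h : ∀ χ : ℝ → ℝ, ContDiff ℝ (⊤ : ℕ∞) χ → (∃ b, b < T ∧ ∀ t, b < t → χ t = 0) →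
      ∫ z, (p z.1 z.2 * deriv χ z.1 + q z.1 z.2 * χ z.1) ∂(spaceTime d T) + c * χ 0 = 0) :
    ∀ᵐ t ∂(volume.restrict (Ioo 0 T)), ∫ x, p t x = c + ∫ s in (0 : ℝ)..t, ∫ x, q s x :=
  ae_eq_primitive_of_weak_deriv_init hT hp.integrableOn hq.integrableOn fun χ hχ hs => by
    rw [← integral_test_eq hp hq hχ, h χ hχ hs]

/-- A weak partial derivative on `(0,T) × 𝕋ᵈ` is a weak partial derivative at almost every time. -/
lemma HasWeakPartial.slice {j : Fin d} {f g : ℝ → Torus d → ℝ}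
    (h : HasWeakPartial T j f g) :
    ∀ᵐ t ∂(volume.restrict (Ioo 0 T)), HasTorusPartial j (f t) (g t) := by
  rcases le_or_gt T 0 with hT | hT
  · rw [Ioo_eq_empty (not_lt.2 hT)]; simp
  obtain ⟨hf, hg, hw⟩ := h
  refine ae_forall_trigPoly (fun w hwt => ?_) ?_ ?_
  · have i1 : IntST T (fun t x => f t x * pderiv j w x) :=
      IntST.mul_trigPoly hf (pderiv_mem_trigPoly hwt j)
    have i2 : IntST T (fun t x => g t x * w x) := IntST.mul_trigPoly hg hwt
    have i3 : IntST T (fun t x => f t x * pderiv j w x + g t x * w x) := i1.add i2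
    have hz := isOpen_Ioo.ae_eq_zero_of_integral_contDiff_smul_eq_zero (μ := volume)
      (f := fun t => ∫ x, (f t x * pderiv j w x + g t x * w x)) (U := Ioo 0 T)
      i3.integrableOn.locallyIntegrableOn ?_
    · rw [ae_restrict_iff' measurableSet_Ioo]
      have h1 := (ae_restrict_iff' measurableSet_Ioo).1 i1.slice
      have h2 := (ae_restrict_iff' measurableSet_Ioo).1 i2.slice
      filter_upwards [hz, h1, h2] with t ht h1 h2 htI
      have := ht htI
      rw [integral_add (h1 htI) (h2 htI)] at this
      linarith
    · intro χ hχ hχc hχs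
      obtain ⟨a, b, ha, hb, hab⟩ := exists_Icc_of_isCompact hT hχc.isCompact hχs
      have hχ0 : ∀ t, t ∉ Icc a b → χ t = 0 := fun t ht =>
        image_eq_zero_of_notMem_tsupport fun h => ht (hab h)
      have h1 := hw (fun t x => χ t * w x) ⟨isSmooth_mul hχ hwt, a, b, ha, hb, fun t ht x => by
        simp only [hχ0 t ht, zero_mul]⟩
      simp only [pderiv_const_mul] at h1
      have e1 : ∫ t, χ t • ∫ x, (f t x * pderiv j w x + g t x * w x)
          = ∫ t in Ioo 0 T, (∫ x, (f t x * pderiv j w x + g t x * w x)) * χ t := by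
        rw [setIntegral_eq_integral_of_forall_compl_eq_zero]
        · simp only [smul_eq_mul, mul_comm]
        · intro t ht
          rw [hχ0 t (fun hm => ht ⟨ha.trans_le hm.1, hm.2.trans_lt hb⟩), mul_zero]
      have e2 : ∫ t in Ioo 0 T, (∫ x, (f t x * pderiv j w x + g t x * w x)) * χ t
          = ∫ z, (f z.1 z.2 * (χ z.1 * pderiv j w z.2) + g z.1 z.2 * (χ z.1 * w z.2))
            ∂(spaceTime d T) := by
        have i4 := i3.mul_left hχ.continuous
        simp_rw [← integral_mul_const]
        rw [← i4.integral_eq]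
        refine integral_congr_ae (ae_of_all _ fun z => ?_)
        simp only; ring
      have i5 : Integrable (fun z : ℝ × Torus d => f z.1 z.2 * (χ z.1 * pderiv j w z.2))
          (spaceTime d T) :=
        (i1.mul_left hχ.continuous).congr (ae_of_all _ fun z => by simp only; ring)
      have i6 : Integrable (fun z : ℝ × Torus d => g z.1 z.2 * (χ z.1 * w z.2))
          (spaceTime d T) :=
        (i2.mul_left hχ.continuous).congr (ae_of_all _ fun z => by simp only; ring)
      rw [e1, e2, integral_add i5 i6, h1]
      ring
  · have hf' : IntST T f := hf
    have hg' : IntST T g := hg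
    filter_upwards [hf'.slice, hg'.slice] with t hft hgt w₁ hw₁ w₂ hw₂ h₁ h₂
    simp_rw [pderiv_add hw₁ hw₂, mul_add]
    rw [integral_add (integrable_mul_of_mem_trigPoly hft (pderiv_mem_trigPoly hw₁ j))
      (integrable_mul_of_mem_trigPoly hft (pderiv_mem_trigPoly hw₂ j)),
      integral_add (integrable_mul_of_mem_trigPoly hgt hw₁)
      (integrable_mul_of_mem_trigPoly hgt hw₂), h₁, h₂]
    ring
  · refine ae_of_all _ fun t c w hw h => ?_
    simp_rw [pderiv_const_mul, mul_left_comm _ c]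
    rw [integral_const_mul, integral_const_mul, h]
    ring

/-! ### The product rule -/

/-- The product rule for `s² v`, where `s` and `v` have weak derivatives `R` and `D`; only `s` is
mollified. -/
lemma integral_sq_mul_pderiv {j : Fin d} {s R v D : Torus d → ℝ} {as aR av aD : ℝ}
    (has : 0 < as) (haR : 0 < aR) (hav : 0 < av) (haD : 0 < aD)
    (h1 : as + aR + av ≤ 1) (h2 : as + as + aD ≤ 1) (h3 : as + as + av ≤ 1)
    (hs : MemLp s (pe as) volume) (hR : MemLp R (pe aR) volume) (hv : MemLp v (pe av) volume)
    (hD : MemLp D (pe aD) volume) (hsR : HasTorusPartial j s R) (hvD : HasTorusPartial j v D)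
    {ψ : Torus d → ℝ} (hψ : ψ ∈ trigPoly d) :
    ∫ x, s x * s x * v x * pderiv j ψ x = -∫ x, (2 * s x * R x * v x + s x * s x * D x) * ψ x := by
  have hsi := memLp_pe_integrable (by linarith) hs
  have cs := lConv_moll has (by linarith) hs
  have cR := lConv_moll haR (by linarith) hR
  have cψ : LConv 0 (fun _ => ψ) ψ := LConv.const (memLp_of_mem_trigPoly hψ _)
  have cψ' : LConv 0 (fun _ => pderiv j ψ) (pderiv j ψ) :=
    LConv.const (memLp_of_mem_trigPoly (pderiv_mem_trigPoly hψ j) _)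
  have css := cs.mul has.le has.le (by linarith) cs
  have l1 := ((css.mul (by linarith) hav.le h3 (LConv.const hv)).mul (by linarith) le_rfl
    (by linarith) cψ')
  have l2 := ((cs.mul has.le haR.le (by linarith) cR).mul (by linarith) hav.le h1
    (LConv.const hv)).mul (by linarith) le_rfl (by linarith) cψ
  have l3 := (css.mul (by linarith) haD.le h2 (LConv.const hD)).mul (by linarith) le_rfl
    (by linarith) cψ
  have key : ∀ N, ∫ x, moll N s x * moll N s x * v x * pderiv j ψ x
      = -(2 * ∫ x, moll N s x * moll N R x * v x * ψ x)
        - ∫ x, moll N s x * moll N s x * D x * ψ x := by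
    intro N
    have hm := moll_mem_trigPoly N hsi
    have hmm : (fun x => moll N s x * moll N s x) ∈ trigPoly d := mul_mem hm hm
    have hw : (fun x => (moll N s x * moll N s x) * ψ x) ∈ trigPoly d := mul_mem hmm hψ
    have h4 := hvD _ hw
    simp_rw [pderiv_mul hmm hψ, pderiv_mul hm hm, pderiv_moll N hsi hsR] at h4
    have i1 := memLp_pe_integrable (by linarith) (l1.mem N)
    have i2 := memLp_pe_integrable (by linarith) (l2.mem N)
    have e1 : ∫ x, v x * ((moll N R x * moll N s x + moll N s x * moll N R x) * ψ x
        + moll N s x * moll N s x * pderiv j ψ x)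
        = 2 * (∫ x, moll N s x * moll N R x * v x * ψ x)
          + ∫ x, moll N s x * moll N s x * v x * pderiv j ψ x := by
      rw [← integral_const_mul, ← integral_add (i2.const_mul 2) i1]
      congr 1; ext x; ring
    have e2 : ∫ x, D x * (moll N s x * moll N s x * ψ x)
        = ∫ x, moll N s x * moll N s x * D x * ψ x := by
      congr 1; ext x; ring
    rw [e1, e2] at h4
    linarith
  have t1 := l1.tendsto_integral (by linarith)
  have t2 := ((l2.tendsto_integral (by linarith)).const_mul 2).neg.sub
    (l3.tendsto_integral (by linarith))
  have t3 := tendsto_nhds_unique (t1.congr key) t2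
  rw [t3]
  have i2 := memLp_pe_integrable (by linarith) l2.lim_mem
  have i3 := memLp_pe_integrable (by linarith) l3.lim_mem
  rw [← integral_const_mul, ← neg_add', ← integral_add (i2.const_mul 2) i3]
  congr 2; ext x; ring

/-! ### The density as a primitive in time -/

/-- The function `ϱ₀ - ∫₀ᵗ g`, a primitive in time with values in `L¹`. -/
def primitiveDensity (ϱ₀ : Torus d → ℝ) (g : ℝ → Torus d → ℝ) (t : ℝ) (x : Torus d) : ℝ :=
  ϱ₀ x - ∫ s in (0 : ℝ)..t, g s x

section primitive

variable {ϱ₀ : Torus d → ℝ} {g : ℝ → Torus d → ℝ}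

lemma integrable_primitive (hT : 0 ≤ T) (hg : IntST T g) {t : ℝ} (ht : t ∈ Icc 0 T) :
    Integrable (fun x => ∫ s in (0 : ℝ)..t, g s x) := by
  have h := (hg.restrict ⟨le_rfl, hT⟩ ht).swap
  simp_rw [intervalIntegral.integral_of_le ht.1]
  rw [uIoc_of_le ht.1] at h
  exact h.integral_prod_left

lemma integrable_primitiveDensity (hT : 0 ≤ T) (h₀ : Integrable ϱ₀) (hg : IntST T g) {t : ℝ}
    (ht : t ∈ Icc 0 T) : Integrable (primitiveDensity ϱ₀ g t) :=
  h₀.sub (integrable_primitive hT hg ht)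

lemma integral_primitiveDensity_mul (hT : 0 ≤ T) (h₀ : Integrable ϱ₀) (hg : IntST T g) {t : ℝ}
    (ht : t ∈ Icc 0 T) {w : Torus d → ℝ} (hw : w ∈ trigPoly d) :
    ∫ x, primitiveDensity ϱ₀ g t x * w x
      = (∫ x, ϱ₀ x * w x) - ∫ s in (0 : ℝ)..t, ∫ x, g s x * w x := by
  have hgw := (hg.mul_trigPoly hw).restrict ⟨le_rfl, hT⟩ ht
  rw [intervalIntegral_integral_swap hgw]
  simp_rw [primitiveDensity, sub_mul, intervalIntegral.integral_mul_const]
  exact integral_sub (integrable_mul_of_mem_trigPoly h₀ hw)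
    (integrable_mul_of_mem_trigPoly (integrable_primitive hT hg ht) hw)

lemma tendsto_primitiveDensity (hT : 0 ≤ T) (hg : IntST T g) {t₀ : ℝ}
    (ht₀ : t₀ ∈ Icc 0 T) :
    Tendsto (fun t => ∫⁻ x, ‖primitiveDensity ϱ₀ g t x - primitiveDensity ϱ₀ g t₀ x‖ₑ)
      (𝓝[Icc 0 T] t₀) (𝓝 0) := by
  have h0 : (0 : ℝ) ∈ Icc 0 T := ⟨le_rfl, hT⟩
  have hTI : T ∈ Icc 0 T := ⟨hT, le_rfl⟩
  have hgT := hg.restrict h0 hTI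
  rw [uIoc_of_le hT] at hgT
  have hfin : ∫⁻ s in Ioc 0 T, ∫⁻ x, ‖g s x‖ₑ ≠ ∞ := by
    have := hgT.2
    rw [HasFiniteIntegral, lintegral_prod _ hgT.1.enorm] at this
    exact this.ne
  have hs : Tendsto ((volume.restrict (Ioc 0 T)) ∘ fun t => uIoc t₀ t) (𝓝[Icc 0 T] t₀) (𝓝 0) := by
    have h1 : Tendsto (fun t => ENNReal.ofReal |t - t₀|) (𝓝[Icc 0 T] t₀) (𝓝 0) := by
      have : Continuous fun t => ENNReal.ofReal |t - t₀| :=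
        ENNReal.continuous_ofReal.comp (by fun_prop)
      simpa using (this.tendsto t₀).mono_left nhdsWithin_le_nhds
    refine tendsto_of_tendsto_of_tendsto_of_le_of_le tendsto_const_nhds h1
      (fun _ => zero_le) fun t => ?_
    exact (Measure.restrict_apply_le _ _).trans (by rw [Real.volume_uIoc])
  have h2 := tendsto_setLIntegral_zero hfin hs
  refine tendsto_of_tendsto_of_tendsto_of_le_of_le' tendsto_const_nhds h2
    (Eventually.of_forall fun _ => zero_le) ?_
  filter_upwards [self_mem_nhdsWithin] with t ht
  have hsub : uIoc t₀ t ⊆ Ioc 0 T := fun x hx => by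
    rw [mem_uIoc] at hx
    rcases hx with hx | hx
    · exact ⟨ht₀.1.trans_lt hx.1, hx.2.trans ht.2⟩
    · exact ⟨ht.1.trans_lt hx.1, hx.2.trans ht₀.2⟩
  rw [Measure.restrict_restrict measurableSet_uIoc, inter_eq_left.2 hsub]
  have hgt := hg.restrict ht₀ ht
  rw [lintegral_lintegral_swap hgt.1.enorm]
  have hslice := hgT.prod_left_ae
  refine lintegral_mono_ae ?_
  filter_upwards [hslice] with x hx
  have i1 : IntervalIntegrable (fun s => g s x) volume 0 t₀ := by
    rw [intervalIntegrable_iff_integrableOn_Ioc_of_le ht₀.1]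
    exact IntegrableOn.mono_set hx (Ioc_subset_Ioc_right ht₀.2)
  have i2 : IntervalIntegrable (fun s => g s x) volume 0 t := by
    rw [intervalIntegrable_iff_integrableOn_Ioc_of_le ht.1]
    exact IntegrableOn.mono_set hx (Ioc_subset_Ioc_right ht.2)
  have e : primitiveDensity ϱ₀ g t x - primitiveDensity ϱ₀ g t₀ x
      = -∫ s in t₀..t, g s x := by
    rw [← intervalIntegral.integral_interval_sub_left i2 i1]
    simp only [primitiveDensity]; ring
  rw [e, enorm_neg, ← ofReal_norm, intervalIntegral.norm_intervalIntegral_eq, ofReal_norm]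
  exact enorm_integral_le_lintegral_enorm _

end primitive

/-! ### The regularity class -/

/-- A weak solution in the regularity class of the theorem, the Lebesgue exponents being replaced by
their reciprocals: `al = 1/p`, `be = 1/q`, `ka = 1/k` and `el = 1/l`. -/
structure RegularSolution (μ lam γ T al be ka el : ℝ) (ϱ : ℝ → Torus d → ℝ)
    (v : ℝ → Torus d → Vec d) (D : ℝ → Torus d → Mat d) (R : ℝ → Torus d → Vec d)
    (ϱ₀ : Torus d → ℝ) (v₀ : Torus d → Vec d) : Prop where
  sol : IsWeakSolution μ lam γ T ϱ v D ϱ₀ v₀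
  time_pos : 0 < T
  one_lt_gamma : 1 < γ
  al_pos : 0 < al
  be_pos : 0 < be
  ka_pos : 0 < ka
  el_pos : 0 < el
  ka_lt_three : ka / 2 < 1 - 3 * al
  ka_lt_two : ka < 1 - 2 * al
  ka_lt_gamma : (γ - 1) * ka < 2 * al
  el_lt_three : el / 2 < 1 - 3 * be
  el_lt_two : el < 1 - 2 * be
  el_lt_gamma : (γ - 1) * el < 2 * be
  density : Mix T ka el ϱ
  velocity : ∀ i, Mix T al be (fun t x => v t x i)
  grad : ∀ i, Mix T (1 - 2 * al - ka) (1 - 2 * be - el) (fun t x => D t x i)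
  grad_two : ∀ i, Mix T (1 / 2) (1 / 2) (fun t x => D t x i)
  sqrt_grad : HasWeakGrad T (fun t x => √(ϱ t x)) R
  sqrt_grad_mem : ∀ j, Mix T (1 - 3 * al - ka / 2) (1 - 3 * be - el / 2) (fun t x => R t x j)

/-- The divergence `2 √ϱ ∇√ϱ · v + ϱ div v` of the momentum. -/
def divMomentum (ϱ : ℝ → Torus d → ℝ) (v : ℝ → Torus d → Vec d) (D : ℝ → Torus d → Mat d)
    (R : ℝ → Torus d → Vec d) (t : ℝ) (x : Torus d) : ℝ :=
  ∑ j, (2 * √(ϱ t x) * R t x j * v t x j + ϱ t x * D t x (j, j))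

section

variable {μ lam γ al be ka el : ℝ} {ϱ : ℝ → Torus d → ℝ}
  {v : ℝ → Torus d → Vec d} {D : ℝ → Torus d → Mat d} {R : ℝ → Torus d → Vec d}
  {ϱ₀ : Torus d → ℝ} {v₀ : Torus d → Vec d}

namespace RegularSolution

variable (S : RegularSolution μ lam γ T al be ka el ϱ v D R ϱ₀ v₀)

include S

lemma ae_nonneg : ∀ᵐ t ∂(volume.restrict (Ioo 0 T)), ∀ᵐ x, 0 ≤ ϱ t x :=
  Measure.ae_ae_of_ae_prod S.sol.density_nonneg

lemma mix_density_velocity (j : Fin d) :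
    Mix T (ka + al) (el + be) (fun t x => ϱ t x * v t x j) :=
  S.density.mul S.ka_pos S.el_pos S.al_pos S.be_pos (S.velocity j)

lemma intST_density : IntST T ϱ :=
  S.density.integrable S.ka_pos (by linarith [S.ka_lt_two, S.al_pos]) S.el_pos
    (by linarith [S.el_lt_two, S.be_pos])

lemma intST_density_velocity (j : Fin d) : IntST T (fun t x => ϱ t x * v t x j) :=
  (S.mix_density_velocity j).integrable (by linarith [S.ka_pos, S.al_pos])
    (by linarith [S.ka_lt_two, S.al_pos]) (by linarith [S.el_pos, S.be_pos])
    (by linarith [S.el_lt_two, S.be_pos])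

lemma intST_density_grad (i : Fin d × Fin d) : IntST T (fun t x => ϱ t x * D t x i) :=
  (S.density.mul S.ka_pos S.el_pos (by linarith [S.ka_lt_two]) (by linarith [S.el_lt_two])
    (S.grad i)).integrable (by linarith [S.ka_lt_two, S.ka_pos]) (by linarith [S.al_pos])
    (by linarith [S.el_lt_two, S.el_pos]) (by linarith [S.be_pos])

lemma intST_divMomentum : IntST T (divMomentum ϱ v D R) := by
  refine integrable_finsetSum _ fun j _ => Integrable.add ?_ (S.intST_density_grad (j, j))
  have h1 := ((S.density.sqrt S.ka_pos S.el_pos).mul (by linarith [S.ka_pos])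
    (by linarith [S.el_pos]) (by linarith [S.ka_lt_three]) (by linarith [S.el_lt_three])
    (S.sqrt_grad_mem j)).mul (by linarith [S.ka_lt_three, S.ka_pos])
    (by linarith [S.el_lt_three, S.el_pos]) S.al_pos S.be_pos (S.velocity j)
  have h2 := h1.integrable (by linarith [S.ka_lt_two, S.ka_pos]) (by linarith [S.al_pos])
    (by linarith [S.el_lt_two, S.el_pos]) (by linarith [S.be_pos])
  refine (h2.const_mul 2).congr (ae_of_all _ fun z => ?_)
  simp only; ring

/-- At almost every time, `ϱ v` has the integrable divergence `divMomentum`. -/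
lemma ae_integral_momentum_grad : ∀ᵐ t ∂(volume.restrict (Ioo 0 T)), ∀ w ∈ trigPoly d,
    ∫ x, ∑ j, ϱ t x * v t x j * pderiv j w x = -∫ x, divMomentum ϱ v D R t x * w x := by
  have h1 : ∀ᵐ t ∂(volume.restrict (Ioo 0 T)), ∀ j,
      HasTorusPartial j (fun x => √(ϱ t x)) (fun x => R t x j) :=
    ae_all_iff.2 fun j => (S.sqrt_grad j).slice
  have h2 : ∀ᵐ t ∂(volume.restrict (Ioo 0 T)), ∀ j,
      HasTorusPartial j (fun x => v t x j) (fun x => D t x (j, j)) :=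
    ae_all_iff.2 fun j => (S.sol.gradient j j).slice
  have h3 := (S.density.sqrt S.ka_pos S.el_pos).memLp_slice (by linarith [S.ka_pos])
    (by linarith [S.el_pos])
  have h4 : ∀ᵐ t ∂(volume.restrict (Ioo 0 T)), ∀ j,
      MemLp (fun x => R t x j) (pe (1 - 3 * be - el / 2)) volume :=
    ae_all_iff.2 fun j => (S.sqrt_grad_mem j).memLp_slice (by linarith [S.ka_lt_three])
      (by linarith [S.el_lt_three])
  have h5 : ∀ᵐ t ∂(volume.restrict (Ioo 0 T)), ∀ j, MemLp (fun x => v t x j) (pe be) volume :=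
    ae_all_iff.2 fun j => (S.velocity j).memLp_slice S.al_pos S.be_pos
  have h6 : ∀ᵐ t ∂(volume.restrict (Ioo 0 T)), ∀ j : Fin d,
      MemLp (fun x => D t x (j, j)) (pe (1 - 2 * be - el)) volume :=
    ae_all_iff.2 fun j => (S.grad (j, j)).memLp_slice (by linarith [S.ka_lt_two])
      (by linarith [S.el_lt_two])
  have h7 : ∀ᵐ t ∂(volume.restrict (Ioo 0 T)), ∀ j : Fin d,
      Integrable (fun x => ϱ t x * v t x j) :=
    ae_all_iff.2 fun j => (S.intST_density_velocity j).slice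
  have h8 : ∀ᵐ t ∂(volume.restrict (Ioo 0 T)), ∀ j : Fin d,
      Integrable (fun x => 2 * √(ϱ t x) * R t x j * v t x j + ϱ t x * D t x (j, j)) := by
    refine ae_all_iff.2 fun j => ?_
    filter_upwards [h3, h4, h5, (S.intST_density_grad (j, j)).slice] with t h3 h4 h5 h6
    have h9 := memLp_mul (by linarith [S.el_lt_three, S.el_pos]) S.be_pos.le
      (memLp_mul (by linarith [S.el_pos]) (by linarith [S.el_lt_three]) h3 (h4 j)) (h5 j)
    have h10 := memLp_pe_integrable (by linarith [S.be_pos]) h9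
    refine Integrable.add ?_ h6
    refine (h10.const_mul 2).congr (ae_of_all _ fun x => ?_)
    simp only; ring
  filter_upwards [h1, h2, h3, h4, h5, h6, h7, h8, S.ae_nonneg] with t h1 h2 h3 h4 h5 h6 h7 h8 h9 w hw
  rw [integral_finsetSum _ fun j _ =>
    integrable_mul_of_mem_trigPoly (h7 j) (pderiv_mem_trigPoly hw j)]
  simp_rw [divMomentum, Finset.sum_mul]
  rw [integral_finsetSum _ fun j _ => integrable_mul_of_mem_trigPoly (h8 j) hw,
    ← Finset.sum_neg_distrib]
  refine Finset.sum_congr rfl fun j _ => ?_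
  have h10 := integral_sq_mul_pderiv (by linarith [S.el_pos]) (by linarith [S.el_lt_three])
    S.be_pos (by linarith [S.el_lt_two]) (by linarith [S.be_pos]) (by linarith [S.be_pos])
    (by linarith [S.be_pos, S.el_lt_two]) h3 (h4 j) (h5 j) (h6 j) (h1 j) (h2 j) hw
  have e1 : ∫ x, ϱ t x * v t x j * pderiv j w x
      = ∫ x, √(ϱ t x) * √(ϱ t x) * v t x j * pderiv j w x :=
    integral_congr_ae (h9.mono fun x hx => by simp only [Real.mul_self_sqrt hx])
  have e2 : ∫ x, (2 * √(ϱ t x) * R t x j * v t x j + ϱ t x * D t x (j, j)) * w x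
      = ∫ x, (2 * √(ϱ t x) * R t x j * v t x j + √(ϱ t x) * √(ϱ t x) * D t x (j, j)) * w x :=
    integral_congr_ae (h9.mono fun x hx => by simp only [Real.mul_self_sqrt hx])
  rw [e1, e2, h10]

lemma init_energy_parts : Integrable (fun x => ϱ₀ x ^ γ) ∧
    Integrable (fun x => ϱ₀ x * ‖v₀ x‖ ^ 2) := by
  have hγ := S.one_lt_gamma
  have h := S.sol.init_energy_finite
  have hm := S.sol.init_density_meas
  have hv := S.sol.init_velocity_meas
  constructor
  · have h1 : Integrable (fun x => (γ - 1) * energyDensity γ ϱ₀ v₀ x) := h.const_mul _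
    refine h1.mono ((Real.continuous_rpow_const (by linarith)).comp_aestronglyMeasurable hm) ?_
    filter_upwards [S.sol.init_density_nonneg] with x hx
    have h2 : 0 ≤ ϱ₀ x ^ γ := Real.rpow_nonneg hx _
    have h3 : 0 ≤ 1 / 2 * ϱ₀ x * ‖v₀ x‖ ^ 2 := by positivity
    rw [Real.norm_of_nonneg h2, Real.norm_eq_abs]
    refine le_trans ?_ (le_abs_self _)
    have : (γ - 1) * (ϱ₀ x ^ γ / (γ - 1)) = ϱ₀ x ^ γ := by
      field_simp [(by linarith : γ - 1 ≠ 0)]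
    rw [energyDensity, mul_add, this]
    nlinarith
  · have h1 : Integrable (fun x => 2 * energyDensity γ ϱ₀ v₀ x) := h.const_mul _
    refine h1.mono (hm.mul (hv.norm.pow 2)) ?_
    filter_upwards [S.sol.init_density_nonneg] with x hx
    have h2 : 0 ≤ ϱ₀ x ^ γ / (γ - 1) := div_nonneg (Real.rpow_nonneg hx _) (by linarith)
    have h3 : 0 ≤ ϱ₀ x * ‖v₀ x‖ ^ 2 := by positivity
    rw [Real.norm_of_nonneg h3, Real.norm_eq_abs]
    refine le_trans ?_ (le_abs_self _)
    rw [energyDensity]; linarith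

lemma integrable_init_density : Integrable ϱ₀ := by
  have hγ := S.one_lt_gamma
  refine ((integrable_const (1 : ℝ)).add S.init_energy_parts.1).mono S.sol.init_density_meas ?_
  filter_upwards [S.sol.init_density_nonneg] with x hx
  rw [Real.norm_of_nonneg hx, Real.norm_eq_abs]
  refine le_trans ?_ (le_abs_self _)
  have h0 := Real.rpow_nonneg hx γ
  simp only [Pi.add_apply]
  rcases le_total (ϱ₀ x) 1 with h | h
  · linarith
  · have := Real.rpow_le_rpow_of_exponent_le h hγ.le
    rw [Real.rpow_one] at this
    linarith

lemma integral_flux_grad {w : Torus d → ℝ} (hw : w ∈ trigPoly d) {t : ℝ} (ht : t ∈ Icc 0 T) :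
    ∫ s in (0 : ℝ)..t, ∫ x, ∑ j, ϱ s x * v s x j * pderiv j w x
      = -∫ s in (0 : ℝ)..t, ∫ x, divMomentum ϱ v D R s x * w x := by
  rw [← intervalIntegral.integral_neg]
  refine intervalIntegral.integral_congr_ae ?_
  have h5 := (ae_restrict_iff' measurableSet_Ioo).1 S.ae_integral_momentum_grad
  have h6 : ∀ᵐ s : ℝ, s ≠ T := by simp [ae_iff]
  filter_upwards [h5, h6] with s hs hsT hsI
  rw [uIoc_of_le ht.1] at hsI
  exact hs ⟨hsI.1, lt_of_le_of_ne (hsI.2.trans ht.2) hsT⟩ w hw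

/-- The weakly continuous representative of the density; it is a primitive in time. -/
lemma ae_density_eq : ∀ᵐ t ∂(volume.restrict (Ioo 0 T)),
    ϱ t =ᵐ[volume] primitiveDensity ϱ₀ (divMomentum ϱ v D R) t := by
  set g := divMomentum ϱ v D R with hg
  have hT := S.time_pos
  have hgi := S.intST_divMomentum
  have h0 := S.integrable_init_density
  have hI : ∀ᵐ t ∂(volume.restrict (Ioo 0 T)), t ∈ Icc 0 T := by
    filter_upwards [ae_restrict_mem measurableSet_Ioo] with t ht using ⟨ht.1.le, ht.2.le⟩
  have hint : ∀ᵐ t ∂(volume.restrict (Ioo 0 T)),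
      Integrable (fun x => ϱ t x - primitiveDensity ϱ₀ g t x) := by
    filter_upwards [S.intST_density.slice, hI] with t h1 h2
    exact h1.sub (integrable_primitiveDensity hT.le h0 hgi h2)
  have h1 : ∀ᵐ t ∂(volume.restrict (Ioo 0 T)), ∀ w ∈ trigPoly d,
      ∫ x, (ϱ t x - primitiveDensity ϱ₀ g t x) * w x = 0 := by
    refine ae_forall_trigPoly (fun w hw => ?_) ?_ ?_
    · have hq : IntST T (fun t x => ∑ j, ϱ t x * v t x j * pderiv j w x) :=
        integrable_finsetSum _ fun j _ =>
          (S.intST_density_velocity j).mul_trigPoly (pderiv_mem_trigPoly hw j)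
      have h2 := ae_integral_eq_primitive_init hT (S.intST_density.mul_trigPoly hw) hq
        (c := ∫ x, ϱ₀ x * w x) (by
          rintro χ hχ ⟨b, hb, hχb⟩
          have h3 := S.sol.mass (fun t x => χ t * w x) ⟨isSmooth_mul hχ hw, b, hb,
            fun t ht x => by simp only [hχb t ht, zero_mul]⟩
          refine Eq.trans ?_ h3
          congr 1
          · refine integral_congr_ae (ae_of_all _ fun z => ?_)
            simp only [pderiv_const_mul, deriv_mul_const_field, Finset.sum_mul]
            congr 1
            · ring
            · exact Finset.sum_congr rfl fun j _ => by ring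
          · rw [← integral_mul_const]
            congr 1; ext x; ring)
      filter_upwards [h2, hI, S.intST_density.slice] with t h2 htI hϱ
      simp_rw [sub_mul]
      rw [integral_sub (integrable_mul_of_mem_trigPoly hϱ hw)
        (integrable_mul_of_mem_trigPoly (integrable_primitiveDensity hT.le h0 hgi htI) hw), h2,
        integral_primitiveDensity_mul hT.le h0 hgi htI hw,
        S.integral_flux_grad hw htI]
      ring
    · filter_upwards [hint] with t ht w₁ hw₁ w₂ hw₂ h₁ h₂
      simp_rw [mul_add]
      rw [integral_add (integrable_mul_of_mem_trigPoly ht hw₁)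
        (integrable_mul_of_mem_trigPoly ht hw₂), h₁, h₂, add_zero]
    · refine ae_of_all _ fun t c w hw h => ?_
      simp_rw [mul_left_comm _ c]
      rw [integral_const_mul, h, mul_zero]
  filter_upwards [h1, hint] with t h1 h2
  filter_upwards [ae_eq_zero_of_integral_trigPoly h2 h1] with x hx
  exact sub_eq_zero.1 hx

end RegularSolution

end

/-! ### Approximation of times by almost every time -/

/-- The filter of the times `t → t₀` taken outside any null set of `(0,T)`. -/
def nearTime (T t₀ : ℝ) : Filter ℝ := ae (volume.restrict (Ioo 0 T)) ⊓ 𝓝 t₀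

lemma nearTime_neBot (hT : 0 < T) {t₀ : ℝ} (ht₀ : t₀ ∈ Icc 0 T) : (nearTime T t₀).NeBot := by
  rw [nearTime, inf_neBot_iff]
  intro U hU V hV
  obtain ⟨δ, hδ, hV⟩ := Metric.mem_nhds_iff.1 hV
  by_contra hne
  rw [not_nonempty_iff_eq_empty] at hne
  have h1 : volume.restrict (Ioo 0 T) Uᶜ = 0 := hU
  have h2 : Ioo (max 0 (t₀ - δ)) (min T (t₀ + δ)) ⊆ Uᶜ ∩ Ioo 0 T := by
    intro s hs
    have h3 := max_lt_iff.1 hs.1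
    have h4 := lt_min_iff.1 hs.2
    refine ⟨fun hsU => ?_, h3.1, h4.1⟩
    have : s ∈ U ∩ V := ⟨hsU, hV (by
      rw [Metric.mem_ball, Real.dist_eq, abs_lt]; constructor <;> linarith [h3.2, h4.2])⟩
    rw [hne] at this
    exact this
  rw [Measure.restrict_apply' measurableSet_Ioo] at h1
  have h5 := measure_mono_null h2 h1
  rw [Real.volume_Ioo, ENNReal.ofReal_eq_zero] at h5
  have h6 : max 0 (t₀ - δ) < min T (t₀ + δ) := by
    rw [max_lt_iff, lt_min_iff, lt_min_iff]
    refine ⟨⟨hT, ?_⟩, ?_, ?_⟩ <;> linarith [ht₀.1, ht₀.2]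
  linarith

lemma nearTime_le (T t₀ : ℝ) : nearTime T t₀ ≤ 𝓝[Icc 0 T] t₀ := by
  rw [nhdsWithin, inf_comm]
  refine inf_le_inf ?_ le_rfl
  rw [le_principal_iff]
  filter_upwards [ae_restrict_mem measurableSet_Ioo] with t ht using ⟨ht.1.le, ht.2.le⟩

lemma eventually_nearTime {P : ℝ → Prop} (h : ∀ᵐ t ∂(volume.restrict (Ioo 0 T)), P t) (t₀ : ℝ) :
    ∀ᶠ t in nearTime T t₀, P t :=
  Eventually.filter_mono inf_le_left h

lemma eq_of_ae_eq_of_continuousOn (hT : 0 < T) {f g : ℝ → ℝ} (hf : ContinuousOn f (Icc 0 T))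
    (hg : ContinuousOn g (Icc 0 T)) (h : ∀ᵐ t ∂(volume.restrict (Ioo 0 T)), f t = g t) :
    ∀ t ∈ Icc 0 T, f t = g t := by
  intro t ht
  have := nearTime_neBot hT ht
  exact tendsto_nhds_unique_of_eventuallyEq ((hf t ht).mono_left (nearTime_le T t))
    ((hg t ht).mono_left (nearTime_le T t)) (eventually_nearTime h t)

lemma IntST.mono {f : ℝ → Torus d → ℝ} (hf : IntST T f) {t : ℝ} (ht : t ≤ T) : IntST t f :=
  Integrable.mono_measure hf
    (Measure.prod_mono (Measure.restrict_mono (Ioo_subset_Ioo_right ht) le_rfl) le_rfl)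

lemma IntST.intervalIntegral_eq {f : ℝ → Torus d → ℝ} (hf : IntST T f) {t : ℝ}
    (ht : t ∈ Icc 0 T) :
    ∫ s in (0 : ℝ)..t, ∫ x, f s x = ∫ z, f z.1 z.2 ∂(spaceTime d t) := by
  rw [(hf.mono ht.2).integral_eq, integral_Ioo_eq ht.1]

/-! ### Truncated pressures -/

/-- The derivative of the truncated power. -/
def truncDeriv (γ : ℝ) (n : ℕ) (s : ℝ) : ℝ :=
  γ * (max s 0) ^ (γ - 1) * max 0 (min 1 (n + 1 - s))

/-- A `C¹` function which is `z ^ γ` for `0 ≤ z ≤ n` and constant for `z ≥ n + 1`. -/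
def truncPow (γ : ℝ) (n : ℕ) (z : ℝ) : ℝ := ∫ s in (0 : ℝ)..z, truncDeriv γ n s

section trunc

variable {γ : ℝ} {n : ℕ}

lemma continuous_truncDeriv (hγ : 1 < γ) : Continuous (truncDeriv γ n) := by
  have h1 : Continuous fun s : ℝ => (max s 0) ^ (γ - 1) :=
    (Real.continuous_rpow_const (by linarith)).comp (by fun_prop)
  unfold truncDeriv
  fun_prop

lemma hasDerivAt_truncPow (hγ : 1 < γ) (z : ℝ) :
    HasDerivAt (truncPow γ n) (truncDeriv γ n z) z :=
  ((continuous_truncDeriv hγ).integral_hasStrictDerivAt 0 z).hasDerivAt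

lemma deriv_truncPow (hγ : 1 < γ) : deriv (truncPow γ n) = truncDeriv γ n :=
  funext fun z => (hasDerivAt_truncPow hγ z).deriv

lemma contDiff_truncPow (hγ : 1 < γ) : ContDiff ℝ 1 (truncPow γ n) := by
  rw [contDiff_one_iff_deriv, deriv_truncPow hγ]
  exact ⟨fun z => (hasDerivAt_truncPow hγ z).differentiableAt, continuous_truncDeriv hγ⟩

lemma truncDeriv_eq_zero {z : ℝ} (hz : (n : ℝ) + 1 ≤ z) : truncDeriv γ n z = 0 := by
  rw [truncDeriv, max_eq_left ((min_le_right _ _).trans (by linarith)), mul_zero]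

lemma truncDeriv_nonneg (hγ : 1 < γ) (z : ℝ) : 0 ≤ truncDeriv γ n z :=
  mul_nonneg (mul_nonneg (by linarith) (Real.rpow_nonneg (le_max_right _ _) _)) (le_max_left _ _)

lemma truncDeriv_le (hγ : 1 < γ) {z : ℝ} (hz : 0 ≤ z) :
    truncDeriv γ n z ≤ γ * z ^ (γ - 1) := by
  rw [truncDeriv, max_eq_left hz]
  exact mul_le_of_le_one_right (mul_nonneg (by linarith) (Real.rpow_nonneg hz _))
    (max_le zero_le_one (min_le_left _ _))

lemma truncDeriv_eq {z : ℝ} (hz : 0 ≤ z) (hzn : z ≤ n) :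
    truncDeriv γ n z = γ * z ^ (γ - 1) := by
  rw [truncDeriv, max_eq_left hz, min_eq_left (by linarith), max_eq_right zero_le_one, mul_one]

lemma truncDeriv_le_const (hγ : 1 < γ) (z : ℝ) :
    truncDeriv γ n z ≤ γ * ((n : ℝ) + 1) ^ (γ - 1) := by
  have hn : (0 : ℝ) ≤ n + 1 := by positivity
  rcases le_total ((n : ℝ) + 1) z with h | h
  · rw [truncDeriv_eq_zero h]
    exact mul_nonneg (by linarith) (Real.rpow_nonneg hn _)
  · rw [truncDeriv]
    refine (mul_le_of_le_one_right (mul_nonneg (by linarith)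
      (Real.rpow_nonneg (le_max_right _ _) _))
      (max_le zero_le_one (min_le_left _ _))).trans ?_
    exact mul_le_mul_of_nonneg_left (Real.rpow_le_rpow (le_max_right _ _) (max_le h hn)
      (by linarith)) (by linarith)

lemma integral_power (hγ : 1 < γ) (z : ℝ) : ∫ s in (0 : ℝ)..z, γ * s ^ (γ - 1) = z ^ γ := by
  rw [intervalIntegral.integral_const_mul, integral_rpow (Or.inl (by linarith)), sub_add_cancel,
    Real.zero_rpow (by linarith), sub_zero]
  field_simp

lemma truncPow_nonneg (hγ : 1 < γ) {z : ℝ} (hz : 0 ≤ z) : 0 ≤ truncPow γ n z :=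
  intervalIntegral.integral_nonneg hz fun s _ => truncDeriv_nonneg hγ s

lemma truncPow_le (hγ : 1 < γ) {z : ℝ} (hz : 0 ≤ z) : truncPow γ n z ≤ z ^ γ := by
  rw [← integral_power hγ z]
  have hc : Continuous fun s : ℝ => γ * s ^ (γ - 1) :=
    continuous_const.mul (Real.continuous_rpow_const (by linarith))
  exact intervalIntegral.integral_mono_on hz
    ((continuous_truncDeriv hγ).intervalIntegrable _ _) (hc.intervalIntegrable _ _)
    fun s hs => truncDeriv_le hγ hs.1

lemma truncPow_eq (hγ : 1 < γ) {z : ℝ} (hz : 0 ≤ z) (hzn : z ≤ n) : truncPow γ n z = z ^ γ := by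
  rw [← integral_power hγ z, truncPow]
  refine intervalIntegral.integral_congr fun s hs => ?_
  rw [uIcc_of_le hz] at hs
  exact truncDeriv_eq hs.1 (hs.2.trans hzn)

lemma abs_truncPow_sub_le (hγ : 1 < γ) (y z : ℝ) :
    |truncPow γ n z - truncPow γ n y| ≤ γ * ((n : ℝ) + 1) ^ (γ - 1) * |z - y| :=
  Convex.norm_image_sub_le_of_norm_hasDerivWithin_le (s := univ) (f := truncPow γ n)
    (fun s _ => (hasDerivAt_truncPow hγ s).hasDerivWithinAt)
    (fun s _ => by
      rw [Real.norm_of_nonneg (truncDeriv_nonneg hγ s)]; exact truncDeriv_le_const hγ s)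
    convex_univ (mem_univ _) (mem_univ _)

lemma abs_truncPow_le (hγ : 1 < γ) (z : ℝ) :
    |truncPow γ n z| ≤ γ * ((n : ℝ) + 1) ^ (γ - 1) * |z| := by
  have := abs_truncPow_sub_le (n := n) hγ 0 z
  simpa [truncPow] using this

lemma truncDeriv_mul_self_le (hγ : 1 < γ) {z : ℝ} (hz : 0 ≤ z) :
    truncDeriv γ n z * z ≤ γ * z ^ γ := by
  refine (mul_le_mul_of_nonneg_right (truncDeriv_le hγ hz) hz).trans (le_of_eq ?_)
  rcases hz.eq_or_lt with rfl | hz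
  · rw [mul_zero, Real.zero_rpow (by linarith), mul_zero]
  · rw [mul_assoc, ← Real.rpow_add_one hz.ne', sub_add_cancel]

lemma abs_truncDeriv_mul_sub_le (hγ : 1 < γ) {z : ℝ} (hz : 0 ≤ z) :
    |truncDeriv γ n z * z - truncPow γ n z| ≤ γ * z ^ γ := by
  have h1 := truncDeriv_mul_self_le (n := n) hγ hz
  have h2 := truncPow_le (n := n) hγ hz
  have h3 := truncPow_nonneg (n := n) hγ hz
  have h4 : 0 ≤ truncDeriv γ n z * z := mul_nonneg (truncDeriv_nonneg hγ z) hz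
  have h5 : z ^ γ ≤ γ * z ^ γ := le_mul_of_one_le_left (Real.rpow_nonneg hz _) hγ.le
  rw [abs_le]; constructor <;> linarith

lemma tendsto_truncPow (hγ : 1 < γ) {z : ℝ} (hz : 0 ≤ z) :
    Tendsto (fun n => truncPow γ n z) atTop (𝓝 (z ^ γ)) := by
  refine tendsto_const_nhds.congr' ?_
  obtain ⟨N, hN⟩ := exists_nat_ge z
  filter_upwards [eventually_ge_atTop N] with n hn
  exact (truncPow_eq hγ hz (hN.trans (by exact_mod_cast hn))).symm

lemma tendsto_truncDeriv_mul_sub (hγ : 1 < γ) {z : ℝ} (hz : 0 ≤ z) :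
    Tendsto (fun n => truncDeriv γ n z * z - truncPow γ n z) atTop (𝓝 ((γ - 1) * z ^ γ)) := by
  refine tendsto_const_nhds.congr' ?_
  obtain ⟨N, hN⟩ := exists_nat_ge z
  filter_upwards [eventually_ge_atTop N] with n hn
  have h : z ≤ n := hN.trans (by exact_mod_cast hn)
  rw [truncPow_eq hγ hz h, truncDeriv_eq hz h]
  rcases hz.eq_or_lt with rfl | hz
  · rw [mul_zero, Real.zero_rpow (by linarith)]; ring
  · rw [mul_assoc, ← Real.rpow_add_one hz.ne', sub_add_cancel]; ring

end trunc

/-! ### The density and the pressure at every time -/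

section

variable {μ lam γ al be ka el : ℝ} {ϱ : ℝ → Torus d → ℝ}
  {v : ℝ → Torus d → Vec d} {D : ℝ → Torus d → Mat d} {R : ℝ → Torus d → Vec d}
  {ϱ₀ : Torus d → ℝ} {v₀ : Torus d → Vec d}

/-- The representative of the density which is continuous in time with values in `L¹`. -/
abbrev rep (ϱ₀ : Torus d → ℝ) (ϱ : ℝ → Torus d → ℝ) (v : ℝ → Torus d → Vec d)
    (D : ℝ → Torus d → Mat d) (R : ℝ → Torus d → Vec d) : ℝ → Torus d → ℝ :=
  primitiveDensity ϱ₀ (divMomentum ϱ v D R)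

lemma rep_zero : rep ϱ₀ ϱ v D R 0 = ϱ₀ := by
  ext x; simp [primitiveDensity]

namespace RegularSolution

variable (S : RegularSolution μ lam γ T al be ka el ϱ v D R ϱ₀ v₀)

include S

lemma integrable_rep {t : ℝ} (ht : t ∈ Icc 0 T) : Integrable (rep ϱ₀ ϱ v D R t) :=
  integrable_primitiveDensity S.time_pos.le S.integrable_init_density S.intST_divMomentum ht

lemma tendsto_rep {t₀ : ℝ} (ht₀ : t₀ ∈ Icc 0 T) :
    Tendsto (fun t => ∫⁻ x, ‖rep ϱ₀ ϱ v D R t x - rep ϱ₀ ϱ v D R t₀ x‖ₑ)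
      (𝓝[Icc 0 T] t₀) (𝓝 0) :=
  tendsto_primitiveDensity S.time_pos.le S.intST_divMomentum ht₀

lemma rep_nonneg {t : ℝ} (ht : t ∈ Icc 0 T) : ∀ᵐ x, 0 ≤ rep ϱ₀ ϱ v D R t x := by
  have := nearTime_neBot S.time_pos ht
  have h1 : ∀ᶠ s in nearTime T t, ∫⁻ x, ENNReal.ofReal (-rep ϱ₀ ϱ v D R t x)
      ≤ ∫⁻ x, ‖rep ϱ₀ ϱ v D R s x - rep ϱ₀ ϱ v D R t x‖ₑ := by
    filter_upwards [eventually_nearTime S.ae_density_eq t, eventually_nearTime S.ae_nonneg t]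
      with s h1 h2
    refine lintegral_mono_ae ?_
    filter_upwards [h1, h2] with x h1 h2
    rw [← ofReal_norm]
    refine ENNReal.ofReal_le_ofReal ((?_ : _ ≤ _).trans (le_abs_self _))
    rw [rep, ← h1]; linarith
  have h2 := ge_of_tendsto ((S.tendsto_rep ht).mono_left (nearTime_le T t)) h1
  have h3 := (lintegral_eq_zero_iff' ((S.integrable_rep ht).aestronglyMeasurable.aemeasurable.neg
    |>.ennreal_ofReal)).1 (le_antisymm h2 zero_le)
  filter_upwards [h3] with x hx
  have h4 : -rep ϱ₀ ϱ v D R t x ≤ 0 := ENNReal.ofReal_eq_zero.1 hx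
  linarith

lemma integral_rep_mul {w : Torus d → ℝ} (hw : w ∈ trigPoly d) {t : ℝ} (ht : t ∈ Icc 0 T) :
    ∫ x, rep ϱ₀ ϱ v D R t x * w x = (∫ x, ϱ₀ x * w x)
      + ∫ s in (0 : ℝ)..t, ∫ x, ∑ j, ϱ s x * v s x j * pderiv j w x := by
  rw [integral_primitiveDensity_mul S.time_pos.le S.integrable_init_density S.intST_divMomentum
    ht hw, S.integral_flux_grad hw ht]
  ring

lemma ae_nonneg_spaceTime : ∀ᵐ z ∂(spaceTime d T), 0 ≤ ϱ z.1 z.2 := S.sol.density_nonneg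

lemma mix_pressure : Mix T (γ * ka) (γ * el) (fun t x => |ϱ t x| ^ γ) :=
  S.density.abs_rpow S.ka_pos S.el_pos (by linarith [S.one_lt_gamma])

lemma intST_pressure_grad (i : Fin d × Fin d) : IntST T (fun t x => ϱ t x ^ γ * D t x i) := by
  have hγ := S.one_lt_gamma
  have h1 := mul_pos (by linarith : 0 < γ) S.ka_pos
  have h2 := mul_pos (by linarith : 0 < γ) S.el_pos
  have h := (S.mix_pressure.mul h1 h2 (by linarith [S.ka_lt_two]) (by linarith [S.el_lt_two])
    (S.grad i)).integrable (by linarith [S.ka_lt_two]) (by linarith [S.ka_lt_gamma])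
    (by linarith [S.el_lt_two]) (by linarith [S.el_lt_gamma])
  refine Integrable.congr h ?_
  filter_upwards [S.ae_nonneg_spaceTime] with z hz
  rw [abs_of_nonneg hz]

lemma intST_pressure_tr : IntST T (fun t x => ϱ t x ^ γ * tr (D t x)) := by
  have : IntST T (fun t x => ∑ i, ϱ t x ^ γ * D t x (i, i)) :=
    integrable_finsetSum _ fun i _ => S.intST_pressure_grad (i, i)
  simpa only [tr, Finset.mul_sum] using this

lemma aesm_tr : AEStronglyMeasurable (fun z : ℝ × Torus d => tr (D z.1 z.2)) (spaceTime d T) := by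
  have h : AEStronglyMeasurable (fun z : ℝ × Torus d => ∑ i, D z.1 z.2 (i, i)) (spaceTime d T) :=
    Finset.aestronglyMeasurable_fun_sum _ fun i _ => (S.grad (i, i)).meas
  exact h

lemma integrable_truncPow_rep (n : ℕ) {t : ℝ} (ht : t ∈ Icc 0 T) :
    Integrable (fun x => truncPow γ n (rep ϱ₀ ϱ v D R t x)) := by
  have hγ := S.one_lt_gamma
  refine ((S.integrable_rep ht).norm.const_mul (γ * ((n : ℝ) + 1) ^ (γ - 1))).mono'
    ((contDiff_truncPow hγ).continuous.comp_aestronglyMeasurable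
      (S.integrable_rep ht).aestronglyMeasurable) (ae_of_all _ fun x => abs_truncPow_le hγ _)

lemma continuousOn_integral_truncPow (n : ℕ) :
    ContinuousOn (fun t => ∫ x, truncPow γ n (rep ϱ₀ ϱ v D R t x)) (Icc 0 T) := by
  have hγ := S.one_lt_gamma
  intro t ht
  rw [ContinuousWithinAt]
  refine tendsto_integral_of_L1 _ (S.integrable_truncPow_rep n ht).aestronglyMeasurable ?_ ?_
  · filter_upwards [self_mem_nhdsWithin] with s hs using S.integrable_truncPow_rep n hs
  · have hC : ENNReal.ofReal (γ * ((n : ℝ) + 1) ^ (γ - 1)) ≠ ∞ := ENNReal.ofReal_ne_top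
    have h1 := ENNReal.Tendsto.const_mul (S.tendsto_rep ht) (Or.inr hC)
    rw [mul_zero] at h1
    refine tendsto_of_tendsto_of_tendsto_of_le_of_le tendsto_const_nhds h1
      (fun _ => zero_le) fun s => ?_
    dsimp only
    rw [← lintegral_const_mul' _ _ hC]
    refine lintegral_mono fun x => ?_
    rw [← ofReal_norm, ← ofReal_norm, ← ENNReal.ofReal_mul (mul_nonneg (by linarith)
      (Real.rpow_nonneg (by positivity) _))]
    exact ENNReal.ofReal_le_ofReal (abs_truncPow_sub_le hγ _ _)

lemma intST_truncPow (n : ℕ) : IntST T (fun t x => truncPow γ n (ϱ t x)) := by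
  have hγ := S.one_lt_gamma
  exact (S.intST_density.norm.const_mul (γ * ((n : ℝ) + 1) ^ (γ - 1))).mono'
    ((contDiff_truncPow hγ).continuous.comp_aestronglyMeasurable S.sol.density_meas)
    (ae_of_all _ fun z => abs_truncPow_le hγ _)

lemma aesm_truncDeriv_mul_tr (n : ℕ) : AEStronglyMeasurable (fun z : ℝ × Torus d =>
    (truncDeriv γ n (ϱ z.1 z.2) * ϱ z.1 z.2 - truncPow γ n (ϱ z.1 z.2)) * tr (D z.1 z.2))
    (spaceTime d T) := by
  have hγ := S.one_lt_gamma
  exact ((((continuous_truncDeriv hγ).comp_aestronglyMeasurable S.sol.density_meas).mul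
    S.sol.density_meas).sub ((contDiff_truncPow hγ).continuous.comp_aestronglyMeasurable
    S.sol.density_meas)).mul S.aesm_tr

lemma truncDeriv_mul_tr_le (n : ℕ) : ∀ᵐ z ∂(spaceTime d T),
    ‖(truncDeriv γ n (ϱ z.1 z.2) * ϱ z.1 z.2 - truncPow γ n (ϱ z.1 z.2)) * tr (D z.1 z.2)‖
      ≤ γ * ‖ϱ z.1 z.2 ^ γ * tr (D z.1 z.2)‖ := by
  filter_upwards [S.ae_nonneg_spaceTime] with z hz
  rw [norm_mul, norm_mul, ← mul_assoc, Real.norm_of_nonneg (Real.rpow_nonneg hz _)]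
  exact mul_le_mul_of_nonneg_right (abs_truncDeriv_mul_sub_le S.one_lt_gamma hz) (norm_nonneg _)

lemma intST_truncDeriv_mul_tr (n : ℕ) : IntST T (fun t x =>
    (truncDeriv γ n (ϱ t x) * ϱ t x - truncPow γ n (ϱ t x)) * tr (D t x)) :=
  (S.intST_pressure_tr.norm.const_mul γ).mono' (S.aesm_truncDeriv_mul_tr n)
    (S.truncDeriv_mul_tr_le n)

/-- The renormalized mass equation, integrated over the torus, at every time. -/
lemma integral_truncPow_rep (n : ℕ) {t : ℝ} (ht : t ∈ Icc 0 T) :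
    ∫ x, truncPow γ n (rep ϱ₀ ϱ v D R t x) = (∫ x, truncPow γ n (ϱ₀ x))
      - ∫ s in (0 : ℝ)..t, ∫ x,
        (truncDeriv γ n (ϱ s x) * ϱ s x - truncPow γ n (ϱ s x)) * tr (D s x) := by
  have hγ := S.one_lt_gamma
  have hT := S.time_pos
  have hq := S.intST_truncDeriv_mul_tr n
  have hq' : IntST T (fun t x =>
      -((truncDeriv γ n (ϱ t x) * ϱ t x - truncPow γ n (ϱ t x)) * tr (D t x))) := hq.neg
  obtain ⟨c, hc⟩ := ae_integral_eq_primitive hT (S.intST_truncPow n) hq' (by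
    rintro χ hχ ⟨a, b, ha, hb, hs⟩
    have h1 := S.sol.renormalized (truncPow γ n) (contDiff_truncPow hγ)
      ⟨(n : ℝ) + 1, fun z hz => by rw [deriv_truncPow hγ]; exact truncDeriv_eq_zero hz⟩
      (fun t x => χ t * (fun _ => (1 : ℝ)) x)
      ⟨isSmooth_mul hχ (const_mem_trigPoly 1), a, b, ha, hb,
        fun t ht x => by simp only [hs t ht, zero_mul]⟩
    refine Eq.trans ?_ h1
    refine integral_congr_ae (ae_of_all _ fun z => ?_)
    simp only [pderiv_const, deriv_truncPow hγ, mul_one, mul_zero,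
      Finset.sum_const_zero]
    ring)
  have hcont := continuousOn_primitive_Ioo hT.le hq'.integrableOn
  have h2 := eq_of_ae_eq_of_continuousOn hT (S.continuousOn_integral_truncPow n)
    (g := fun t => c + ∫ s in (0 : ℝ)..t, ∫ x,
      -((truncDeriv γ n (ϱ s x) * ϱ s x - truncPow γ n (ϱ s x)) * tr (D s x)))
    (continuousOn_const.add hcont) (by
      filter_upwards [hc, S.ae_density_eq] with t h1 h2
      rw [← h1]
      exact integral_congr_ae (h2.mono fun x hx => by simp only [hx]))
  have h3 := h2 0 ⟨le_rfl, hT.le⟩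
  rw [rep_zero, intervalIntegral.integral_same, add_zero] at h3
  rw [h2 t ht, h3]
  simp_rw [integral_neg, intervalIntegral.integral_neg]
  ring

/-- The pressure balance, at every time. -/
lemma integral_pressure_rep {t : ℝ} (ht : t ∈ Icc 0 T) :
    Integrable (fun x => rep ϱ₀ ϱ v D R t x ^ γ) ∧
    ∫ x, rep ϱ₀ ϱ v D R t x ^ γ = (∫ x, ϱ₀ x ^ γ)
      - (γ - 1) * ∫ s in (0 : ℝ)..t, ∫ x, ϱ s x ^ γ * tr (D s x) := by
  have hγ := S.one_lt_gamma
  have hT := S.time_pos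
  have h0 := S.sol.init_density_nonneg
  have hr := S.rep_nonneg ht
  have hrm := (S.integrable_rep ht).aestronglyMeasurable
  have hle : spaceTime d t ≤ spaceTime d T :=
    Measure.prod_mono (Measure.restrict_mono (Ioo_subset_Ioo_right ht.2) le_rfl) le_rfl
  have c1 : Tendsto (fun n => ∫ x, truncPow γ n (ϱ₀ x)) atTop (𝓝 (∫ x, ϱ₀ x ^ γ)) := by
    refine tendsto_integral_of_dominated_convergence _ (fun n =>
      (contDiff_truncPow hγ).continuous.comp_aestronglyMeasurable S.sol.init_density_meas)
      S.init_energy_parts.1 (fun n => ?_) ?_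
    · filter_upwards [h0] with x hx
      rw [Real.norm_of_nonneg (truncPow_nonneg hγ hx)]
      exact truncPow_le hγ hx
    · filter_upwards [h0] with x hx using tendsto_truncPow hγ hx
  have c2 : Tendsto (fun n => ∫ s in (0 : ℝ)..t, ∫ x,
      (truncDeriv γ n (ϱ s x) * ϱ s x - truncPow γ n (ϱ s x)) * tr (D s x)) atTop
      (𝓝 ((γ - 1) * ∫ s in (0 : ℝ)..t, ∫ x, ϱ s x ^ γ * tr (D s x))) := by
    simp_rw [(S.intST_truncDeriv_mul_tr _).intervalIntegral_eq ht]
    rw [S.intST_pressure_tr.intervalIntegral_eq ht, ← integral_const_mul]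
    refine tendsto_integral_of_dominated_convergence _
      (fun n => (S.aesm_truncDeriv_mul_tr n).mono_measure hle)
      ((S.intST_pressure_tr.mono ht.2).norm.const_mul γ)
      (fun n => ae_mono hle (S.truncDeriv_mul_tr_le n)) ?_
    filter_upwards [ae_mono hle S.ae_nonneg_spaceTime] with z hz
    rw [← mul_assoc]
    exact (tendsto_truncDeriv_mul_sub hγ hz).mul_const _
  have c3 := c1.sub c2
  simp_rw [← S.integral_truncPow_rep _ ht] at c3
  have hint : Integrable (fun x => rep ϱ₀ ϱ v D R t x ^ γ) := by
    refine ⟨(Real.continuous_rpow_const (by linarith)).comp_aestronglyMeasurable hrm, ?_⟩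
    have f1 : ∫⁻ x, ‖rep ϱ₀ ϱ v D R t x ^ γ‖ₑ
        ≤ ∫⁻ x, liminf (fun n => ‖truncPow γ n (rep ϱ₀ ϱ v D R t x)‖ₑ) atTop := by
      refine lintegral_mono_ae ?_
      filter_upwards [hr] with x hx
      exact ((tendsto_truncPow hγ hx).enorm.liminf_eq).ge
    have f2 := lintegral_liminf_le' (u := atTop) (μ := (volume : Measure (Torus d))) (fun n : ℕ =>
      ((contDiff_truncPow (n := n) hγ).continuous.comp_aestronglyMeasurable hrm).enorm)
    have f3 : ∀ n, ∫⁻ x, ‖truncPow γ n (rep ϱ₀ ϱ v D R t x)‖ₑ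
        = ENNReal.ofReal (∫ x, truncPow γ n (rep ϱ₀ ϱ v D R t x)) := by
      intro n
      have hnn : 0 ≤ᵐ[volume] fun x => truncPow γ n (rep ϱ₀ ϱ v D R t x) :=
        hr.mono fun x hx => truncPow_nonneg hγ hx
      rw [ofReal_integral_eq_lintegral_ofReal (S.integrable_truncPow_rep n ht) hnn]
      exact lintegral_congr_ae (hnn.mono fun x hx => Real.enorm_of_nonneg hx)
    refine f1.trans_lt (f2.trans_lt ?_)
    simp only [f3]
    have f4 := ((ENNReal.continuous_ofReal.tendsto _).comp c3).liminf_eq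
    simp only [Function.comp_def] at f4
    rw [f4]
    exact ENNReal.ofReal_lt_top
  refine ⟨hint, ?_⟩
  refine tendsto_nhds_unique ?_ c3
  refine tendsto_integral_of_dominated_convergence _ (fun n =>
    (contDiff_truncPow hγ).continuous.comp_aestronglyMeasurable hrm) hint (fun n => ?_) ?_
  · filter_upwards [hr] with x hx
    rw [Real.norm_of_nonneg (truncPow_nonneg hγ hx)]
    exact truncPow_le hγ hx
  · filter_upwards [hr] with x hx using tendsto_truncPow hγ hx

lemma exists_pressure_bound : ∃ C, ∀ t ∈ Icc 0 T, ∫ x, rep ϱ₀ ϱ v D R t x ^ γ ≤ C := by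
  have h := (continuousOn_primitive_Ioo S.time_pos.le S.intST_pressure_tr.integrableOn)
  have h2 : ContinuousOn (fun t => (∫ x, ϱ₀ x ^ γ)
      - (γ - 1) * ∫ s in (0 : ℝ)..t, ∫ x, ϱ s x ^ γ * tr (D s x)) (Icc 0 T) := by fun_prop
  obtain ⟨C, hC⟩ := isCompact_Icc.exists_bound_of_continuousOn h2
  exact ⟨C, fun t ht => by
    rw [(S.integral_pressure_rep ht).2]; exact (le_abs_self _).trans (hC t ht)⟩

end RegularSolution

end

/-! ### Linear combinations in mixed Lebesgue spaces -/

lemma Mix.add {a b : ℝ} (ha : 0 < a) (ha1 : a ≤ 1) (hb : 0 < b) (hb1 : b ≤ 1)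
    {f g : ℝ → Torus d → ℝ} (hf : Mix T a b f) (hg : Mix T a b g) :
    Mix T a b (fun t x => f t x + g t x) := by
  refine ⟨hf.meas.add hg.meas, ?_⟩
  refine lt_of_le_of_lt ?_ (ENNReal.add_lt_top.2 ⟨hf.lt_top, hg.lt_top⟩)
  have h := ENNReal.lintegral_Lp_add_le (hf.aemeasurable hb) (hg.aemeasurable hb)
    (one_le_inv_iff₀.2 ⟨ha, ha1⟩)
  simp only [one_div, inv_inv] at h
  refine le_trans (nrm_mono ha.le ?_) h
  filter_upwards [hf.meas.prodMk_left, hg.meas.prodMk_left] with t h1 h2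
  exact eLpNorm_add_le h1 h2 (one_le_pe hb1)

lemma Mix.const_mul {a b : ℝ} (ha : 0 < a) {f : ℝ → Torus d → ℝ} (hf : Mix T a b f) (c : ℝ) :
    Mix T a b (fun t x => c * f t x) := by
  refine ⟨hf.meas.const_mul c, ?_⟩
  have e : ∀ t, eLpNorm (fun x => c * f t x) (pe b) volume
      = ‖c‖ₑ * eLpNorm (f t) (pe b) volume := fun t => eLpNorm_const_smul c (f t) _ _
  have hc : ‖c‖ₑ ^ a⁻¹ ≠ ∞ := ENNReal.rpow_ne_top_of_nonneg (inv_pos.2 ha).le enorm_ne_top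
  simp_rw [nrm, e, ENNReal.mul_rpow_of_nonneg _ _ (inv_pos.2 ha).le]
  rw [lintegral_const_mul' _ _ hc, ENNReal.mul_rpow_of_nonneg _ _ ha.le]
  exact ENNReal.mul_lt_top (ENNReal.rpow_lt_top_of_nonneg ha.le hc) hf.lt_top

lemma Mix.zero {a b : ℝ} (ha : 0 < a) : Mix T a b (fun _ (_ : Torus d) => 0) := by
  refine ⟨aestronglyMeasurable_const, ?_⟩
  have e : eLpNorm (fun _ : Torus d => (0 : ℝ)) (pe b) volume = 0 := eLpNorm_zero
  simp [nrm, e, ha]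

lemma Mix.sum {ι : Type*} (s : Finset ι) {a b : ℝ} (ha : 0 < a) (ha1 : a ≤ 1) (hb : 0 < b)
    (hb1 : b ≤ 1) {f : ι → ℝ → Torus d → ℝ} (hf : ∀ i, Mix T a b (f i)) :
    Mix T a b (fun t x => ∑ i ∈ s, f i t x) := by
  classical
  induction s using Finset.induction_on with
  | empty => simpa using! Mix.zero (d := d) (T := T) ha
  | insert i s hi ih =>
    simp only [Finset.sum_insert hi]
    exact (hf i).add ha ha1 hb hb1 ih

/-! ### Weak limits in Hilbert spaces -/

lemma exists_weak_limit {α H : Type*} [NormedAddCommGroup H] [InnerProductSpace ℝ H]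
    [CompleteSpace H] (U : Ultrafilter α) {Z : α → H} {K : ℝ} (hK : ∀ᶠ s in U, ‖Z s‖ ≤ K) :
    ∃ z : H, ∀ y, Tendsto (fun s => inner ℝ (Z s) y) U (𝓝 (inner ℝ z y)) := by
  let φ : α → WeakDual ℝ H := fun s => StrongDual.toWeakDual (InnerProductSpace.toDual ℝ H (Z s))
  have hc := WeakDual.isCompact_closedBall (𝕜 := ℝ) (0 : StrongDual ℝ H) K
  obtain ⟨ψ, -, hψ⟩ := hc.ultrafilter_le_nhds (U.map φ) (by
    rw [Ultrafilter.coe_map, le_principal_iff, mem_map]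
    filter_upwards [hK] with s hs
    simpa [φ] using hs)
  refine ⟨(InnerProductSpace.toDual ℝ H).symm (WeakDual.toStrongDual ψ), fun y => ?_⟩
  have h1 : Tendsto (fun s => φ s y) U (𝓝 (ψ y)) :=
    ((WeakDual.eval_continuous y).tendsto ψ).comp (show Tendsto φ U (𝓝 ψ) from hψ)
  rw [InnerProductSpace.toDual_symm_apply]
  exact h1

lemma norm_sq_le_of_weak_limit {α H : Type*} [NormedAddCommGroup H] [InnerProductSpace ℝ H]
    {U : Filter α} [U.NeBot] {Z : α → H} {z : H}
    (hz : ∀ y, Tendsto (fun s => inner ℝ (Z s) y) U (𝓝 (inner ℝ z y))) {c : ℝ}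
    (hc : ∀ᶠ s in U, ‖Z s‖ ^ 2 ≤ c) : ‖z‖ ^ 2 ≤ c := by
  have h : inner ℝ z z ≤ (c + ‖z‖ ^ 2) / 2 := by
    refine le_of_tendsto (hz z) ?_
    filter_upwards [hc] with s hs
    nlinarith [real_inner_le_norm (Z s) z, sq_nonneg (‖Z s‖ - ‖z‖)]
  rw [real_inner_self_eq_norm_sq] at h
  linarith

/-! ### The momentum at every time -/

/-- The entry `(i, j)` of `ϱ v ⊗ v + ϱ^γ I`. -/
def inertialStress (γ : ℝ) (ϱ : ℝ → Torus d → ℝ) (v : ℝ → Torus d → Vec d) (i j : Fin d) (t : ℝ)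
    (x : Torus d) : ℝ :=
  ϱ t x * v t x i * v t x j + if i = j then ϱ t x ^ γ else 0

/-- The entry `(i, j)` of `-μ ∇v - (μ + lam) (div v) I`. -/
def viscousStress (μ lam : ℝ) (D : ℝ → Torus d → Mat d) (i j : Fin d) (t : ℝ)
    (x : Torus d) : ℝ :=
  -μ * D t x (i, j) + if i = j then -(μ + lam) * tr (D t x) else 0

/-- The integral of the `i`-th component of the momentum at time `t` against `w`, as given by the
momentum equation. -/
def momentumPairing (μ lam γ : ℝ) (ϱ : ℝ → Torus d → ℝ) (v : ℝ → Torus d → Vec d)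
    (D : ℝ → Torus d → Mat d) (ϱ₀ : Torus d → ℝ) (v₀ : Torus d → Vec d) (i : Fin d)
    (w : Torus d → ℝ) (t : ℝ) : ℝ :=
  (∫ x, ϱ₀ x * v₀ x i * w x) + ∫ s in (0 : ℝ)..t, ∫ x, ∑ j,
    (inertialStress γ ϱ v i j s x + viscousStress μ lam D i j s x) * pderiv j w x

/-- A momentum of finite kinetic energy is integrable. -/
lemma integrable_momentum {r : Torus d → ℝ} {u : Torus d → Vec d} (hr : Integrable r)
    (hu : AEStronglyMeasurable u volume) (hru : Integrable (fun x => r x * ‖u x‖ ^ 2))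
    (i : Fin d) : Integrable (fun x => r x * u x i) := by
  refine (hr.norm.add hru.norm).mono (hr.aestronglyMeasurable.mul
    ((EuclideanSpace.proj i : Vec d →L[ℝ] ℝ).continuous.comp_aestronglyMeasurable hu))
    (ae_of_all _ fun x => ?_)
  have h1 : |u x i| ≤ ‖u x‖ := PiLp.norm_apply_le (u x) i
  simp only [Pi.add_apply, norm_mul, Real.norm_eq_abs, abs_pow, abs_norm]
  rw [abs_of_nonneg (a := |r x| + _) (by positivity)]
  have h2 : |u x i| ≤ 1 + ‖u x‖ ^ 2 := by nlinarith [sq_nonneg (‖u x‖ - 1)]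
  nlinarith [abs_nonneg (r x)]

section

variable {μ lam γ al be ka el : ℝ} {ϱ : ℝ → Torus d → ℝ}
  {v : ℝ → Torus d → Vec d} {D : ℝ → Torus d → Mat d} {R : ℝ → Torus d → Vec d}
  {ϱ₀ : Torus d → ℝ} {v₀ : Torus d → Vec d}

namespace RegularSolution

variable (S : RegularSolution μ lam γ T al be ka el ϱ v D R ϱ₀ v₀)

include S

lemma mix_pressure_self : Mix T (γ * ka) (γ * el) (fun t x => ϱ t x ^ γ) := by
  have hγ := S.one_lt_gamma
  refine S.mix_pressure.of_le (mul_nonneg (by linarith) S.ka_pos.le)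
    ((Real.continuous_rpow_const (by linarith)).comp_aestronglyMeasurable S.sol.density_meas)
    fun t x => ?_
  exact (Real.abs_rpow_le_abs_rpow _ _).trans (le_abs_self _)

lemma mix_inertialStress (i j : Fin d) :
    Mix T (2 * al + ka) (2 * be + el) (inertialStress γ ϱ v i j) := by
  have hγ := S.one_lt_gamma
  have := S.al_pos
  have := S.be_pos
  have := S.ka_pos
  have := S.el_pos
  have := S.ka_lt_two
  have := S.el_lt_two
  have h1 := (S.mix_density_velocity i).mul (by linarith) (by linarith) S.al_pos S.be_pos
    (S.velocity j)
  rw [show ka + al + al = 2 * al + ka by ring, show el + be + be = 2 * be + el by ring] at h1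
  refine h1.add (by linarith) (by linarith) (by linarith) (by linarith) ?_
  split_ifs
  · exact S.mix_pressure_self.mono (mul_pos (by linarith) S.ka_pos)
      (mul_pos (by linarith) S.el_pos) (by linarith [S.ka_lt_gamma]) (by linarith [S.el_lt_gamma])
  · exact Mix.zero (by linarith)

lemma mix_viscousStress (i j : Fin d) : Mix T (1 / 2) (1 / 2) (viscousStress μ lam D i j) := by
  refine ((S.grad_two (i, j)).const_mul (by norm_num) (-μ)).add (by norm_num) (by norm_num)
    (by norm_num) (by norm_num) ?_
  split_ifs
  · exact (Mix.sum Finset.univ (by norm_num) (by norm_num) (by norm_num) (by norm_num)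
      fun i => S.grad_two (i, i)).const_mul (by norm_num) _
  · exact Mix.zero (by norm_num)

lemma intST_stress (i j : Fin d) :
    IntST T (fun t x => inertialStress γ ϱ v i j t x + viscousStress μ lam D i j t x) :=
  ((S.mix_inertialStress i j).integrable (by linarith [S.al_pos, S.ka_pos])
    (by linarith [S.ka_lt_two]) (by linarith [S.be_pos, S.el_pos])
    (by linarith [S.el_lt_two])).add
  ((S.mix_viscousStress i j).integrable (by norm_num) (by norm_num) (by norm_num) (by norm_num))

lemma intST_stress_grad (i : Fin d) {w : Torus d → ℝ} (hw : w ∈ trigPoly d) :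
    IntST T (fun t x => ∑ j, (inertialStress γ ϱ v i j t x + viscousStress μ lam D i j t x)
      * pderiv j w x) :=
  integrable_finsetSum _ fun j _ => (S.intST_stress i j).mul_trigPoly (pderiv_mem_trigPoly hw j)

lemma continuousOn_momentumPairing (i : Fin d) {w : Torus d → ℝ} (hw : w ∈ trigPoly d) :
    ContinuousOn (momentumPairing μ lam γ ϱ v D ϱ₀ v₀ i w) (Icc 0 T) :=
  continuousOn_const.add
    (continuousOn_primitive_Ioo S.time_pos.le (S.intST_stress_grad i hw).integrableOn)

lemma integrable_init_momentum (i : Fin d) : Integrable (fun x => ϱ₀ x * v₀ x i) :=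
  integrable_momentum S.integrable_init_density S.sol.init_velocity_meas S.init_energy_parts.2 i

lemma momentumPairing_add (i : Fin d) {w₁ w₂ : Torus d → ℝ} (h₁ : w₁ ∈ trigPoly d)
    (h₂ : w₂ ∈ trigPoly d) {t : ℝ} (ht : t ∈ Icc 0 T) :
    momentumPairing μ lam γ ϱ v D ϱ₀ v₀ i (fun x => w₁ x + w₂ x) t
      = momentumPairing μ lam γ ϱ v D ϱ₀ v₀ i w₁ t
        + momentumPairing μ lam γ ϱ v D ϱ₀ v₀ i w₂ t := by
  have i1 := S.intST_stress_grad i h₁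
  have i2 := S.intST_stress_grad i h₂
  have i3 := S.intST_stress_grad i (w := fun x => w₁ x + w₂ x) (add_mem h₁ h₂)
  unfold momentumPairing
  rw [i1.intervalIntegral_eq ht, i2.intervalIntegral_eq ht, i3.intervalIntegral_eq ht]
  simp_rw [pderiv_add h₁ h₂, mul_add, Finset.sum_add_distrib]
  rw [integral_add (i1.mono ht.2) (i2.mono ht.2),
    integral_add (integrable_mul_of_mem_trigPoly (S.integrable_init_momentum i) h₁)
      (integrable_mul_of_mem_trigPoly (S.integrable_init_momentum i) h₂)]
  ring

omit S in
lemma momentumPairing_smul (i : Fin d) (c : ℝ) (w : Torus d → ℝ) (t : ℝ) :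
    momentumPairing μ lam γ ϱ v D ϱ₀ v₀ i (fun x => c * w x) t
      = c * momentumPairing μ lam γ ϱ v D ϱ₀ v₀ i w t := by
  unfold momentumPairing
  simp_rw [pderiv_const_mul, mul_left_comm _ c, ← Finset.mul_sum, integral_const_mul,
    intervalIntegral.integral_const_mul]
  ring

lemma intST_density_velocity' (i : Fin d) {w : Torus d → ℝ} (hw : w ∈ trigPoly d) :
    IntST T (fun t x => ϱ t x * v t x i * w x) :=
  (S.intST_density_velocity i).mul_trigPoly hw

/-- The momentum equation, integrated in time and tested with functions of space alone. -/
lemma ae_momentum_eq : ∀ᵐ t ∂(volume.restrict (Ioo 0 T)), ∀ w ∈ trigPoly d, ∀ i,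
    ∫ x, ϱ t x * v t x i * w x = momentumPairing μ lam γ ϱ v D ϱ₀ v₀ i w t := by
  have hI : ∀ᵐ t ∂(volume.restrict (Ioo 0 T)), t ∈ Icc 0 T := by
    filter_upwards [ae_restrict_mem measurableSet_Ioo] with t ht using ⟨ht.1.le, ht.2.le⟩
  refine ae_forall_trigPoly (fun w hw => ae_all_iff.2 fun i => ?_) ?_ ?_
  · refine ae_integral_eq_primitive_init S.time_pos (S.intST_density_velocity' i hw)
      (S.intST_stress_grad i hw) ?_
    rintro χ hχ ⟨b, hb, hχb⟩
    have h3 := S.sol.momentum i (fun t x => χ t * w x) ⟨isSmooth_mul hχ hw, b, hb,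
      fun t ht x => by simp only [hχb t ht, zero_mul]⟩
    refine Eq.trans ?_ h3
    congr 1
    · refine integral_congr_ae (ae_of_all _ fun z => ?_)
      simp only [pderiv_const_mul, deriv_mul_const_field, inertialStress, viscousStress, add_mul,
        Finset.sum_add_distrib, ite_mul, zero_mul, Finset.sum_ite_eq, Finset.mem_univ, if_true,
        Finset.sum_mul, Finset.mul_sum]
      have e1 : ∀ j, ϱ z.1 z.2 * v z.1 z.2 i * v z.1 z.2 j * (χ z.1 * pderiv j w z.2)
        = ϱ z.1 z.2 * v z.1 z.2 i * v z.1 z.2 j * pderiv j w z.2 * χ z.1 := fun j => by ring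
      have e2 : ∀ j, μ * (D z.1 z.2 (i, j) * (χ z.1 * pderiv j w z.2))
        = -(-μ * D z.1 z.2 (i, j) * pderiv j w z.2 * χ z.1) := fun j => by ring
      simp only [e1, e2, Finset.sum_neg_distrib]
      ring
    · rw [← integral_mul_const]
      congr 1; ext x; ring
  · filter_upwards [hI, ae_all_iff.2 fun i => (S.intST_density_velocity i).slice] with t ht hi
      w₁ hw₁ w₂ hw₂ h₁ h₂ i
    simp_rw [mul_add]
    rw [integral_add (integrable_mul_of_mem_trigPoly (hi i) hw₁)
      (integrable_mul_of_mem_trigPoly (hi i) hw₂), h₁, h₂, S.momentumPairing_add i hw₁ hw₂ ht]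
  · refine ae_of_all _ fun t c w hw h i => ?_
    simp_rw [mul_left_comm _ c]
    rw [integral_const_mul, h, momentumPairing_smul]

lemma ae_kinetic_bound : ∃ K : ℝ≥0∞, K ≠ ∞ ∧ ∀ᵐ t ∂(volume.restrict (Ioo 0 T)),
    ∫⁻ x, ‖ϱ t x * ‖v t x‖ ^ 2‖ₑ ≤ K := by
  have h := S.sol.kinetic_bound.2
  rw [eLpNorm_exponent_top] at h
  refine ⟨_, h.ne, ?_⟩
  filter_upwards [enorm_ae_le_eLpNormEssSup (fun t => eLpNorm (fun x => ϱ t x * ‖v t x‖ ^ 2) 1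
    (volume : Measure (Torus d))) (volume.restrict (Ioo 0 T))] with t ht
  simp only [enorm_eq_self] at ht
  rw [eLpNorm_one_eq_lintegral_enorm] at ht
  simpa only [eLpNorm_one_eq_lintegral_enorm] using ht

lemma aesm_velocity :
    ∀ᵐ t ∂(volume.restrict (Ioo 0 T)), AEStronglyMeasurable (v t) volume := by
  filter_upwards [ae_all_iff.2 fun i => (S.velocity i).meas.prodMk_left] with t ht
  have h1 : AEMeasurable (fun x => (WithLp.ofLp (v t x) : Fin d → ℝ)) volume :=
    aemeasurable_pi_lambda _ fun i => (ht i).aemeasurable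
  have h2 := (PiLp.continuous_toLp 2 (fun _ : Fin d => ℝ)).comp_aestronglyMeasurable
    h1.aestronglyMeasurable
  exact h2

lemma ae_integrable_kinetic : ∀ᵐ t ∂(volume.restrict (Ioo 0 T)),
    Integrable (fun x => ϱ t x * ‖v t x‖ ^ 2) := by
  obtain ⟨K, hK, h⟩ := S.ae_kinetic_bound
  filter_upwards [h, S.sol.kinetic_bound.1.prodMk_left] with t h1 h2
  exact ⟨h2, h1.trans_lt hK.lt_top⟩

end RegularSolution

end

/-! ### Weak limits of the momentum -/

lemma norm_sq_eq_integral {f : Lp (Vec d) 2 (volume : Measure (Torus d))} {g : Torus d → Vec d}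
    (h : f =ᵐ[volume] g) : ‖f‖ ^ 2 = ∫ x, ‖g x‖ ^ 2 := by
  rw [← real_inner_self_eq_norm_sq, L2.inner_def]
  refine integral_congr_ae (h.mono fun x hx => ?_)
  simp only [hx, real_inner_self_eq_norm_sq]

lemma norm_sqrt_smul_sq {a : ℝ} (ha : 0 ≤ a) (u : Vec d) : ‖√a • u‖ ^ 2 = a * ‖u‖ ^ 2 := by
  rw [norm_smul, mul_pow, Real.norm_of_nonneg (Real.sqrt_nonneg _), Real.sq_sqrt ha]

lemma aesm_coord {u : Torus d → Vec d} (hu : AEStronglyMeasurable u volume) (i : Fin d) :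
    AEStronglyMeasurable (fun x => u x i) volume :=
  (EuclideanSpace.proj i : Vec d →L[ℝ] ℝ).continuous.comp_aestronglyMeasurable hu

lemma continuous_single (i : Fin d) : Continuous fun a : ℝ => (EuclideanSpace.single i a : Vec d) :=
  (Isometry.of_dist_eq fun a b => by simp).continuous

lemma memLp_sqrt {r : Torus d → ℝ} (hr : Integrable r) :
    MemLp (fun x => √(r x)) 2 volume := by
  have hm : AEStronglyMeasurable (fun x => √(r x)) volume :=
    Real.continuous_sqrt.comp_aestronglyMeasurable hr.aestronglyMeasurable
  rw [memLp_two_iff_integrable_sq hm]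
  refine hr.norm.mono (hm.pow 2) (ae_of_all _ fun x => ?_)
  rw [norm_norm, Real.norm_eq_abs, Real.norm_eq_abs, abs_pow, abs_of_nonneg (Real.sqrt_nonneg _)]
  rcases le_total 0 (r x) with h | h
  · rw [Real.sq_sqrt h]; exact le_abs_self _
  · rw [Real.sqrt_eq_zero_of_nonpos h]; simp

lemma abs_sqrt_sub_sq_le {a b : ℝ} (ha : 0 ≤ a) (hb : 0 ≤ b) : |√a - √b| ^ 2 ≤ |a - b| := by
  have h1 : |a - b| = |√a - √b| * (√a + √b) := by
    rw [← abs_of_nonneg (a := √a + √b) (by positivity), ← abs_mul]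
    congr 1
    nlinarith [Real.mul_self_sqrt ha, Real.mul_self_sqrt hb]
  have h2 : |√a - √b| ≤ √a + √b := by
    have := Real.sqrt_nonneg a
    have := Real.sqrt_nonneg b
    rw [abs_le]; constructor <;> linarith
  rw [h1, sq]
  exact mul_le_mul_of_nonneg_left h2 (abs_nonneg _)

section

variable {μ lam γ al be ka el : ℝ} {ϱ : ℝ → Torus d → ℝ}
  {v : ℝ → Torus d → Vec d} {D : ℝ → Torus d → Mat d} {R : ℝ → Torus d → Vec d}
  {ϱ₀ : Torus d → ℝ} {v₀ : Torus d → Vec d}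

namespace RegularSolution

variable (S : RegularSolution μ lam γ T al be ka el ϱ v D R ϱ₀ v₀)

include S

lemma ae_memLp_root : ∀ᵐ s ∂(volume.restrict (Ioo 0 T)),
    MemLp (fun x => √(ϱ s x) • v s x) 2 volume := by
  filter_upwards [S.ae_integrable_kinetic, S.ae_nonneg, S.aesm_velocity,
    S.sol.density_meas.prodMk_left] with s h1 h2 h3 h4
  have hm : AEStronglyMeasurable (fun x => √(ϱ s x) • v s x) volume :=
    (Real.continuous_sqrt.comp_aestronglyMeasurable h4).smul h3
  rw [memLp_two_iff_integrable_sq_norm hm]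
  exact h1.congr (h2.mono fun x hx => (norm_sqrt_smul_sq hx _).symm)

/-- Replacing `√ϱ(s)` by its limit in the momentum: the error is controlled by Hölder's inequality
and `|√a - √b|² ≤ |a - b|`. -/
lemma exists_sqrt_error {w : Torus d → ℝ} (hw : w ∈ trigPoly d) : ∃ M : ℝ≥0∞, M ≠ ∞ ∧
    ∀ t₀ ∈ Icc 0 T, ∀ i, ∀ᵐ s ∂(volume.restrict (Ioo 0 T)),
      ‖∫ x, (√(ϱ s x) - √(rep ϱ₀ ϱ v D R t₀ x)) * (√(ϱ s x) * v s x i * w x)‖ₑ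
        ≤ (∫⁻ x, ‖rep ϱ₀ ϱ v D R s x - rep ϱ₀ ϱ v D R t₀ x‖ₑ) ^ (1 / 2 : ℝ) * M := by
  obtain ⟨K, hK, hKb⟩ := S.ae_kinetic_bound
  obtain ⟨C, hC0, hC⟩ := exists_bound_of_mem_trigPoly hw
  refine ⟨(ENNReal.ofReal (C ^ 2) * K) ^ (1 / 2 : ℝ), ENNReal.rpow_ne_top_of_nonneg (by norm_num)
    (ENNReal.mul_ne_top ENNReal.ofReal_ne_top hK), fun t₀ ht₀ i => ?_⟩
  filter_upwards [hKb, S.ae_nonneg, S.aesm_velocity, S.sol.density_meas.prodMk_left,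
    S.ae_density_eq] with s h1 h2 h3 h4 h5
  have h6 := S.rep_nonneg ht₀
  have m1 : AEStronglyMeasurable (fun x => √(ϱ s x)) volume :=
    Real.continuous_sqrt.comp_aestronglyMeasurable h4
  have m2 : AEStronglyMeasurable (fun x => √(rep ϱ₀ ϱ v D R t₀ x)) volume :=
    Real.continuous_sqrt.comp_aestronglyMeasurable (S.integrable_rep ht₀).aestronglyMeasurable
  have m3 := (m1.mul (aesm_coord h3 i)).mul
    (continuous_of_mem_trigPoly hw).aestronglyMeasurable
  have e := eLpNorm_mul_le (a := 1 / 2) (b := 1 / 2) (by norm_num) (by norm_num) (m1.sub m2) m3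
  rw [add_halves, pe_one, eLpNorm_one_eq_lintegral_enorm, eLpNorm_eq_lintegral (by norm_num),
    eLpNorm_eq_lintegral (by norm_num)] at e
  refine (enorm_integral_le_lintegral_enorm _).trans (e.trans ?_)
  refine mul_le_mul' (ENNReal.rpow_le_rpow ?_ (by norm_num))
    (ENNReal.rpow_le_rpow ?_ (by norm_num))
  · refine lintegral_mono_ae ?_
    filter_upwards [h2, h5, h6] with x h2 h5 h6
    rw [h5] at h2
    rw [Pi.sub_apply, ← ofReal_norm, ← ofReal_norm, ENNReal.ofReal_rpow_of_nonneg (norm_nonneg _)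
      (by norm_num), h5]
    refine ENNReal.ofReal_le_ofReal ?_
    norm_num
    rw [← sq_abs]
    exact abs_sqrt_sub_sq_le h2 h6
  · refine le_trans (lintegral_mono_ae (g := fun x =>
      ENNReal.ofReal (C ^ 2) * ‖ϱ s x * ‖v s x‖ ^ 2‖ₑ) ?_) ?_
    · filter_upwards [h2] with x hx
      rw [Pi.mul_apply, Pi.mul_apply, ← ofReal_norm, ← ofReal_norm,
        ENNReal.ofReal_rpow_of_nonneg (norm_nonneg _) (by norm_num),
        ← ENNReal.ofReal_mul (by positivity)]
      refine ENNReal.ofReal_le_ofReal ?_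
      have h7 : |v s x i| ≤ ‖v s x‖ := PiLp.norm_apply_le (v s x) i
      have h8 := hC x
      norm_num
      rw [mul_pow, mul_pow, sq_abs √(ϱ s x), Real.sq_sqrt hx, abs_of_nonneg hx]
      have h9 : |v s x i| ^ 2 ≤ ‖v s x‖ ^ 2 := by gcongr
      have h10 : |w x| ^ 2 ≤ C ^ 2 := by gcongr
      calc ϱ s x * |v s x i| ^ 2 * |w x| ^ 2 ≤ ϱ s x * ‖v s x‖ ^ 2 * C ^ 2 := by gcongr
        _ = _ := by ring
    · rw [lintegral_const_mul' _ _ ENNReal.ofReal_ne_top]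
      gcongr

/-- At every time the momentum is `√ϱ` times a weak limit of `√ϱ v`; this gives the momentum a
density even where vacuum forms, and makes the kinetic energy lower semicontinuous. -/
lemma exists_momentum_root {t₀ : ℝ} (ht₀ : t₀ ∈ Icc 0 T) :
    ∃ z : Torus d → Vec d, MemLp z 2 volume ∧
      (∀ i, ∀ w ∈ trigPoly d, ∫ x, √(rep ϱ₀ ϱ v D R t₀ x) * z x i * w x
        = momentumPairing μ lam γ ϱ v D ϱ₀ v₀ i w t₀) ∧
      ∀ c, (∀ᶠ s in nearTime T t₀, ∫ x, ϱ s x * ‖v s x‖ ^ 2 ≤ c) → ∫ x, ‖z x‖ ^ 2 ≤ c := by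
  classical
  obtain ⟨K, hK, hKb⟩ := S.ae_kinetic_bound
  have hne := nearTime_neBot S.time_pos ht₀
  let Z : ℝ → Lp (Vec d) 2 (volume : Measure (Torus d)) := fun s =>
    if h : MemLp (fun x => √(ϱ s x) • v s x) 2 volume then h.toLp _ else 0
  have hZ : ∀ᵐ s ∂(volume.restrict (Ioo 0 T)), Z s =ᵐ[volume] fun x => √(ϱ s x) • v s x := by
    filter_upwards [S.ae_memLp_root] with s hs
    simp only [Z, dif_pos hs]
    exact hs.coeFn_toLp
  have hZn : ∀ᵐ s ∂(volume.restrict (Ioo 0 T)), ‖Z s‖ ^ 2 = ∫ x, ϱ s x * ‖v s x‖ ^ 2 := by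
    filter_upwards [hZ, S.ae_nonneg] with s h1 h2
    rw [norm_sq_eq_integral h1]
    exact integral_congr_ae (h2.mono fun x hx => norm_sqrt_smul_sq hx _)
  have hZK : ∀ᵐ s ∂(volume.restrict (Ioo 0 T)), ‖Z s‖ ≤ √K.toReal := by
    filter_upwards [hZn, hKb] with s h1 h2
    refine Real.le_sqrt_of_sq_le ?_
    rw [h1]
    refine (le_abs_self _).trans ?_
    rw [← Real.norm_eq_abs, ← toReal_enorm]
    exact ENNReal.toReal_mono hK ((enorm_integral_le_lintegral_enorm _).trans h2)
  let U := Ultrafilter.of (nearTime T t₀)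
  have hU : ↑U ≤ nearTime T t₀ := Ultrafilter.of_le _
  obtain ⟨z, hz⟩ := exists_weak_limit U (hU (eventually_nearTime hZK t₀))
  refine ⟨z, Lp.memLp z, fun i w hw => ?_, fun c hc => ?_⟩
  · obtain ⟨C, hC0, hC⟩ := exists_bound_of_mem_trigPoly hw
    have hrw : MemLp (fun x => √(rep ϱ₀ ϱ v D R t₀ x) * w x) 2 volume :=
      (memLp_sqrt (S.integrable_rep ht₀)).of_le_mul (c := C)
        ((memLp_sqrt (S.integrable_rep ht₀)).1.mul
          (continuous_of_mem_trigPoly hw).aestronglyMeasurable) (ae_of_all _ fun x => by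
            rw [norm_mul, mul_comm]
            exact mul_le_mul_of_nonneg_right (hC x) (norm_nonneg _))
    have hy : MemLp (fun x => EuclideanSpace.single i (√(rep ϱ₀ ϱ v D R t₀ x) * w x)) 2
        (volume : Measure (Torus d)) := by
      refine hrw.of_le ?_ (ae_of_all _ fun x => by simp)
      exact (continuous_single i).comp_aestronglyMeasurable hrw.1
    have hinner : ∀ {f : Lp (Vec d) 2 (volume : Measure (Torus d))} {g : Torus d → Vec d},
        f =ᵐ[volume] g → inner ℝ f (hy.toLp _)
          = ∫ x, √(rep ϱ₀ ϱ v D R t₀ x) * g x i * w x := by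
      intro f g hfg
      rw [L2.inner_def]
      refine integral_congr_ae ?_
      filter_upwards [hfg, hy.coeFn_toLp] with x h1 h2
      rw [h1, h2, EuclideanSpace.inner_single_right]
      simp only [conj_trivial]; ring
    have l1 := hz (hy.toLp _)
    rw [hinner (EventuallyEq.refl _ _)] at l1
    have l2 : Tendsto (momentumPairing μ lam γ ϱ v D ϱ₀ v₀ i w) U
        (𝓝 (momentumPairing μ lam γ ϱ v D ϱ₀ v₀ i w t₀)) :=
      (S.continuousOn_momentumPairing i hw t₀ ht₀).mono_left (hU.trans (nearTime_le T t₀))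
    obtain ⟨M, hM, hMb⟩ := S.exists_sqrt_error hw
    have l3 : Tendsto (fun s => ∫ x, (√(ϱ s x) - √(rep ϱ₀ ϱ v D R t₀ x))
        * (√(ϱ s x) * v s x i * w x)) U (𝓝 0) := by
      rw [tendsto_zero_iff_enorm_tendsto_zero]
      have h1 := ENNReal.Tendsto.mul_const ((ENNReal.continuous_rpow_const
        (y := 1 / 2)).tendsto 0 |>.comp ((S.tendsto_rep ht₀).mono_left
          (hU.trans (nearTime_le T t₀)))) (Or.inr hM)
      rw [ENNReal.zero_rpow_of_pos (by norm_num), zero_mul] at h1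
      exact tendsto_of_tendsto_of_tendsto_of_le_of_le' tendsto_const_nhds h1
        (Eventually.of_forall fun _ => zero_le)
        (hU (eventually_nearTime (hMb t₀ ht₀ i) t₀))
    refine tendsto_nhds_unique l1 ((l2.sub l3).congr' ?_ |>.trans (by rw [sub_zero]))
    have hev : ∀ᵐ s ∂(volume.restrict (Ioo 0 T)),
        momentumPairing μ lam γ ϱ v D ϱ₀ v₀ i w s
          - (∫ x, (√(ϱ s x) - √(rep ϱ₀ ϱ v D R t₀ x)) * (√(ϱ s x) * v s x i * w x))
        = inner ℝ (Z s) (hy.toLp _) := by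
      filter_upwards [hZ, S.ae_momentum_eq, S.ae_nonneg, S.ae_memLp_root,
        (S.intST_density_velocity i).slice] with s h1 h2 h3 h4 h5
      rw [hinner h1, ← h2 w hw i]
      have h6 : MemLp (fun x => √(ϱ s x) * v s x i) 2 volume :=
        h4.of_le (aesm_coord h4.1 i) (ae_of_all _ fun x => PiLp.norm_apply_le (√(ϱ s x) • v s x) i)
      have i1 : Integrable (fun x => √(rep ϱ₀ ϱ v D R t₀ x) * w x * (√(ϱ s x) * v s x i)) :=
        hrw.integrable_mul h6
      have i2 := integrable_mul_of_mem_trigPoly h5 hw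
      have e1 : ∫ x, (√(ϱ s x) - √(rep ϱ₀ ϱ v D R t₀ x)) * (√(ϱ s x) * v s x i * w x)
          = (∫ x, ϱ s x * v s x i * w x)
            - ∫ x, √(rep ϱ₀ ϱ v D R t₀ x) * w x * (√(ϱ s x) * v s x i) := by
        rw [← integral_sub i2 i1]
        refine integral_congr_ae (h3.mono fun x hx => ?_)
        have := Real.mul_self_sqrt hx
        simp only
        linear_combination (v s x i * w x) * this
      rw [e1, sub_sub_cancel]
      refine integral_congr_ae (ae_of_all _ fun x => ?_)
      simp only [PiLp.smul_apply, smul_eq_mul]; ring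
    exact hU (eventually_nearTime hev t₀)
  · rw [← norm_sq_eq_integral (EventuallyEq.refl _ (z : Torus d → Vec d))]
    refine norm_sq_le_of_weak_limit hz ?_
    filter_upwards [hU hc, hU (eventually_nearTime hZn t₀)] with s h1 h2
    rw [h2]; exact h1

end RegularSolution

end

/-! ### Velocities at every time -/

/-- `u` is a velocity at time `t`: its product with the density is the momentum given by the
momentum equation. -/
structure IsVelocityAt (μ lam γ : ℝ) (ϱ : ℝ → Torus d → ℝ) (v : ℝ → Torus d → Vec d)
    (D : ℝ → Torus d → Mat d) (R : ℝ → Torus d → Vec d) (ϱ₀ : Torus d → ℝ)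
    (v₀ : Torus d → Vec d) (t : ℝ) (u : Torus d → Vec d) : Prop where
  meas : AEStronglyMeasurable u volume
  integrable : ∀ i, Integrable (fun x => rep ϱ₀ ϱ v D R t x * u x i)
  pairing : ∀ i, ∀ w ∈ trigPoly d, ∫ x, rep ϱ₀ ϱ v D R t x * u x i * w x
    = momentumPairing μ lam γ ϱ v D ϱ₀ v₀ i w t

section

variable {μ lam γ al be ka el : ℝ} {ϱ : ℝ → Torus d → ℝ}
  {v : ℝ → Torus d → Vec d} {D : ℝ → Torus d → Mat d} {R : ℝ → Torus d → Vec d}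
  {ϱ₀ : Torus d → ℝ} {v₀ : Torus d → Vec d}

namespace RegularSolution

variable (S : RegularSolution μ lam γ T al be ka el ϱ v D R ϱ₀ v₀)

include S

lemma ae_isVelocityAt : ∀ᵐ t ∂(volume.restrict (Ioo 0 T)),
    IsVelocityAt μ lam γ ϱ v D R ϱ₀ v₀ t (v t) := by
  filter_upwards [S.ae_momentum_eq, S.ae_density_eq, S.aesm_velocity,
    ae_all_iff.2 fun i => (S.intST_density_velocity i).slice] with t h1 h2 h3 h4
  refine ⟨h3, fun i => (h4 i).congr (h2.mono fun x hx => by simp only [hx]), fun i w hw => ?_⟩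
  rw [← h1 w hw i]
  exact integral_congr_ae (h2.mono fun x hx => by simp only [hx])

lemma isVelocityAt_zero : IsVelocityAt μ lam γ ϱ v D R ϱ₀ v₀ 0 v₀ := by
  refine ⟨S.sol.init_velocity_meas, fun i => ?_, fun i w hw => ?_⟩
  · rw [rep_zero]; exact S.integrable_init_momentum i
  · rw [rep_zero, momentumPairing, intervalIntegral.integral_same, add_zero]

lemma integrable_sqrt_mul {t : ℝ} (ht : t ∈ Icc 0 T) {z : Torus d → Vec d}
    (hz : MemLp z 2 volume) (i : Fin d) :
    Integrable (fun x => √(rep ϱ₀ ϱ v D R t x) * z x i) :=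
  (memLp_sqrt (S.integrable_rep ht)).integrable_mul
    (hz.of_le (aesm_coord hz.1 i) (ae_of_all _ fun x => PiLp.norm_apply_le (z x) i))

lemma exists_isVelocityAt {t : ℝ} (ht : t ∈ Icc 0 T) :
    ∃ u, IsVelocityAt μ lam γ ϱ v D R ϱ₀ v₀ t u := by
  obtain ⟨z, hz, hzw, -⟩ := S.exists_momentum_root ht
  have h0 := S.rep_nonneg ht
  have e : ∀ i, (fun x => rep ϱ₀ ϱ v D R t x * ((√(rep ϱ₀ ϱ v D R t x))⁻¹ • z x) i)
      =ᵐ[volume] fun x => √(rep ϱ₀ ϱ v D R t x) * z x i := by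
    intro i
    filter_upwards [h0] with x hx
    rw [PiLp.smul_apply, smul_eq_mul]
    rcases hx.eq_or_lt with h | h
    · rw [← h]; simp
    · have h1 := Real.mul_self_sqrt hx
      have h2 := (Real.sqrt_pos.2 h).ne'
      nth_rewrite 1 [← h1]
      field_simp
  refine ⟨fun x => (√(rep ϱ₀ ϱ v D R t x))⁻¹ • z x, ?_, fun i => ?_, fun i w hw => ?_⟩
  · exact ((Real.continuous_sqrt.comp_aestronglyMeasurable
      (S.integrable_rep ht).aestronglyMeasurable).aemeasurable.inv.aestronglyMeasurable).smul hz.1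
  · exact (S.integrable_sqrt_mul ht hz i).congr (e i).symm
  · rw [← hzw i w hw]
    exact integral_congr_ae ((e i).mono fun x hx => by simp only [hx])

/-- The kinetic energy is lower semicontinuous in time. -/
lemma kinetic_of_isVelocityAt {t : ℝ} (ht : t ∈ Icc 0 T) {u : Torus d → Vec d}
    (hu : IsVelocityAt μ lam γ ϱ v D R ϱ₀ v₀ t u) :
    Integrable (fun x => rep ϱ₀ ϱ v D R t x * ‖u x‖ ^ 2) ∧
    ∀ c, (∀ᶠ s in nearTime T t, ∫ x, ϱ s x * ‖v s x‖ ^ 2 ≤ c) →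
      ∫ x, rep ϱ₀ ϱ v D R t x * ‖u x‖ ^ 2 ≤ c := by
  obtain ⟨z, hz, hzw, hzc⟩ := S.exists_momentum_root ht
  have h0 := S.rep_nonneg ht
  have h1 : ∀ᵐ x, ∀ i, rep ϱ₀ ϱ v D R t x * u x i - √(rep ϱ₀ ϱ v D R t x) * z x i = 0 := by
    refine ae_all_iff.2 fun i => ?_
    refine ae_eq_zero_of_integral_trigPoly ((hu.integrable i).sub (S.integrable_sqrt_mul ht hz i))
      fun w hw => ?_
    simp_rw [sub_mul]
    rw [integral_sub (integrable_mul_of_mem_trigPoly (hu.integrable i) hw)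
      (integrable_mul_of_mem_trigPoly (S.integrable_sqrt_mul ht hz i) hw), hu.pairing i w hw,
      hzw i w hw, sub_self]
  have h2 : ∀ᵐ x, rep ϱ₀ ϱ v D R t x * ‖u x‖ ^ 2 ≤ ‖z x‖ ^ 2 := by
    filter_upwards [h0, h1] with x hx h1
    rcases hx.eq_or_lt with h | h
    · rw [← h, zero_mul]; positivity
    · have h3 : z x = √(rep ϱ₀ ϱ v D R t x) • u x := by
        ext i
        have h4 := h1 i
        have h5 := Real.mul_self_sqrt hx
        have h6 := Real.sqrt_pos.2 h
        rw [PiLp.smul_apply, smul_eq_mul]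
        refine mul_left_cancel₀ h6.ne' ?_
        linear_combination -h4 - u x i * h5
      rw [h3, norm_sqrt_smul_sq hx]
  have hm : AEStronglyMeasurable (fun x => rep ϱ₀ ϱ v D R t x * ‖u x‖ ^ 2) volume :=
    (S.integrable_rep ht).aestronglyMeasurable.mul (hu.meas.norm.pow 2)
  have hzi : Integrable (fun x => ‖z x‖ ^ 2) := (memLp_two_iff_integrable_sq_norm hz.1).1 hz
  have hi : Integrable (fun x => rep ϱ₀ ϱ v D R t x * ‖u x‖ ^ 2) := by
    refine hzi.mono' hm ?_
    filter_upwards [h0, h2] with x h0 h2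
    rwa [Real.norm_of_nonneg (by positivity)]
  exact ⟨hi, fun c hc => (integral_mono_ae hi hzi h2).trans (hzc c hc)⟩

/-- A representative of the velocity which is a velocity at every time. -/
lemma exists_velocity_rep : ∃ u : ℝ → Torus d → Vec d,
    (∀ t ∈ Icc 0 T, IsVelocityAt μ lam γ ϱ v D R ϱ₀ v₀ t (u t)) ∧
    (∀ᵐ t ∂(volume.restrict (Ioo 0 T)), u t = v t) ∧ u 0 = v₀ := by
  classical
  choose! u' hu' using fun t (ht : t ∈ Icc 0 T) => S.exists_isVelocityAt ht
  refine ⟨fun t => if t = 0 then v₀ else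
    if IsVelocityAt μ lam γ ϱ v D R ϱ₀ v₀ t (v t) then v t else u' t, fun t ht => ?_, ?_, by simp⟩
  · dsimp only
    split_ifs with h1 h2
    · rw [h1]; exact S.isVelocityAt_zero
    · exact h2
    · exact hu' t ht
  · filter_upwards [S.ae_isVelocityAt, ae_restrict_mem measurableSet_Ioo] with t h1 h2
    rw [if_neg h2.1.ne', if_pos h1]

end RegularSolution

end

/-! ### Pairings with time slices -/

lemma Mix.of_memLp {a b : ℝ} (ha : 0 < a) {g : Torus d → ℝ} (hg : MemLp g (pe b) volume) :
    Mix T a b (fun _ => g) :=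
  ⟨hg.1.comp_snd, nrm_const_lt_top ha hg.2.ne⟩

lemma Mix.intST_mul {a b : ℝ} (ha : 0 < a) (ha1 : a < 1) (hb : 0 < b) (hb1 : b < 1)
    {F : ℝ → Torus d → ℝ} (hF : Mix T a b F) {g : Torus d → ℝ}
    (hg : MemLp g (pe (1 - b)) volume) : IntST T (fun t x => F t x * g x) := by
  have h := hF.mul ha hb (sub_pos.2 ha1) (sub_pos.2 hb1) (Mix.of_memLp (sub_pos.2 ha1) hg)
  rw [add_sub_cancel, add_sub_cancel] at h
  exact h.integrable one_pos le_rfl one_pos le_rfl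

lemma enorm_intervalIntegral_le {f : ℝ → ℝ} {s t : ℝ} :
    ‖∫ τ in s..t, f τ‖ₑ ≤ ∫⁻ τ in uIoc s t, ‖f τ‖ₑ := by
  rw [← ofReal_norm, intervalIntegral.norm_intervalIntegral_eq, ofReal_norm]
  exact enorm_integral_le_lintegral_enorm _

lemma restrict_uIoc_le {s t : ℝ} (hs : s ∈ Icc 0 T) (ht : t ∈ Icc 0 T) :
    (volume : Measure ℝ).restrict (uIoc s t) ≤ volume.restrict (Ioo 0 T) := by
  rw [Measure.restrict_congr_set (Ioo_ae_eq_Ioc (a := (0 : ℝ)) (b := T))]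
  refine Measure.restrict_mono (fun x hx => ?_) le_rfl
  rw [mem_uIoc] at hx
  rcases hx with hx | hx
  · exact ⟨hs.1.trans_lt hx.1, hx.2.trans ht.2⟩
  · exact ⟨ht.1.trans_lt hx.1, hx.2.trans hs.2⟩

/-- Passage to the limit in the test function of a pairing integrated in time. -/
lemma Mix.tendsto_pairing {a b : ℝ} (ha : 0 < a) (ha1 : a < 1) (hb : 0 < b) (hb1 : b < 1)
    {F : ℝ → Torus d → ℝ} (hF : Mix T a b F) {G : ℕ → Torus d → ℝ} {g : Torus d → ℝ}
    (hG : LConv (1 - b) G g) {s t : ℝ} (hs : s ∈ Icc 0 T) (ht : t ∈ Icc 0 T) :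
    Tendsto (fun N => ∫ τ in s..t, ∫ x, F τ x * G N x) atTop
      (𝓝 (∫ τ in s..t, ∫ x, F τ x * g x)) := by
  have i0 := hF.intST_mul ha ha1 hb hb1 hG.lim_mem
  have iN := fun N => hF.intST_mul ha ha1 hb hb1 (hG.mem N)
  rw [← tendsto_sub_nhds_zero_iff, tendsto_zero_iff_enorm_tendsto_zero]
  have h1 := ENNReal.Tendsto.const_mul (a := ∫⁻ τ in Ioo 0 T, eLpNorm (F τ) (pe b) volume)
    hG.tendsto (Or.inr (hF.lintegral_lt_top ha ha1.le hb).ne)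
  rw [mul_zero] at h1
  refine tendsto_of_tendsto_of_tendsto_of_le_of_le tendsto_const_nhds h1
    (fun _ => zero_le) fun N => ?_
  have hGm := (hG.mem N).1.sub hG.lim_mem.1
  dsimp only
  rw [← intervalIntegral.integral_sub (intervalIntegrable_of_Ioo (iN N).integrableOn hs ht)
    (intervalIntegrable_of_Ioo i0.integrableOn hs ht)]
  refine enorm_intervalIntegral_le.trans
    ((lintegral_mono' (restrict_uIoc_le hs ht) le_rfl).trans ?_)
  rw [← lintegral_mul_const'' _ (hF.aemeasurable hb)]
  refine lintegral_mono_ae ?_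
  filter_upwards [i0.slice, (iN N).slice, hF.meas.prodMk_left] with τ h2 h3 h4
  rw [← integral_sub h3 h2]
  refine (enorm_integral_le_lintegral_enorm _).trans ?_
  have h5 := eLpNorm_mul_le hb.le (sub_pos.2 hb1).le h4 hGm
  rw [add_sub_cancel, pe_one, eLpNorm_one_eq_lintegral_enorm] at h5
  refine le_trans (le_of_eq (lintegral_congr fun x => ?_)) h5
  rw [Pi.sub_apply]; congr 1; ring

/-- Freezing the first factor of a pairing at time `s`. -/
lemma Mix.enorm_sub_le_timeOsc {F G : ℝ → Torus d → ℝ} {s t h : ℝ} (hs : s ∈ Icc 0 T)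
    (ht : t ∈ Icc 0 T) (hst : |t - s| ≤ h) (i0 : Integrable (fun x => F s x * G s x))
    (i1 : IntST T (fun τ x => F τ x * G s x)) :
    ‖(t - s) * (∫ x, F s x * G s x) - ∫ τ in s..t, ∫ x, F τ x * G s x‖ₑ
      ≤ timeOsc T F G h s := by
  have e : (t - s) * (∫ x, F s x * G s x) = ∫ _ in s..t, ∫ x, F s x * G s x := by simp
  rw [e, ← intervalIntegral.integral_sub (by simp)
    (intervalIntegrable_of_Ioo i1.integrableOn hs ht)]
  refine enorm_intervalIntegral_le.trans ?_
  have hle : (volume : Measure ℝ).restrict (uIoc s t)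
      ≤ volume.restrict (Ioo 0 T ∩ Icc (s - h) (s + h)) := by
    have h1 : uIoc s t ⊆ Icc (s - h) (s + h) := by
      intro τ hτ
      have h2 := abs_le.1 hst
      rw [mem_uIoc] at hτ
      rcases hτ with hτ | hτ <;> constructor <;> linarith
    have h3 := Measure.restrict_mono_measure (restrict_uIoc_le hs ht) (Icc (s - h) (s + h))
    rw [Measure.restrict_restrict measurableSet_Icc, Measure.restrict_restrict measurableSet_Icc,
      inter_eq_right.2 h1, inter_comm] at h3
    exact h3
  refine (lintegral_mono' hle le_rfl).trans ?_
  refine lintegral_mono_ae ?_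
  filter_upwards [ae_restrict_of_ae_restrict_of_subset inter_subset_left i1.slice] with τ h2
  rw [← integral_sub i0 h2]
  refine (enorm_integral_le_lintegral_enorm _).trans (le_of_eq (lintegral_congr fun x => ?_))
  rw [← enorm_mul, ← enorm_neg]; congr 1; ring

/-! ### A lower bound for the kinetic energy -/

lemma aemeasurable_timeOsc {F G : ℝ → Torus d → ℝ}
    (hF : AEStronglyMeasurable (fun z : ℝ × Torus d => F z.1 z.2) (spaceTime d T))
    (hG : AEStronglyMeasurable (fun z : ℝ × Torus d => G z.1 z.2) (spaceTime d T)) (h : ℝ) :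
    AEMeasurable (timeOsc T F G h) (volume.restrict (Ioo 0 T)) := by
  obtain ⟨F', hF'm, -, hFF'⟩ := exists_stronglyMeasurable_rep hF
  obtain ⟨G', hG'm, -, hGG'⟩ := exists_stronglyMeasurable_rep hG
  refine ⟨timeOsc T F' G' h, ?_, (timeOsc_congr hFF' hGG').mono fun s hs => hs h⟩
  have hFm := hF'm.measurable
  have hGm := hG'm.measurable
  have m : Measurable fun z : (ℝ × ℝ) × Torus d =>
      ‖F' z.1.2 z.2 - F' z.1.1 z.2‖ₑ * ‖G' z.1.1 z.2‖ₑ := by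
    have e1 : Measurable fun z : (ℝ × ℝ) × Torus d => F' z.1.2 z.2 :=
      hFm.comp (g := fun z : ℝ × Torus d => F' z.1 z.2)
        (f := fun z : (ℝ × ℝ) × Torus d => (z.1.2, z.2)) (by fun_prop)
    have e2 : Measurable fun z : (ℝ × ℝ) × Torus d => F' z.1.1 z.2 :=
      hFm.comp (g := fun z : ℝ × Torus d => F' z.1 z.2)
        (f := fun z : (ℝ × ℝ) × Torus d => (z.1.1, z.2)) (by fun_prop)
    have e3 : Measurable fun z : (ℝ × ℝ) × Torus d => G' z.1.1 z.2 :=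
      hGm.comp (g := fun z : ℝ × Torus d => G' z.1 z.2)
        (f := fun z : (ℝ × ℝ) × Torus d => (z.1.1, z.2)) (by fun_prop)
    exact (e1.sub e2).enorm.mul e3.enorm
  have m2 := m.lintegral_prod_right' (ν := (volume : Measure (Torus d)))
  have hset : MeasurableSet {p : ℝ × ℝ | p.2 ∈ Ioo 0 T ∩ Icc (p.1 - h) (p.1 + h)} := by
    exact ((measurableSet_lt measurable_const measurable_snd).inter
      (measurableSet_lt measurable_snd measurable_const)).inter
      ((measurableSet_le (measurable_fst.sub_const h) measurable_snd).inter
      (measurableSet_le measurable_snd (measurable_fst.add_const h)))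
  have m3 := (m2.indicator hset).lintegral_prod_right' (ν := (volume : Measure ℝ))
  have e : ∀ s, timeOsc T F' G' h s = ∫⁻ τ, {p : ℝ × ℝ | p.2 ∈ Ioo 0 T ∩ Icc (p.1 - h) (p.1 + h)}.indicator
      (fun p => ∫⁻ x, ‖F' p.2 x - F' p.1 x‖ₑ * ‖G' p.1 x‖ₑ) (s, τ) := fun s => by
    rw [timeOsc, ← lintegral_indicator (measurableSet_Ioo.inter measurableSet_Icc)]
    rfl
  rw [funext e]
  exact m3

lemma IntST.slice_uIoc {f : ℝ → Torus d → ℝ} (hf : IntST T f) {s t : ℝ} (hs : s ∈ Icc 0 T)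
    (ht : t ∈ Icc 0 T) : ∀ᵐ τ, τ ∈ uIoc s t → Integrable (f τ) :=
  (ae_restrict_iff' measurableSet_uIoc).1 (ae_mono (restrict_uIoc_le hs ht) hf.slice)

lemma IntST.intervalIntegral_add {f g : ℝ → Torus d → ℝ} (hf : IntST T f) (hg : IntST T g)
    {s t : ℝ} (hs : s ∈ Icc 0 T) (ht : t ∈ Icc 0 T) :
    ∫ τ in s..t, ∫ x, (f τ x + g τ x) = (∫ τ in s..t, ∫ x, f τ x) + ∫ τ in s..t, ∫ x, g τ x := by
  rw [← intervalIntegral.integral_add (intervalIntegrable_of_Ioo hf.integrableOn hs ht)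
    (intervalIntegrable_of_Ioo hg.integrableOn hs ht)]
  refine intervalIntegral.integral_congr_ae ?_
  filter_upwards [hf.slice_uIoc hs ht, hg.slice_uIoc hs ht] with τ h1 h2 hτ
  exact integral_add (h1 hτ) (h2 hτ)

lemma IntST.intervalIntegral_sum {ι : Type*} (σ : Finset ι) {f : ι → ℝ → Torus d → ℝ}
    (hf : ∀ i ∈ σ, IntST T (f i)) {s t : ℝ} (hs : s ∈ Icc 0 T) (ht : t ∈ Icc 0 T) :
    ∫ τ in s..t, ∫ x, ∑ i ∈ σ, f i τ x = ∑ i ∈ σ, ∫ τ in s..t, ∫ x, f i τ x := by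
  rw [← intervalIntegral.integral_finsetSum fun i hi =>
    intervalIntegrable_of_Ioo (hf i hi).integrableOn hs ht]
  refine intervalIntegral.integral_congr_ae ?_
  filter_upwards [(Finset.eventually_all σ).2 fun i hi => (hf i hi).slice_uIoc hs ht] with τ h1 hτ
  exact integral_finsetSum _ fun i hi => h1 i hi hτ

section

variable {μ lam γ al be ka el : ℝ} {ϱ : ℝ → Torus d → ℝ}
  {v : ℝ → Torus d → Vec d} {D : ℝ → Torus d → Mat d} {R : ℝ → Torus d → Vec d}
  {ϱ₀ : Torus d → ℝ} {v₀ : Torus d → Vec d}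

namespace RegularSolution

variable (S : RegularSolution μ lam γ T al be ka el ϱ v D R ϱ₀ v₀)

include S

lemma intST_inertialStress (i j : Fin d) : IntST T (inertialStress γ ϱ v i j) :=
  (S.mix_inertialStress i j).integrable (by linarith [S.al_pos, S.ka_pos])
    (by linarith [S.ka_lt_two]) (by linarith [S.be_pos, S.el_pos]) (by linarith [S.el_lt_two])

lemma intST_viscousStress (i j : Fin d) : IntST T (viscousStress μ lam D i j) :=
  (S.mix_viscousStress i j).integrable (by norm_num) (by norm_num) (by norm_num) (by norm_num)

lemma momentumPairing_sub (i : Fin d) {w : Torus d → ℝ} (hw : w ∈ trigPoly d) {s t : ℝ}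
    (hs : s ∈ Icc 0 T) (ht : t ∈ Icc 0 T) :
    momentumPairing μ lam γ ϱ v D ϱ₀ v₀ i w t = momentumPairing μ lam γ ϱ v D ϱ₀ v₀ i w s
      + ∑ j, ((∫ τ in s..t, ∫ x, inertialStress γ ϱ v i j τ x * pderiv j w x)
        + ∫ τ in s..t, ∫ x, viscousStress μ lam D i j τ x * pderiv j w x) := by
  have h0 : (0 : ℝ) ∈ Icc 0 T := ⟨le_rfl, S.time_pos.le⟩
  have hI := (S.intST_stress_grad i hw).integrableOn
  have h1 := intervalIntegral.integral_add_adjacent_intervals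
    (intervalIntegrable_of_Ioo hI h0 hs) (intervalIntegrable_of_Ioo hI hs ht)
  rw [momentumPairing, momentumPairing, ← h1, add_assoc, add_right_inj, add_right_inj,
    IntST.intervalIntegral_sum _ (fun j _ =>
      (S.intST_stress i j).mul_trigPoly (pderiv_mem_trigPoly hw j)) hs ht]
  refine Finset.sum_congr rfl fun j _ => ?_
  simp_rw [add_mul]
  exact ((S.intST_inertialStress i j).mul_trigPoly (pderiv_mem_trigPoly hw j)).intervalIntegral_add
    ((S.intST_viscousStress i j).mul_trigPoly (pderiv_mem_trigPoly hw j)) hs ht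

lemma integral_rep_sq {w : Torus d → ℝ} (hw : w ∈ trigPoly d) {s t : ℝ}
    (hs : s ∈ Icc 0 T) (ht : t ∈ Icc 0 T) :
    ∫ x, rep ϱ₀ ϱ v D R t x * (w x * w x) = (∫ x, rep ϱ₀ ϱ v D R s x * (w x * w x))
      + 2 * ∑ j, ∫ τ in s..t, ∫ x, ϱ τ x * v τ x j * (w x * pderiv j w x) := by
  have hw2 : (fun x => w x * w x) ∈ trigPoly d := mul_mem hw hw
  have h0 : (0 : ℝ) ∈ Icc 0 T := ⟨le_rfl, S.time_pos.le⟩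
  have hf : ∀ j, IntST T (fun t x => ϱ t x * v t x j * pderiv j (fun x => w x * w x) x) :=
    fun j => (S.intST_density_velocity j).mul_trigPoly (pderiv_mem_trigPoly hw2 j)
  have hI := IntST.integrableOn (f := fun t x =>
    ∑ j, ϱ t x * v t x j * pderiv j (fun x => w x * w x) x) (integrable_finsetSum _ fun j _ => hf j)
  have h1 := intervalIntegral.integral_add_adjacent_intervals
    (intervalIntegrable_of_Ioo hI h0 hs) (intervalIntegrable_of_Ioo hI hs ht)
  rw [S.integral_rep_mul hw2 ht, S.integral_rep_mul hw2 hs, ← h1, add_assoc, add_right_inj,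
    add_right_inj, IntST.intervalIntegral_sum _ (fun j _ => hf j) hs ht, Finset.mul_sum]
  refine Finset.sum_congr rfl fun j _ => ?_
  rw [← intervalIntegral.integral_const_mul]
  simp_rw [← integral_const_mul, pderiv_mul hw hw]
  congr 1; ext τ; congr 1; ext x; ring

/-- The convexity inequality `½ r|u|² ≥ r u · w - ½ r|w|²`, combined with the momentum and mass
equations between the times `s` and `t`. -/
lemma kinetic_ge_of_test {s t : ℝ} (hs : s ∈ Icc 0 T) (ht : t ∈ Icc 0 T) {us u : Torus d → Vec d}
    (hus : IsVelocityAt μ lam γ ϱ v D R ϱ₀ v₀ s us) (hu : IsVelocityAt μ lam γ ϱ v D R ϱ₀ v₀ t u)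
    {w : Fin d → Torus d → ℝ} (hw : ∀ i, w i ∈ trigPoly d) :
    ∑ i, ((∫ x, rep ϱ₀ ϱ v D R s x * us x i * w i x)
        - 1 / 2 * ∫ x, rep ϱ₀ ϱ v D R s x * (w i x * w i x))
      + ∑ i, ∑ j, ((∫ τ in s..t, ∫ x, inertialStress γ ϱ v i j τ x * pderiv j (w i) x)
        + (∫ τ in s..t, ∫ x, viscousStress μ lam D i j τ x * pderiv j (w i) x)
        - ∫ τ in s..t, ∫ x, ϱ τ x * v τ x j * (w i x * pderiv j (w i) x))
      ≤ 1 / 2 * ∫ x, rep ϱ₀ ϱ v D R t x * ‖u x‖ ^ 2 := by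
  have hr := S.rep_nonneg ht
  have i1 : ∀ i, Integrable (fun x => rep ϱ₀ ϱ v D R t x * u x i * w i x) := fun i =>
    integrable_mul_of_mem_trigPoly (hu.integrable i) (hw i)
  have i2 : ∀ i, Integrable (fun x => rep ϱ₀ ϱ v D R t x * (w i x * w i x)) := fun i =>
    integrable_mul_of_mem_trigPoly (S.integrable_rep ht) (mul_mem (hw i) (hw i))
  have h1 : ∑ i, ((∫ x, rep ϱ₀ ϱ v D R t x * u x i * w i x)
      - 1 / 2 * ∫ x, rep ϱ₀ ϱ v D R t x * (w i x * w i x))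
      ≤ 1 / 2 * ∫ x, rep ϱ₀ ϱ v D R t x * ‖u x‖ ^ 2 := by
    have i3 : ∀ i, Integrable (fun x => rep ϱ₀ ϱ v D R t x * u x i * w i x
        - 1 / 2 * (rep ϱ₀ ϱ v D R t x * (w i x * w i x))) := fun i =>
      (i1 i).sub ((i2 i).const_mul (1 / 2))
    simp_rw [← integral_const_mul]
    rw [Finset.sum_congr rfl fun i _ => (integral_sub (i1 i) ((i2 i).const_mul (1 / 2))).symm,
      ← integral_finsetSum _ fun i _ => i3 i]
    refine integral_mono_ae (integrable_finsetSum _ fun i _ => i3 i)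
      ((S.kinetic_of_isVelocityAt ht hu).1.const_mul _) ?_
    filter_upwards [hr] with x hx
    rw [EuclideanSpace.real_norm_sq_eq, Finset.mul_sum, Finset.mul_sum]
    refine Finset.sum_le_sum fun i _ => ?_
    nlinarith [mul_nonneg hx (sq_nonneg (u x i - w i x))]
  refine le_trans (le_of_eq ?_) h1
  rw [← Finset.sum_add_distrib]
  refine Finset.sum_congr rfl fun i _ => ?_
  rw [hu.pairing i _ (hw i), S.momentumPairing_sub i (hw i) hs ht, hus.pairing i _ (hw i),
    S.integral_rep_sq (hw i) hs ht, Finset.sum_sub_distrib]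
  ring

lemma mix_grad (i : Fin d × Fin d) :
    Mix T (1 - (2 * al + ka)) (1 - (2 * be + el)) (fun t x => D t x i) := by
  have := S.grad i
  rwa [← sub_sub, ← sub_sub]

lemma mix_velocity_grad (i j : Fin d) :
    Mix T (1 - (ka + al)) (1 - (el + be)) (fun t x => v t x i * D t x (i, j)) := by
  have := (S.velocity i).mul S.al_pos S.be_pos (by linarith [S.ka_lt_two])
    (by linarith [S.el_lt_two]) (S.grad (i, j))
  rwa [show al + (1 - 2 * al - ka) = 1 - (ka + al) by ring,
    show be + (1 - 2 * be - el) = 1 - (el + be) by ring] at this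

/-- The limit `w → v(s)` in `kinetic_ge_of_test`. -/
lemma ae_kinetic_ge : ∀ᵐ s ∂(volume.restrict (Ioo 0 T)), ∀ t ∈ Icc 0 T, ∀ u,
    IsVelocityAt μ lam γ ϱ v D R ϱ₀ v₀ t u →
    1 / 2 * (∫ x, ϱ s x * ‖v s x‖ ^ 2)
      + ∑ i, ∑ j, ((∫ τ in s..t, ∫ x, inertialStress γ ϱ v i j τ x * D s x (i, j))
        + (∫ τ in s..t, ∫ x, viscousStress μ lam D i j τ x * D s x (i, j))
        - ∫ τ in s..t, ∫ x, ϱ τ x * v τ x j * (v s x i * D s x (i, j)))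
      ≤ 1 / 2 * ∫ x, rep ϱ₀ ϱ v D R t x * ‖u x‖ ^ 2 := by
  have hal := S.al_pos
  have hbe := S.be_pos
  have hka := S.ka_pos
  have hel := S.el_pos
  have hka2 := S.ka_lt_two
  have hel2 := S.el_lt_two
  have a1 : ∀ᵐ s ∂(volume.restrict (Ioo 0 T)), ∀ i, MemLp (fun x => v s x i) (pe be) volume :=
    ae_all_iff.2 fun i => (S.velocity i).memLp_slice hal hbe
  have a2 : ∀ᵐ s ∂(volume.restrict (Ioo 0 T)), ∀ i : Fin d × Fin d,
      MemLp (fun x => D s x i) (pe (1 - (2 * be + el))) volume :=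
    ae_all_iff.2 fun i => (S.mix_grad i).memLp_slice (by linarith) (by linarith)
  have a3 : ∀ᵐ s ∂(volume.restrict (Ioo 0 T)), ∀ i : Fin d × Fin d,
      MemLp (fun x => D s x i) (pe (1 / 2)) volume :=
    ae_all_iff.2 fun i => (S.grad_two i).memLp_slice (by norm_num) (by norm_num)
  have a4 : ∀ᵐ s ∂(volume.restrict (Ioo 0 T)), ∀ i j,
      HasTorusPartial j (fun x => v s x i) (fun x => D s x (i, j)) :=
    ae_all_iff.2 fun i => ae_all_iff.2 fun j => (S.sol.gradient i j).slice
  filter_upwards [a1, a2, a3, a4, S.density.memLp_slice hka hel, S.ae_isVelocityAt,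
    S.ae_density_eq, ae_restrict_mem measurableSet_Ioo, S.ae_integrable_kinetic]
    with s h1 h2 h3 h4 h5 h6 h7 h8 h9 t ht u hu
  have hs : s ∈ Icc 0 T := ⟨h8.1.le, h8.2.le⟩
  have h10 : MemLp (rep ϱ₀ ϱ v D R s) (pe el) volume := (memLp_congr_ae h7).1 h5
  have hvi : ∀ i, Integrable (fun x => v s x i) := fun i =>
    memLp_pe_integrable (by linarith) (h1 i)
  have hw : ∀ N i, moll N (fun x => v s x i) ∈ trigPoly d := fun N i => moll_mem_trigPoly N (hvi i)
  have key := fun N => S.kinetic_ge_of_test hs ht h6 hu (hw N)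
  simp_rw [fun N i j x => pderiv_moll N (hvi i) (h4 i j) x] at key
  have c1 : ∀ i, LConv be (fun N => moll N fun x => v s x i) (fun x => v s x i) := fun i =>
    lConv_moll hbe (by linarith) (h1 i)
  have c2 : ∀ i j, LConv (1 - (2 * be + el)) (fun N => moll N fun x => D s x (i, j))
      (fun x => D s x (i, j)) := fun i j => lConv_moll (by linarith) (by linarith) (h2 (i, j))
  have c3 : ∀ i j, LConv (1 - 1 / 2) (fun N => moll N fun x => D s x (i, j))
      (fun x => D s x (i, j)) := fun i j => by
    have := lConv_moll (by norm_num) (by norm_num) (h3 (i, j))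
    norm_num at this ⊢
    exact this
  have c4 : ∀ i j, LConv (1 - (el + be))
      (fun N x => moll N (fun x => v s x i) x * moll N (fun x => D s x (i, j)) x)
      (fun x => v s x i * D s x (i, j)) := fun i j => by
    have := (c1 i).mul hbe.le (by linarith) (by linarith) (c2 i j)
    rwa [show be + (1 - (2 * be + el)) = 1 - (el + be) by ring] at this
  have e0 : 1 / 2 * (∫ x, ϱ s x * ‖v s x‖ ^ 2)
      = ∑ i, ((∫ x, rep ϱ₀ ϱ v D R s x * v s x i * v s x i)
        - 1 / 2 * ∫ x, rep ϱ₀ ϱ v D R s x * (v s x i * v s x i)) := by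
    have i1 : ∀ i, Integrable (fun x => rep ϱ₀ ϱ v D R s x * (v s x i * v s x i)) := fun i =>
      memLp_pe_integrable (by linarith) (memLp_mul hel.le (by linarith) h10
        (memLp_mul hbe.le hbe.le (h1 i) (h1 i)))
    have e1 : ∫ x, ϱ s x * ‖v s x‖ ^ 2
        = ∑ i, ∫ x, rep ϱ₀ ϱ v D R s x * (v s x i * v s x i) := by
      rw [← integral_finsetSum _ fun i _ => i1 i]
      refine integral_congr_ae (h7.mono fun x hx => ?_)
      simp only [hx, EuclideanSpace.real_norm_sq_eq, Finset.mul_sum, ← sq]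
    rw [e1, Finset.mul_sum]
    refine Finset.sum_congr rfl fun i _ => ?_
    simp_rw [mul_assoc]; ring
  rw [e0]
  have t1 : ∀ i, Tendsto (fun N => ∫ x, rep ϱ₀ ϱ v D R s x * v s x i
      * moll N (fun x => v s x i) x) atTop (𝓝 (∫ x, rep ϱ₀ ϱ v D R s x * v s x i * v s x i)) :=
    fun i => (((LConv.const h10).mul hel.le hbe.le (by linarith) (LConv.const (h1 i))).mul
      (by linarith) hbe.le (by linarith) (c1 i)).tendsto_integral (by linarith)
  have t2 : ∀ i, Tendsto (fun N => ∫ x, rep ϱ₀ ϱ v D R s x * (moll N (fun x => v s x i) x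
      * moll N (fun x => v s x i) x)) atTop
      (𝓝 (∫ x, rep ϱ₀ ϱ v D R s x * (v s x i * v s x i))) := fun i =>
    ((LConv.const h10).mul hel.le (by linarith) (by linarith)
      ((c1 i).mul hbe.le hbe.le (by linarith) (c1 i))).tendsto_integral (by linarith)
  have t3 := fun i j => (S.mix_inertialStress i j).tendsto_pairing (by linarith) (by linarith)
    (by linarith) (by linarith) (c2 i j) hs ht
  have t4 := fun i j => (S.mix_viscousStress i j).tendsto_pairing (by norm_num) (by norm_num)
    (by norm_num) (by norm_num) (c3 i j) hs ht
  have t5 := fun i j => (S.mix_density_velocity j).tendsto_pairing (by linarith) (by linarith)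
    (by linarith) (by linarith) (c4 i j) hs ht
  have t6 := (tendsto_finsetSum Finset.univ fun i _ =>
    (t1 i).sub ((t2 i).const_mul (1 / 2))).add (tendsto_finsetSum Finset.univ fun i _ =>
      tendsto_finsetSum Finset.univ fun j _ => ((t3 i j).add (t4 i j)).sub (t5 i j))
  exact le_of_tendsto' t6 key

end RegularSolution

end

/-! ### The balance of kinetic energy -/

section

variable {μ lam γ al be ka el : ℝ} {ϱ : ℝ → Torus d → ℝ}
  {v : ℝ → Torus d → Vec d} {D : ℝ → Torus d → Mat d} {R : ℝ → Torus d → Vec d}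
  {ϱ₀ : Torus d → ℝ} {v₀ : Torus d → Vec d}

namespace RegularSolution

variable (S : RegularSolution μ lam γ T al be ka el ϱ v D R ϱ₀ v₀)

include S

lemma intST_inertialStress_mul (i j : Fin d) :
    IntST T (fun s x => inertialStress γ ϱ v i j s x * D s x (i, j)) := by
  have h := (S.mix_inertialStress i j).mul (by linarith [S.al_pos, S.ka_pos])
    (by linarith [S.be_pos, S.el_pos]) (by linarith [S.ka_lt_two]) (by linarith [S.el_lt_two])
    (S.mix_grad (i, j))
  rw [add_sub_cancel, add_sub_cancel] at h
  exact h.integrable one_pos le_rfl one_pos le_rfl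

lemma intST_viscousStress_mul (i j : Fin d) :
    IntST T (fun s x => viscousStress μ lam D i j s x * D s x (i, j)) := by
  have h := (S.mix_viscousStress i j).mul (by norm_num) (by norm_num) (by norm_num) (by norm_num)
    (S.grad_two (i, j))
  rw [add_halves] at h
  exact h.integrable one_pos le_rfl one_pos le_rfl

lemma intST_convection_mul (i j : Fin d) :
    IntST T (fun s x => ϱ s x * v s x j * (v s x i * D s x (i, j))) := by
  have h := (S.mix_density_velocity j).mul (by linarith [S.al_pos, S.ka_pos])
    (by linarith [S.be_pos, S.el_pos]) (by linarith [S.ka_lt_two, S.al_pos])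
    (by linarith [S.el_lt_two, S.be_pos]) (S.mix_velocity_grad i j)
  rw [add_sub_cancel, add_sub_cancel] at h
  exact h.integrable one_pos le_rfl one_pos le_rfl

lemma intST_sq_grad (i : Fin d × Fin d) : IntST T (fun s x => D s x i ^ 2) := by
  have h := (S.grad_two i).mul (by norm_num) (by norm_num) (by norm_num) (by norm_num)
    (S.grad_two i)
  rw [add_halves] at h
  simpa only [sq] using h.integrable one_pos le_rfl one_pos le_rfl

lemma intST_sq_tr : IntST T (fun s x => tr (D s x) ^ 2) := by
  have h0 : Mix T (1 / 2) (1 / 2) (fun s x => tr (D s x)) :=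
    Mix.sum Finset.univ (by norm_num) (by norm_num) (by norm_num) (by norm_num)
      fun i => S.grad_two (i, i)
  have h := h0.mul (by norm_num) (by norm_num) (by norm_num) (by norm_num) h0
  rw [add_halves] at h
  simpa only [sq] using h.integrable one_pos le_rfl one_pos le_rfl

lemma intST_dissipation : IntST T (fun s x => μ * ‖D s x‖ ^ 2 + (μ + lam) * tr (D s x) ^ 2) := by
  have h1 : IntST T (fun s x => ∑ i, D s x i ^ 2) :=
    integrable_finsetSum _ fun i _ => S.intST_sq_grad i
  simp_rw [← EuclideanSpace.real_norm_sq_eq] at h1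
  exact (h1.const_mul μ).add (S.intST_sq_tr.const_mul (μ + lam))

lemma intST_kinetic : IntST T (fun s x => ϱ s x * ‖v s x‖ ^ 2) := by
  obtain ⟨K, hK, h⟩ := S.ae_kinetic_bound
  refine ⟨S.sol.kinetic_bound.1, ?_⟩
  rw [HasFiniteIntegral, spaceTime, lintegral_prod _ S.sol.kinetic_bound.1.enorm]
  refine (lintegral_mono_ae h).trans_lt ?_
  rw [lintegral_const]
  exact ENNReal.mul_lt_top hK.lt_top (measure_lt_top _ _)

/-- The rate of change of the kinetic energy at time `s`. -/
lemma ae_kinetic_rate_eq : ∀ᵐ s ∂(volume.restrict (Ioo 0 T)),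
    ∑ i, ∑ j, ((∫ x, inertialStress γ ϱ v i j s x * D s x (i, j))
      + (∫ x, viscousStress μ lam D i j s x * D s x (i, j))
      - ∫ x, ϱ s x * v s x j * (v s x i * D s x (i, j)))
    = (∫ x, ϱ s x ^ γ * tr (D s x)) - ∫ x, (μ * ‖D s x‖ ^ 2 + (μ + lam) * tr (D s x) ^ 2) := by
  filter_upwards [ae_all_iff.2 fun i => ae_all_iff.2 fun j => (S.intST_inertialStress_mul i j).slice,
    ae_all_iff.2 fun i => ae_all_iff.2 fun j => (S.intST_viscousStress_mul i j).slice,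
    ae_all_iff.2 fun i => ae_all_iff.2 fun j => (S.intST_convection_mul i j).slice,
    S.intST_pressure_tr.slice, S.intST_dissipation.slice] with s h1 h2 h3 h4 h5
  have i1 : ∀ i j, Integrable (fun x => inertialStress γ ϱ v i j s x * D s x (i, j)
      + viscousStress μ lam D i j s x * D s x (i, j)
      - ϱ s x * v s x j * (v s x i * D s x (i, j))) := fun i j =>
    ((h1 i j).add (h2 i j)).sub (h3 i j)
  have e1 : ∀ i j, (∫ x, inertialStress γ ϱ v i j s x * D s x (i, j))
      + (∫ x, viscousStress μ lam D i j s x * D s x (i, j))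
      - (∫ x, ϱ s x * v s x j * (v s x i * D s x (i, j)))
      = ∫ x, (inertialStress γ ϱ v i j s x * D s x (i, j)
      + viscousStress μ lam D i j s x * D s x (i, j)
      - ϱ s x * v s x j * (v s x i * D s x (i, j))) := fun i j => by
    rw [← integral_add (h1 i j) (h2 i j)]
    exact (integral_sub ((h1 i j).add (h2 i j)) (h3 i j)).symm
  simp_rw [e1]
  rw [← integral_sub h4 h5, Finset.sum_congr rfl fun i _ =>
    (integral_finsetSum Finset.univ fun j _ => i1 i j).symm,
    ← integral_finsetSum _ fun i _ => integrable_finsetSum _ fun j _ => i1 i j]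
  refine integral_congr_ae (ae_of_all _ fun x => ?_)
  have e2 : ∀ i j, inertialStress γ ϱ v i j s x * D s x (i, j)
      + viscousStress μ lam D i j s x * D s x (i, j)
      - ϱ s x * v s x j * (v s x i * D s x (i, j))
      = (if i = j then (ϱ s x ^ γ - (μ + lam) * tr (D s x)) * D s x (i, j) else 0)
        - μ * D s x (i, j) ^ 2 := by
    intro i j
    simp only [inertialStress, viscousStress]
    split_ifs <;> ring
  simp only [e2, Finset.sum_sub_distrib, Finset.sum_ite_eq, Finset.mem_univ, if_true,
    ← Finset.mul_sum]
  rw [EuclideanSpace.real_norm_sq_eq, Fintype.sum_prod_type]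
  simp only [tr]
  ring

/-- The balance of kinetic energy. It follows from `ae_kinetic_ge` through
`eq_primitive_of_subgradient`, freezing the stresses at time `s` being controlled by `timeOsc`. -/
lemma kinetic_balance {u : ℝ → Torus d → Vec d}
    (hu : ∀ t ∈ Icc 0 T, IsVelocityAt μ lam γ ϱ v D R ϱ₀ v₀ t (u t))
    (huv : ∀ᵐ t ∂(volume.restrict (Ioo 0 T)), u t = v t) {t : ℝ} (ht : t ∈ Icc 0 T) :
    1 / 2 * (∫ x, rep ϱ₀ ϱ v D R t x * ‖u t x‖ ^ 2)
      = 1 / 2 * (∫ x, rep ϱ₀ ϱ v D R 0 x * ‖u 0 x‖ ^ 2)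
        + ∫ s in (0 : ℝ)..t, ((∫ x, ϱ s x ^ γ * tr (D s x))
          - ∫ x, (μ * ‖D s x‖ ^ 2 + (μ + lam) * tr (D s x) ^ 2)) := by
  have hal := S.al_pos
  have hbe := S.be_pos
  have hka := S.ka_pos
  have hel := S.el_pos
  have hka2 := S.ka_lt_two
  have hel2 := S.el_lt_two
  have hT := S.time_pos
  have hI : ∀ᵐ t ∂(volume.restrict (Ioo 0 T)), t ∈ Icc 0 T := by
    filter_upwards [ae_restrict_mem measurableSet_Ioo] with t ht using ⟨ht.1.le, ht.2.le⟩
  have he : ∀ᵐ s ∂(volume.restrict (Ioo 0 T)), ∫ x, ϱ s x * ‖v s x‖ ^ 2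
      = ∫ x, rep ϱ₀ ϱ v D R s x * ‖u s x‖ ^ 2 := by
    filter_upwards [huv, S.ae_density_eq] with s h1 h2
    rw [h1]
    exact integral_congr_ae (h2.mono fun x hx => by simp only [hx])
  set B : ℝ → ℝ := fun s => (∫ x, ϱ s x ^ γ * tr (D s x))
      - ∫ x, (μ * ‖D s x‖ ^ 2 + (μ + lam) * tr (D s x) ^ 2) with hB
  set β : ℝ → ℝ → ℝ≥0∞ := fun h s => ∑ i, ∑ j,
    (timeOsc T (inertialStress γ ϱ v i j) (fun s x => D s x (i, j)) h s
      + timeOsc T (viscousStress μ lam D i j) (fun s x => D s x (i, j)) h s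
      + timeOsc T (fun s x => ϱ s x * v s x j) (fun s x => v s x i * D s x (i, j)) h s) with hβ
  refine eq_primitive_of_subgradient (e := fun t => 1 / 2 * ∫ x, rep ϱ₀ ϱ v D R t x * ‖u t x‖ ^ 2)
    (B := B) (β := β) hT ?_ ?_ ?_ ?_ ?_ t ht
  · exact (S.intST_kinetic.integrableOn.congr he).const_mul _
  · exact S.intST_pressure_tr.integrableOn.sub S.intST_dissipation.integrableOn
  · have m1 := fun i j => aemeasurable_timeOsc (G := fun s x => D s x (i, j))
      (S.mix_inertialStress i j).meas
      (S.mix_grad (i, j)).meas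
    have m2 := fun i j => aemeasurable_timeOsc (G := fun s x => D s x (i, j))
      (S.mix_viscousStress i j).meas
      (S.mix_grad (i, j)).meas
    have m3 := fun i j => aemeasurable_timeOsc (F := fun s x => ϱ s x * v s x j)
      (G := fun s x => v s x i * D s x (i, j)) (S.mix_density_velocity j).meas
      (S.mix_velocity_grad i j).meas
    have l1 := fun i j => tendsto_timeOsc (by linarith) (by linarith) (by linarith) (by linarith)
      (S.mix_inertialStress i j) (S.mix_grad (i, j))
    have l2 := fun i j => tendsto_timeOsc (by norm_num) (by norm_num) (by norm_num) (by norm_num)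
      (S.mix_viscousStress i j) (show Mix T (1 - 1 / 2) (1 - 1 / 2) (fun t x => D t x (i, j)) by
        have := S.grad_two (i, j)
        norm_num at this ⊢
        exact this)
    have l3 := fun i j => tendsto_timeOsc (by linarith) (by linarith) (by linarith) (by linarith)
      (S.mix_density_velocity j) (S.mix_velocity_grad i j)
    have l := tendsto_finsetSum Finset.univ fun i _ => tendsto_finsetSum Finset.univ fun j _ =>
      ((l1 i j).add (l2 i j)).add (l3 i j)
    simp only [add_zero, Finset.sum_const_zero] at l
    refine l.congr fun h => ?_
    have m4 : ∀ i j, AEMeasurable (fun s =>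
        timeOsc T (inertialStress γ ϱ v i j) (fun s x => D s x (i, j)) h s
          + timeOsc T (viscousStress μ lam D i j) (fun s x => D s x (i, j)) h s
          + timeOsc T (fun s x => ϱ s x * v s x j) (fun s x => v s x i * D s x (i, j)) h s)
        (volume.restrict (Ioo 0 T)) := fun i j => ((m1 i j h).add (m2 i j h)).add (m3 i j h)
    simp only [hβ]
    rw [lintegral_finsetSum' _ fun i _ => Finset.aemeasurable_fun_sum _ fun j _ => m4 i j,
      Finset.mul_sum]
    refine Finset.sum_congr rfl fun i _ => ?_
    rw [lintegral_finsetSum' _ fun j _ => m4 i j, Finset.mul_sum]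
    refine Finset.sum_congr rfl fun j _ => ?_
    rw [lintegral_add_right' _ (m3 i j h), lintegral_add_left' (m1 i j h), mul_add, mul_add]
  · have a1 : ∀ᵐ s ∂(volume.restrict (Ioo 0 T)), ∀ i : Fin d × Fin d,
        MemLp (fun x => D s x i) (pe (1 - (2 * be + el))) volume :=
      ae_all_iff.2 fun i => (S.mix_grad i).memLp_slice (by linarith) (by linarith)
    have a2 : ∀ᵐ s ∂(volume.restrict (Ioo 0 T)), ∀ i : Fin d × Fin d,
        MemLp (fun x => D s x i) (pe (1 / 2)) volume :=
      ae_all_iff.2 fun i => (S.grad_two i).memLp_slice (by norm_num) (by norm_num)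
    have a3 : ∀ᵐ s ∂(volume.restrict (Ioo 0 T)), ∀ i j,
        MemLp (fun x => v s x i * D s x (i, j)) (pe (1 - (el + be))) volume :=
      ae_all_iff.2 fun i => ae_all_iff.2 fun j =>
        (S.mix_velocity_grad i j).memLp_slice (by linarith) (by linarith)
    filter_upwards [a1, a2, a3, hI, he, S.ae_kinetic_ge, S.ae_kinetic_rate_eq,
      ae_all_iff.2 fun i => ae_all_iff.2 fun j => (S.intST_inertialStress_mul i j).slice,
      ae_all_iff.2 fun i => ae_all_iff.2 fun j => (S.intST_viscousStress_mul i j).slice,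
      ae_all_iff.2 fun i => ae_all_iff.2 fun j => (S.intST_convection_mul i j).slice]
      with s a1 a2 a3 hs he hge hrate i1 i2 i3 h _ t ht hst
    have b1 := fun i j => Mix.enorm_sub_le_timeOsc (F := inertialStress γ ϱ v i j)
      (G := fun s x => D s x (i, j)) hs ht hst (i1 i j)
      ((S.mix_inertialStress i j).intST_mul (by linarith) (by linarith) (by linarith)
        (by linarith) (a1 (i, j)))
    have b2 := fun i j => Mix.enorm_sub_le_timeOsc (F := viscousStress μ lam D i j)
      (G := fun s x => D s x (i, j)) hs ht hst (i2 i j)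
      ((S.mix_viscousStress i j).intST_mul (by norm_num) (by norm_num) (by norm_num)
        (by norm_num) (by have := a2 (i, j); norm_num at this ⊢; exact this))
    have b3 := fun i j => Mix.enorm_sub_le_timeOsc (F := fun s x => ϱ s x * v s x j)
      (G := fun s x => v s x i * D s x (i, j)) hs ht hst (i3 i j)
      ((S.mix_density_velocity j).intST_mul (by linarith) (by linarith) (by linarith)
        (by linarith) (a3 i j))
    have h1 := hge t ht (u t) (hu t ht)
    rw [he] at h1
    have h2 : 1 / 2 * (∫ x, rep ϱ₀ ϱ v D R s x * ‖u s x‖ ^ 2) + (t - s) * B s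
        - 1 / 2 * (∫ x, rep ϱ₀ ϱ v D R t x * ‖u t x‖ ^ 2)
        ≤ ∑ i, ∑ j,
          (((t - s) * (∫ x, inertialStress γ ϱ v i j s x * D s x (i, j))
            - ∫ τ in s..t, ∫ x, inertialStress γ ϱ v i j τ x * D s x (i, j))
          + ((t - s) * (∫ x, viscousStress μ lam D i j s x * D s x (i, j))
            - ∫ τ in s..t, ∫ x, viscousStress μ lam D i j τ x * D s x (i, j))
          - ((t - s) * (∫ x, ϱ s x * v s x j * (v s x i * D s x (i, j)))
            - ∫ τ in s..t, ∫ x, ϱ τ x * v τ x j * (v s x i * D s x (i, j)))) := by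
      simp only [hB]
      rw [← hrate]
      simp only [Finset.sum_add_distrib, Finset.sum_sub_distrib, mul_add, mul_sub, Finset.mul_sum]
        at h1 ⊢
      linarith
    refine (ENNReal.ofReal_le_ofReal (h2.trans (le_abs_self _))).trans ?_
    rw [← Real.norm_eq_abs, ofReal_norm]
    refine (enorm_sum_le _ _).trans (Finset.sum_le_sum fun i _ => (enorm_sum_le _ _).trans
      (Finset.sum_le_sum fun j _ => (enorm_sub_le).trans ?_))
    exact add_le_add ((enorm_add_le _ _).trans (add_le_add (b1 i j) (b2 i j))) (b3 i j)
  · intro t ht c hc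
    have h1 := (S.kinetic_of_isVelocityAt ht (hu t ht)).2 (2 * c) (by
      filter_upwards [show ∀ᶠ s in nearTime T t, _ from hc, eventually_nearTime he t] with s h1 h2
      rw [h2]; linarith)
    linarith

end RegularSolution

end

/-! ### Weak continuity in time -/

/-- Weak continuity may be tested on trigonometric polynomials, for a family bounded in a Lebesgue
space. -/
lemma continuousOn_pairing {b : ℝ} (hb : 0 < b) (hb1 : b < 1) {f : ℝ → Torus d → ℝ} {C : ℝ≥0∞}
    (hC : C ≠ ∞) (hf : ∀ t ∈ Icc 0 T, AEStronglyMeasurable (f t) volume)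
    (hfC : ∀ t ∈ Icc 0 T, eLpNorm (f t) (pe b) volume ≤ C)
    (hcont : ∀ w ∈ trigPoly d, ContinuousOn (fun t => ∫ x, f t x * w x) (Icc 0 T))
    {w : Torus d → ℝ} (hw : MemLp w (pe (1 - b)) volume) :
    ContinuousOn (fun t => ∫ x, f t x * w x) (Icc 0 T) := by
  have hwi := memLp_pe_integrable (by linarith) hw
  have hc := lConv_moll (by linarith) (by linarith) hw
  have hu : TendstoUniformlyOn (fun N t => ∫ x, f t x * moll N w x) (fun t => ∫ x, f t x * w x)
      atTop (Icc 0 T) := by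
    rw [EMetric.tendstoUniformlyOn_iff]
    intro ε hε
    have h1 := ENNReal.Tendsto.const_mul (a := C) hc.tendsto (Or.inr hC)
    rw [mul_zero] at h1
    filter_upwards [(tendsto_order.1 h1).2 ε hε] with N hN t ht
    refine lt_of_le_of_lt ?_ hN
    have hft : MemLp (f t) (pe b) volume := ⟨hf t ht, (hfC t ht).trans_lt hC.lt_top⟩
    have i1 := memLp_mul hb.le (sub_pos.2 hb1).le hft hw
    have i2 := memLp_mul hb.le (sub_pos.2 hb1).le hft (hc.mem N)
    rw [add_sub_cancel] at i1 i2
    rw [edist_comm, edist_eq_enorm_sub, ← integral_sub (memLp_pe_integrable le_rfl i2)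
      (memLp_pe_integrable le_rfl i1)]
    refine (enorm_integral_le_lintegral_enorm _).trans ?_
    have h5 := eLpNorm_mul_le hb.le (sub_pos.2 hb1).le (hf t ht) ((hc.mem N).sub hw).1
    rw [add_sub_cancel, pe_one, eLpNorm_one_eq_lintegral_enorm] at h5
    refine le_trans (le_trans (le_of_eq (lintegral_congr fun x => ?_)) h5)
      (mul_le_mul' (hfC t ht) le_rfl)
    rw [Pi.sub_apply]; congr 1; ring
  exact hu.continuousOn (Frequently.of_forall fun N => hcont _ (moll_mem_trigPoly N hwi))

section

variable {μ lam γ al be ka el : ℝ} {ϱ : ℝ → Torus d → ℝ}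
  {v : ℝ → Torus d → Vec d} {D : ℝ → Torus d → Mat d} {R : ℝ → Torus d → Vec d}
  {ϱ₀ : Torus d → ℝ} {v₀ : Torus d → Vec d}

namespace RegularSolution

variable (S : RegularSolution μ lam γ T al be ka el ϱ v D R ϱ₀ v₀)

include S

lemma exists_lintegral_pressure_le : ∃ C : ℝ≥0∞, C ≠ ∞ ∧ ∀ t ∈ Icc 0 T,
    ∫⁻ x, ‖rep ϱ₀ ϱ v D R t x‖ₑ ^ γ ≤ C := by
  obtain ⟨C, hC⟩ := S.exists_pressure_bound
  refine ⟨ENNReal.ofReal C, ENNReal.ofReal_ne_top, fun t ht => ?_⟩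
  have hr := S.rep_nonneg ht
  have hγ := S.one_lt_gamma
  refine le_trans (le_of_eq ?_) (ENNReal.ofReal_le_ofReal (hC t ht))
  rw [ofReal_integral_eq_lintegral_ofReal (S.integral_pressure_rep ht).1
    (hr.mono fun x hx => Real.rpow_nonneg hx _)]
  refine lintegral_congr_ae (hr.mono fun x hx => ?_)
  dsimp only
  rw [Real.enorm_of_nonneg hx, ENNReal.ofReal_rpow_of_nonneg hx (by linarith)]

lemma exists_eLpNorm_rep_le : ∃ C : ℝ≥0∞, C ≠ ∞ ∧ ∀ t ∈ Icc 0 T,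
    eLpNorm (rep ϱ₀ ϱ v D R t) (pe γ⁻¹) volume ≤ C := by
  have hγ := inv_pos.2 (by linarith [S.one_lt_gamma] : 0 < γ)
  obtain ⟨C, hC, h⟩ := S.exists_lintegral_pressure_le
  refine ⟨C ^ γ⁻¹, ENNReal.rpow_ne_top_of_nonneg hγ.le hC, fun t ht => ?_⟩
  rw [eLpNorm_eq_lintegral hγ, inv_inv]
  exact ENNReal.rpow_le_rpow (h t ht) hγ.le

lemma exists_eLpNorm_sqrt_rep_le : ∃ C : ℝ≥0∞, C ≠ ∞ ∧ ∀ t ∈ Icc 0 T,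
    eLpNorm (fun x => √(rep ϱ₀ ϱ v D R t x)) (pe (2 * γ)⁻¹) volume ≤ C := by
  have hγ1 := S.one_lt_gamma
  have hγ : 0 < (2 * γ)⁻¹ := by positivity
  obtain ⟨C, hC, h⟩ := S.exists_lintegral_pressure_le
  refine ⟨C ^ (2 * γ)⁻¹, ENNReal.rpow_ne_top_of_nonneg hγ.le hC, fun t ht => ?_⟩
  rw [eLpNorm_eq_lintegral hγ, inv_inv]
  refine ENNReal.rpow_le_rpow (le_trans (lintegral_mono_ae ?_) (h t ht)) hγ.le
  filter_upwards [S.rep_nonneg ht] with x hx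
  rw [ENNReal.rpow_mul]
  refine ENNReal.rpow_le_rpow (le_of_eq ?_) (by linarith)
  rw [Real.enorm_of_nonneg (Real.sqrt_nonneg _), Real.enorm_of_nonneg hx,
    ENNReal.ofReal_rpow_of_nonneg (Real.sqrt_nonneg _) (by norm_num), Real.rpow_two,
    Real.sq_sqrt hx]

lemma exists_kinetic_bound {u : ℝ → Torus d → Vec d}
    (hu : ∀ t ∈ Icc 0 T, IsVelocityAt μ lam γ ϱ v D R ϱ₀ v₀ t (u t)) : ∃ C : ℝ≥0∞, C ≠ ∞ ∧
    ∀ t ∈ Icc 0 T, eLpNorm (fun x => √(rep ϱ₀ ϱ v D R t x) • u t x) 2 volume ≤ C := by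
  obtain ⟨K, hK, h⟩ := S.ae_kinetic_bound
  refine ⟨K ^ (1 / 2 : ℝ), ENNReal.rpow_ne_top_of_nonneg (by norm_num) hK, fun t ht => ?_⟩
  have hk := S.kinetic_of_isVelocityAt ht (hu t ht)
  have hr := S.rep_nonneg ht
  have h1 : ∫ x, rep ϱ₀ ϱ v D R t x * ‖u t x‖ ^ 2 ≤ K.toReal := by
    refine hk.2 _ ?_
    filter_upwards [eventually_nearTime h t] with s hs
    refine (le_abs_self _).trans ?_
    rw [← Real.norm_eq_abs, ← toReal_enorm]
    exact ENNReal.toReal_mono hK ((enorm_integral_le_lintegral_enorm _).trans hs)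
  rw [eLpNorm_eq_lintegral_rpow_enorm_toReal (by norm_num) (by norm_num)]
  simp only [ENNReal.toReal_ofNat]
  refine ENNReal.rpow_le_rpow ?_ (by norm_num)
  calc ∫⁻ x, ‖√(rep ϱ₀ ϱ v D R t x) • u t x‖ₑ ^ (2 : ℝ)
      = ∫⁻ x, ENNReal.ofReal (rep ϱ₀ ϱ v D R t x * ‖u t x‖ ^ 2) := by
        refine lintegral_congr_ae (hr.mono fun x hx => ?_)
        dsimp only
        rw [← ofReal_norm, ENNReal.ofReal_rpow_of_nonneg (norm_nonneg _) (by norm_num),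
          Real.rpow_two, norm_sqrt_smul_sq hx]
    _ = ENNReal.ofReal (∫ x, rep ϱ₀ ϱ v D R t x * ‖u t x‖ ^ 2) :=
        (ofReal_integral_eq_lintegral_ofReal hk.1
          (hr.mono fun x hx => mul_nonneg hx (sq_nonneg _))).symm
    _ ≤ K := by
        rw [← ENNReal.ofReal_toReal hK]
        exact ENNReal.ofReal_le_ofReal h1

lemma aesm_sqrt_rep {t : ℝ} (ht : t ∈ Icc 0 T) :
    AEStronglyMeasurable (fun x => √(rep ϱ₀ ϱ v D R t x)) volume :=
  Real.continuous_sqrt.comp_aestronglyMeasurable (S.integrable_rep ht).aestronglyMeasurable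

lemma continuousOn_density {w : Torus d → ℝ} (hw : MemLp w (pe (1 - γ⁻¹)) volume) :
    ContinuousOn (fun t => ∫ x, rep ϱ₀ ϱ v D R t x * w x) (Icc 0 T) := by
  have hγ := S.one_lt_gamma
  obtain ⟨C, hC, h⟩ := S.exists_eLpNorm_rep_le
  refine continuousOn_pairing (inv_pos.2 (by linarith)) (inv_lt_one_of_one_lt₀ hγ) hC
    (fun t ht => (S.integrable_rep ht).aestronglyMeasurable) h (fun w hw => ?_) hw
  have hI : IntST T (fun t x => ∑ j, ϱ t x * v t x j * pderiv j w x) :=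
    integrable_finsetSum _ fun j _ =>
      (S.intST_density_velocity j).mul_trigPoly (pderiv_mem_trigPoly hw j)
  exact (continuousOn_const.add (continuousOn_primitive_Ioo S.time_pos.le hI.integrableOn)).congr
    fun t ht => S.integral_rep_mul hw ht

lemma continuousOn_momentum {u : ℝ → Torus d → Vec d}
    (hu : ∀ t ∈ Icc 0 T, IsVelocityAt μ lam γ ϱ v D R ϱ₀ v₀ t (u t)) (i : Fin d)
    {w : Torus d → ℝ} (hw : MemLp w (pe (1 - ((2 * γ)⁻¹ + 1 / 2))) volume) :
    ContinuousOn (fun t => ∫ x, rep ϱ₀ ϱ v D R t x * u t x i * w x) (Icc 0 T) := by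
  have hγ := S.one_lt_gamma
  have hγ2 : (2 * γ)⁻¹ < 1 / 2 := by
    rw [← one_div]; exact one_div_lt_one_div_of_lt (by norm_num) (by linarith)
  have hγ0 : 0 < (2 * γ)⁻¹ := by positivity
  obtain ⟨C₁, hC₁, h₁⟩ := S.exists_eLpNorm_sqrt_rep_le
  obtain ⟨C₂, hC₂, h₂⟩ := S.exists_kinetic_bound hu
  refine continuousOn_pairing (by linarith) (by linarith) (ENNReal.mul_ne_top hC₁ hC₂)
    (fun t ht => (hu t ht).integrable i |>.aestronglyMeasurable) (fun t ht => ?_)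
    (fun w hw => ?_) hw
  · have hm := (S.aesm_sqrt_rep ht).smul (hu t ht).meas
    have h3 := eLpNorm_mul_le hγ0.le (by norm_num : (0 : ℝ) ≤ 1 / 2) (S.aesm_sqrt_rep ht)
      (aesm_coord hm i)
    refine le_trans (le_of_eq (eLpNorm_congr_ae ?_)) (h3.trans (mul_le_mul' (h₁ t ht) ?_))
    · filter_upwards [S.rep_nonneg ht] with x hx
      rw [Pi.smul_apply', PiLp.smul_apply, smul_eq_mul, ← mul_assoc, Real.mul_self_sqrt hx]
    · refine le_trans ?_ (h₂ t ht)
      rw [show pe (1 / 2) = 2 by rw [pe_eq (by norm_num)]; norm_num]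
      exact eLpNorm_mono fun x => PiLp.norm_apply_le (√(rep ϱ₀ ϱ v D R t x) • u t x) i
  · exact (S.continuousOn_momentumPairing i hw).congr fun t ht => (hu t ht).pairing i w hw

lemma memLp_rep {t : ℝ} (ht : t ∈ Icc 0 T) :
    MemLp (rep ϱ₀ ϱ v D R t) (ENNReal.ofReal γ) volume := by
  have hγ := S.one_lt_gamma
  obtain ⟨C, hC, h⟩ := S.exists_eLpNorm_rep_le
  rw [← inv_inv γ, ← pe_eq (inv_pos.2 (by linarith))]
  exact ⟨(S.integrable_rep ht).aestronglyMeasurable, (h t ht).trans_lt hC.lt_top⟩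

lemma memLp_momentum {u : ℝ → Torus d → Vec d}
    (hu : ∀ t ∈ Icc 0 T, IsVelocityAt μ lam γ ϱ v D R ϱ₀ v₀ t (u t)) {t : ℝ} (ht : t ∈ Icc 0 T) :
    MemLp (fun x => rep ϱ₀ ϱ v D R t x • u t x) (ENNReal.ofReal (2 * γ / (γ + 1))) volume := by
  have hγ := S.one_lt_gamma
  obtain ⟨C₁, hC₁, h₁⟩ := S.exists_eLpNorm_sqrt_rep_le
  obtain ⟨C₂, hC₂, h₂⟩ := S.exists_kinetic_bound hu
  have m1 : MemLp (fun x => √(rep ϱ₀ ϱ v D R t x)) (pe (2 * γ)⁻¹) volume :=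
    ⟨S.aesm_sqrt_rep ht, (h₁ t ht).trans_lt hC₁.lt_top⟩
  have m2 : MemLp (fun x => √(rep ϱ₀ ϱ v D R t x) • u t x) (pe (1 / 2)) volume := by
    rw [show pe (1 / 2) = 2 by rw [pe_eq (by norm_num)]; norm_num]
    exact ⟨(S.aesm_sqrt_rep ht).smul (hu t ht).meas, (h₂ t ht).trans_lt hC₂.lt_top⟩
  have := holderTriple_pe (a := (2 * γ)⁻¹) (b := 1 / 2) (by positivity) (by norm_num)
  have h := m2.smul (r := pe ((2 * γ)⁻¹ + 1 / 2)) m1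
  rw [pe_eq (by positivity), show ((2 * γ)⁻¹ + 1 / 2)⁻¹ = 2 * γ / (γ + 1) by field_simp; ring] at h
  refine (memLp_congr_ae ?_).1 h
  filter_upwards [S.rep_nonneg ht] with x hx
  simp only [Pi.smul_apply', smul_smul, Real.mul_self_sqrt hx]

/-- The energy at every time. -/
lemma energy_balance {u : ℝ → Torus d → Vec d}
    (hu : ∀ t ∈ Icc 0 T, IsVelocityAt μ lam γ ϱ v D R ϱ₀ v₀ t (u t))
    (huv : ∀ᵐ t ∂(volume.restrict (Ioo 0 T)), u t = v t) (hu0 : u 0 = v₀) {t : ℝ}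
    (ht : t ∈ Icc 0 T) :
    Integrable (energyDensity γ (rep ϱ₀ ϱ v D R t) (u t)) ∧
    energy γ (rep ϱ₀ ϱ v D R t) (u t) + dissipation μ lam D t = energy γ ϱ₀ v₀ := by
  have hγ := S.one_lt_gamma
  have e : ∀ (r : Torus d → ℝ) (u : Torus d → Vec d), energyDensity γ r u
      = fun x => 1 / 2 * (r x * ‖u x‖ ^ 2) + (γ - 1)⁻¹ * r x ^ γ := fun r u => by
    ext x; rw [energyDensity]; ring
  have i1 := (S.kinetic_of_isVelocityAt ht (hu t ht)).1
  have i2 := (S.integral_pressure_rep ht).1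
  obtain ⟨i3, i4⟩ := S.init_energy_parts
  have h0 : (0 : ℝ) ∈ Icc 0 T := ⟨le_rfl, S.time_pos.le⟩
  refine ⟨by rw [e]; exact (i1.const_mul _).add (i2.const_mul _), ?_⟩
  rw [energy, energy, e, e, integral_add (i1.const_mul _) (i2.const_mul _),
    integral_add (i4.const_mul _) (i3.const_mul _), integral_const_mul, integral_const_mul,
    integral_const_mul, integral_const_mul, S.kinetic_balance hu huv ht,
    (S.integral_pressure_rep ht).2, rep_zero, hu0,
    intervalIntegral.integral_sub (intervalIntegrable_of_Ioo S.intST_pressure_tr.integrableOn h0 ht)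
      (intervalIntegrable_of_Ioo S.intST_dissipation.integrableOn h0 ht), dissipation,
    ← S.intST_dissipation.intervalIntegral_eq ht]
  have : γ - 1 ≠ 0 := by linarith
  field_simp
  ring

lemma isWeaklyContinuousRep {u : ℝ → Torus d → Vec d}
    (hu : ∀ t ∈ Icc 0 T, IsVelocityAt μ lam γ ϱ v D R ϱ₀ v₀ t (u t))
    (huv : ∀ᵐ t ∂(volume.restrict (Ioo 0 T)), u t = v t) (hu0 : u 0 = v₀) :
    IsWeaklyContinuousRep γ T ϱ v ϱ₀ v₀ (rep ϱ₀ ϱ v D R) u where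
  density_eq := S.ae_density_eq.mono fun t ht => ht.symm
  velocity_eq := huv.mono fun t ht => by rw [ht]
  nonneg := fun t ht => S.rep_nonneg ht
  density_mem := fun t ht => S.memLp_rep ht
  momentum_mem := fun t ht => S.memLp_momentum hu ht
  density_cont := fun w hw => by
    have hγ := S.one_lt_gamma
    refine S.continuousOn_density ?_
    have h0 : 0 < 1 - γ⁻¹ := sub_pos.2 (inv_lt_one_of_one_lt₀ hγ)
    have : γ - 1 ≠ 0 := by linarith
    rwa [pe_eq h0, show (1 - γ⁻¹)⁻¹ = γ / (γ - 1) by field_simp]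
  momentum_cont := fun w hw => by
    have hγ := S.one_lt_gamma
    have h0 : 0 < 1 - ((2 * γ)⁻¹ + 1 / 2) := by
      have : (2 * γ)⁻¹ < 1 / 2 := by
        rw [← one_div]; exact one_div_lt_one_div_of_lt (by norm_num) (by linarith)
      linarith
    have hne : γ - 1 ≠ 0 := by linarith
    have hpe : ENNReal.ofReal (2 * γ / (γ - 1)) = pe (1 - ((2 * γ)⁻¹ + 1 / 2)) := by
      rw [pe_eq h0]
      congr 1
      rw [show 1 - ((2 * γ)⁻¹ + 1 / 2) = (γ - 1) / (2 * γ) by field_simp; ring, inv_div]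
    rw [hpe] at hw
    have hwi : ∀ i, MemLp (fun x => w x i) (pe (1 - ((2 * γ)⁻¹ + 1 / 2))) volume := fun i =>
      hw.of_le (aesm_coord hw.1 i) (ae_of_all _ fun x => PiLp.norm_apply_le (w x) i)
    have hc := continuousOn_finsetSum Finset.univ fun i _ => S.continuousOn_momentum hu i (hwi i)
    refine hc.congr fun t ht => ?_
    have hmi : ∀ i, Integrable (fun x => rep ϱ₀ ϱ v D R t x * u t x i * w x i) := fun i => by
      have hm := S.memLp_momentum hu ht
      rw [show ENNReal.ofReal (2 * γ / (γ + 1)) = pe ((2 * γ)⁻¹ + 1 / 2) by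
        rw [pe_eq (by positivity)]; congr 1; field_simp; ring] at hm
      have hm' : MemLp (fun x => rep ϱ₀ ϱ v D R t x * u t x i) (pe ((2 * γ)⁻¹ + 1 / 2)) volume :=
        hm.of_le (aesm_coord hm.1 i)
          (ae_of_all _ fun x => PiLp.norm_apply_le (rep ϱ₀ ϱ v D R t x • u t x) i)
      have := memLp_mul (by positivity) h0.le hm' (hwi i)
      rw [add_sub_cancel] at this
      exact memLp_pe_integrable le_rfl this
    dsimp only
    rw [← integral_finsetSum _ fun i _ => hmi i]
    refine integral_congr_ae (ae_of_all _ fun x => ?_)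
    simp only [PiLp.inner_apply, RCLike.inner_apply, conj_trivial, Finset.mul_sum]
    exact Finset.sum_congr rfl fun i _ => by ring
  init_density := by rw [rep_zero]
  init_momentum := by rw [rep_zero, hu0]

end RegularSolution

end

/-! ### The exponents -/

lemma regularSolution_of_memLpLq {μ lam γ p q k l : ℝ} (hγ : 1 < γ) (hT : 0 < T) (hp : 3 < p)
    (hq : 3 < q) (hk₁ : p / (2 * (p - 3)) < k) (hk₂ : p / (p - 2) < k) (hk₃ : (γ - 1) * p / 2 < k)
    (hl₁ : q / (2 * (q - 3)) < l) (hl₂ : q / (q - 2) < l) (hl₃ : (γ - 1) * q / 2 < l)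
    {ϱ : ℝ → Torus d → ℝ} {v : ℝ → Torus d → Vec d} {D : ℝ → Torus d → Mat d}
    {R : ℝ → Torus d → Vec d} {ϱ₀ : Torus d → ℝ} {v₀ : Torus d → Vec d}
    (hsol : IsWeakSolution μ lam γ T ϱ v D ϱ₀ v₀)
    (hϱ : MemLpLq T (ENNReal.ofReal k) (ENNReal.ofReal l) ϱ)
    (hR : HasWeakGrad T (fun t x => √(ϱ t x)) R)
    (hRmem : MemLpLq T (ENNReal.ofReal (2 * p * k / (2 * k * (p - 3) - p)))
      (ENNReal.ofReal (2 * l * q / (2 * l * (q - 3) - q))) R)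
    (hv : MemLpLq T (ENNReal.ofReal p) (ENNReal.ofReal q) v)
    (hD : MemLpLq T (ENNReal.ofReal (p * k / (k * (p - 2) - p)))
      (ENNReal.ofReal (q * l / (l * (q - 2) - q))) D) :
    RegularSolution μ lam γ T p⁻¹ q⁻¹ k⁻¹ l⁻¹ ϱ v D R ϱ₀ v₀ := by
  have aux : ∀ {p k : ℝ}, 3 < p → p / (2 * (p - 3)) < k → p / (p - 2) < k →
      (γ - 1) * p / 2 < k → 0 < k ∧ 0 < 2 * k * (p - 3) - p ∧ 0 < k * (p - 2) - p ∧
        (2 * p * k / (2 * k * (p - 3) - p))⁻¹ = 1 - 3 * p⁻¹ - k⁻¹ / 2 ∧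
        (p * k / (k * (p - 2) - p))⁻¹ = 1 - 2 * p⁻¹ - k⁻¹ ∧
        k⁻¹ / 2 < 1 - 3 * p⁻¹ ∧ k⁻¹ < 1 - 2 * p⁻¹ ∧ (γ - 1) * k⁻¹ < 2 * p⁻¹ := by
    intro p k hp h1 h2 h3
    have hp0 : 0 < p := by linarith
    have hk : 0 < k := lt_trans (div_pos hp0 (by linarith)) h2
    rw [div_lt_iff₀ (by linarith)] at h1 h2 h3
    have a1 : 0 < 2 * k * (p - 3) - p := by linarith
    have a2 : 0 < k * (p - 2) - p := by linarith
    have e1 : (2 * p * k / (2 * k * (p - 3) - p))⁻¹ = 1 - 3 * p⁻¹ - k⁻¹ / 2 := by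
      rw [inv_div]; field_simp
    have e2 : (p * k / (k * (p - 2) - p))⁻¹ = 1 - 2 * p⁻¹ - k⁻¹ := by
      rw [inv_div]; field_simp
    have b1 : 0 < (2 * p * k / (2 * k * (p - 3) - p))⁻¹ := by positivity
    have b2 : 0 < (p * k / (k * (p - 2) - p))⁻¹ := by positivity
    rw [e1] at b1
    rw [e2] at b2
    refine ⟨hk, a1, a2, e1, e2, by linarith, by linarith, ?_⟩
    rw [← div_eq_mul_inv, ← div_eq_mul_inv, div_lt_div_iff₀ hk hp0]
    linarith
  obtain ⟨hk, kp1, kp2, ke1, ke2, kb1, kb2, kb3⟩ := aux hp hk₁ hk₂ hk₃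
  obtain ⟨hl, lp1, lp2, le1, le2, lb1, lb2, lb3⟩ := aux hq hl₁ hl₂ hl₃
  have hp0 : 0 < p := by linarith
  have hq0 : 0 < q := by linarith
  have coord : ∀ {n : Type} [Fintype n] {f : ℝ → Torus d → EuclideanSpace ℝ n},
      AEStronglyMeasurable (fun z : ℝ × Torus d => f z.1 z.2) (spaceTime d T) → ∀ i,
      AEStronglyMeasurable (fun z : ℝ × Torus d => f z.1 z.2 i) (spaceTime d T) :=
    fun {n} _ f hf i =>
      (EuclideanSpace.proj i : EuclideanSpace ℝ n →L[ℝ] ℝ).continuous.comp_aestronglyMeasurable hf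
  have hD2 : MemLpLq T (ENNReal.ofReal 2) (ENNReal.ofReal 2) D := by
    rw [ENNReal.ofReal_ofNat]
    exact hsol.gradient_bound
  refine ⟨hsol, hT, hγ, inv_pos.2 hp0, inv_pos.2 hq0, inv_pos.2 hk, inv_pos.2 hl, kb1, kb2, kb3,
    lb1, lb2, lb3, ?_, ?_, ?_, ?_, hR, ?_⟩
  · exact Mix.of_memLpLq hk hl hϱ hϱ.1 fun _ _ => le_rfl
  · exact fun i => Mix.of_memLpLq hp0 hq0 hv (coord hv.1 i) fun t x => PiLp.norm_apply_le (v t x) i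
  · intro i
    have := Mix.of_memLpLq (by positivity) (by positivity) hD (coord hD.1 i)
      fun t x => PiLp.norm_apply_le (D t x) i
    rwa [ke2, le2] at this
  · intro i
    have := Mix.of_memLpLq two_pos two_pos hD2 (coord hD.1 i)
      fun t x => PiLp.norm_apply_le (D t x) i
    rwa [← one_div] at this
  · intro j
    have := Mix.of_memLpLq (by positivity) (by positivity) hRmem (coord hRmem.1 j)
      fun t x => PiLp.norm_apply_le (R t x) j
    rwa [ke1, show 2 * l * q / (2 * l * (q - 3) - q) = 2 * q * l / (2 * l * (q - 3) - q) by ring,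
      le1] at this

end CNS

end

theorem theorem1p5
    (d : ℕ) (hd : 2 ≤ d)
    (μ lam γ T : ℝ) (hμ : 0 ≤ μ) (hlam : 0 < 2 * μ + d * lam) (hγ : 1 < γ) (hT : 0 < T)
    (p q k l : ℝ) (hp : 3 < p) (hq : max 3 (d * (p - 3) / 2) < q)
    (hk : max (max (p / (2 * (p - 3))) (p / (p - 2)))
      (max ((γ - 1) * p / 2) ((γ - 1) * (d + q) * p / (2 * q - d * (p - 3)))) < k)
    (hl : max (max (q / (2 * (q - 3))) (q / (q - 2))) ((γ - 1) * q / 2) < l)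
    (ϱ : ℝ → CNS.Torus d → ℝ) (v : ℝ → CNS.Torus d → CNS.Vec d)
    (D : ℝ → CNS.Torus d → CNS.Mat d) (R : ℝ → CNS.Torus d → CNS.Vec d)
    (ϱ₀ : CNS.Torus d → ℝ) (v₀ : CNS.Torus d → CNS.Vec d)
    (hsol : CNS.IsWeakSolution μ lam γ T ϱ v D ϱ₀ v₀)
    (hϱ : CNS.MemLpLq T (ENNReal.ofReal k) (ENNReal.ofReal l) ϱ)
    (hR : CNS.HasWeakGrad T (fun t x => Real.sqrt (ϱ t x)) R)
    (hRmem : CNS.MemLpLq T (ENNReal.ofReal (2 * p * k / (2 * k * (p - 3) - p)))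
      (ENNReal.ofReal (2 * l * q / (2 * l * (q - 3) - q))) R)
    (hv : CNS.MemLpLq T (ENNReal.ofReal p) (ENNReal.ofReal q) v)
    (hD : CNS.MemLpLq T (ENNReal.ofReal (p * k / (k * (p - 2) - p)))
      (ENNReal.ofReal (q * l / (l * (q - 2) - q))) D)
    (hv₀ : MemLp v₀ (ENNReal.ofReal (max (2 * γ / (γ - 1)) (q / 2))) volume) :
    ∃ (r : ℝ → CNS.Torus d → ℝ) (u : ℝ → CNS.Torus d → CNS.Vec d),
      CNS.IsWeaklyContinuousRep γ T ϱ v ϱ₀ v₀ r u ∧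
      ∀ t ∈ Icc 0 T,
        Integrable (CNS.energyDensity γ (r t) (u t)) ∧
        Integrable (fun z : ℝ × CNS.Torus d =>
          μ * ‖D z.1 z.2‖ ^ 2 + (μ + lam) * CNS.tr (D z.1 z.2) ^ 2) (CNS.spaceTime d t) ∧
        CNS.energy γ (r t) (u t) + CNS.dissipation μ lam D t = CNS.energy γ ϱ₀ v₀ := by
  have hS := CNS.regularSolution_of_memLpLq hγ hT hp (lt_of_le_of_lt (le_max_left _ _) hq)
    (lt_of_le_of_lt (le_max_left _ _) (lt_of_le_of_lt (le_max_left _ _) hk))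
    (lt_of_le_of_lt (le_max_right _ _) (lt_of_le_of_lt (le_max_left _ _) hk))
    (lt_of_le_of_lt (le_max_left _ _) (lt_of_le_of_lt (le_max_right _ _) hk))
    (lt_of_le_of_lt (le_max_left _ _) (lt_of_le_of_lt (le_max_left _ _) hl))
    (lt_of_le_of_lt (le_max_right _ _) (lt_of_le_of_lt (le_max_left _ _) hl))
    (lt_of_le_of_lt (le_max_right _ _) hl) hsol hϱ hR hRmem hv hD
  obtain ⟨u, hu, huv, hu0⟩ := hS.exists_velocity_rep
  refine ⟨CNS.rep ϱ₀ ϱ v D R, u, hS.isWeaklyContinuousRep hu huv hu0, fun t ht => ?_⟩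
  obtain ⟨h1, h2⟩ := hS.energy_balance hu huv hu0 ht
  exact ⟨h1, hS.intST_dissipation.mono ht.2, h2⟩
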